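/- **Setting.** Let $\pi : Y \to X$ be a smooth, locally trivial fibre bundle of finite-dimensional manifolds with $\dim X = n+1$ ($n \ge 0$) and typical fibre of dimension $N \ge 0$. For $y \in Y$ and $x = \pi(y)$ let $J^1_yY$ be the affine space of linear maps $\gamma : T_xX \to T_yY$ with $T\pi \circ \gamma = \mathrm{id}$; these are the fibres over $Y$ of the first jet bundle $J^1Y$. Let $Z_y$ be the space of $(n+1)$-forms $z$ on $T_yY$ with $v \lrcorner w \lrcorner z = 0$ for all vertical $v, w \in T_yY$; these are the fibres of the bundle $\pi_{YZ} : Z \to Y$. The map $\Phi(z)(\gamma) = \gamma^*z$ identifies $Z_y$ with the affine dual $J^1_yY^\star$, the space of affine maps $J^1_yY \to \Lambda^{n+1}T_x^*X$. The canonical $(n+1)$-form on $Z$ is $\Theta(z)(u_0,\dots,u_n) = z(T\pi_{YZ}u_0,\dots,T\pi_{YZ}u_n)$. Let $\mathcal L$ be a Lagrangian density, i.e. a smooth bundle map $J^1Y \to \Lambda^{n+1}T^*X$ over $X$. Its covariant Legendre transform $\mathbb F\mathcal L : J^1Y \to J^1Y^\star \cong Z$ is given, for $\gamma,\gamma' \in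 J^1_yY$, by $$\langle \mathbb F\mathcal L(\gamma),\gamma'\rangle = \mathcal L(\gamma) + \frac{d}{d\varepsilon}\Big|_{\varepsilon=0}\mathcal L\big(\gamma+\varepsilon(\gamma'-\gamma)\big).$$ Put $\Theta_{\mathcal L} = \mathbb F\mathcal L^*\Theta$ (the Cartan form) and $\Omega_{\mathcal L} = -d\Theta_{\mathcal L}$. Let $\mathcal G$ be a Lie group, possibly infinite-dimensional (modelled on a Hausdorff locally convex real topological vector space, with smoothness in the sense of Michal and Bastiani), with Lie algebra $\mathfrak g = T_1\mathcal G$. Let $\mathcal G$ act smoothly on $X$ and on $Y$, each $\eta \in \mathcal G$ acting on $X$ by a diffeomorphism $\eta_X$ and on $Y$ by a bundle automorphism $\eta_Y$ with $\pi\circ\eta_Y = \eta_X\circ\pi$. The lifted actions are $\eta_{J^1Y}(\gamma) = T\eta_Y\circ\gamma\circ T\eta_X^{-1}$ on $J^1Y$ and $\eta_Z(z) = (\eta_Y^{-1})^*z$ on $Z$; for $\xi \in \mathfrak g$ let $\xi_{J^1Y}$ and $\xi_Z$ be their infinitesimal generators. Let $J(\xi) = \xi_Z \lrcorner \Theta$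 be the special covariant momentum map on $Z$, and put $J^{\mathcal L}(\xi) = \mathbb F\mathcal L^*J(\xi)$, an $n$-form on $J^1Y$. **Proposition 4.6.** Suppose that $\mathcal L$ is equivariant: $\mathcal L(\eta_{J^1Y}(\gamma)) = (\eta_X^{-1})^*\mathcal L(\gamma)$ for all $\eta\in\mathcal G$ and $\gamma\in J^1Y$. Then: (i) $\mathbb F\mathcal L$ is equivariant: $\eta_Z\circ\mathbb F\mathcal L = \mathbb F\mathcal L\circ\eta_{J^1Y}$ for every $\eta\in\mathcal G$. (ii) The Cartan form is a smooth form and is invariant: $\eta_{J^1Y}^*\Theta_{\mathcal L} = \Theta_{\mathcal L}$ for every $\eta\in\mathcal G$. (iii) $J^{\mathcal L}$ is a covariant momentum map for the lifted action of $\mathcal G$ on $J^1Y$ relative to $\Omega_{\mathcal L}$: for each $\gamma$ the map $\xi\mapsto J^{\mathcal L}(\xi)(\gamma)$ is linear and continuous on $\mathfrak g$, each $J^{\mathcal L}(\xi)$ is a smooth $n$-form on $J^1Y$, and $$\xi_{J^1Y}\lrcorner\Omega_{\mathcal L} = dJ^{\mathcal L}(\xi)\qquad\text{for all }\xi\in\mathfrak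 g.$$ Moreover $J^{\mathcal L}(\xi) = \xi_{J^1Y}\lrcorner\Theta_{\mathcal L}$ for all $\xi\in\mathfrak g$. -/

import Mathlib

open scoped Manifold ContDiff Topology
noncomputable section
namespace FieldTheory
universe u v

/-- The model space of the base `X`, of dimension `n + 1`. -/
abbrev BaseModel (n : ℕ) := EuclideanSpace ℝ (Fin (n + 1))
/-- The model space of the fibres of `Y → X`, of dimension `N`. -/
abbrev FiberModel (N : ℕ) := EuclideanSpace ℝ (Fin N)
/-- The model space of the total space `Y`, of dimension `n + 1 + N`. -/
abbrev TotalModel (n N : ℕ) := BaseModel n × FiberModel N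

section Dual
variable {n : ℕ} {T : Type*} [NormedAddCommGroup T] [NormedSpace ℝ T]
  (P : T →L[ℝ] BaseModel n)

/-- A form killed by any two `P`-vertical vectors is determined by its pullbacks along the right
inverses of `P`. -/
theorem phase_eq_zero {γ₀ : BaseModel n →L[ℝ] T} (h₀ : ∀ v, P (γ₀ v) = v)
    {z : T [⋀^Fin (n + 1)]→L[ℝ] ℝ}
    (hz : ∀ (u : Fin (n + 1) → T) (i j : Fin (n + 1)), i ≠ j → P (u i) = 0 → P (u j) = 0 → z u = 0)
    (h : ∀ γ : BaseModel n →L[ℝ] T, (∀ v, P (γ v) = v) → z.compContinuousLinearMap γ = 0) :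
    z = 0 := by
  classical
  have h0 : ∀ b : Fin (n + 1) → BaseModel n, z (fun i => γ₀ (b i)) = 0 := fun b =>
    DFunLike.congr_fun (h γ₀ h₀) b
  have h1 : ∀ (b : Fin (n + 1) → BaseModel n) (k : Fin (n + 1)) (w : T), P w = 0 →
      z (Function.update (fun i => γ₀ (b i)) k w) = 0 := by
    intro b k w hw
    let p : Submodule ℝ (BaseModel n) := Submodule.span ℝ (Set.range fun i => b (k.succAbove i))
    have hp : p < ⊤ := by
      refine lt_top_iff_ne_top.2 fun hp => ?_
      have h2 := finrank_range_le_card (R := ℝ) (fun i => b (k.succAbove i))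
      rw [Set.finrank, show Submodule.span ℝ (Set.range fun i => b (k.succAbove i)) = ⊤ from hp,
        finrank_top] at h2
      simp at h2
    obtain ⟨α, hα, hpα⟩ := Submodule.exists_le_ker_of_lt_top p hp
    obtain ⟨c₀, hc₀⟩ : ∃ c, α c ≠ 0 := by
      by_contra hc; push Not at hc; exact hα (LinearMap.ext hc)
    have hb : ∀ i, i ≠ k → α (b i) = 0 := by
      intro i hi
      obtain ⟨j, rfl⟩ := Fin.exists_succAbove_eq hi
      exact hpα (Submodule.subset_span ⟨j, rfl⟩)
    let c := (α c₀)⁻¹ • c₀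
    have hc : α c = 1 := by simp [c, hc₀]
    let γ : BaseModel n →L[ℝ] T := γ₀ + (LinearMap.toContinuousLinearMap α).smulRight w
    have hγ : ∀ v, γ v = γ₀ v + α v • w := fun v => rfl
    have e1 := DFunLike.congr_fun (h γ fun v => by rw [hγ]; simp [h₀, hw]) (Function.update b k c)
    have e2 : (fun i => γ (Function.update b k c i)) =
        Function.update (fun i => γ₀ (b i)) k (γ₀ c + w) := by
      funext i
      by_cases hi : i = k
      · subst hi; simp [hγ, hc]
      · simp [hi, hγ, hb i hi]
    have e3 : Function.update (fun i => γ₀ (b i)) k (γ₀ c) =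
        fun i => γ₀ (Function.update b k c i) := by
      funext i
      by_cases hi : i = k
      · subst hi; simp
      · simp [hi]
    have e4 : z (fun i => γ (Function.update b k c i)) = 0 := e1
    rw [e2, z.map_update_add, e3, h0, zero_add] at e4
    exact e4
  ext u
  have hu : u = (fun i => γ₀ (P (u i))) + fun i => u i - γ₀ (P (u i)) := by
    funext i; simp
  have hw : ∀ i, P (u i - γ₀ (P (u i))) = 0 := fun i => by simp [h₀]
  rw [hu, z.map_add_univ]
  refine Finset.sum_eq_zero fun s _ => ?_
  by_cases hs : ∃ i j, i ≠ j ∧ i ∉ s ∧ j ∉ s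
  · obtain ⟨i, j, hij, hi, hj⟩ := hs
    exact hz _ i j hij (by simp [hi, h₀]) (by simp [hj, h₀])
  · push Not at hs
    by_cases hs' : ∃ k, k ∉ s
    · obtain ⟨k, hk⟩ := hs'
      have : s.piecewise (fun i => γ₀ (P (u i))) (fun i => u i - γ₀ (P (u i))) =
          Function.update (fun i => γ₀ (P (u i))) k (u k - γ₀ (P (u k))) := by
        funext i
        by_cases hi : i = k
        · subst hi; simp [hk]
        · have : i ∈ s := by by_contra h'; exact hk (hs i k hi h')
          simp [hi, this]
      rw [this]
      exact h1 _ k _ (hw k)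
    · push Not at hs'
      have : s.piecewise (fun i => γ₀ (P (u i))) (fun i => u i - γ₀ (P (u i))) =
          fun i => γ₀ (P (u i)) := by
        funext i; simp [hs' i]
      rw [this]
      exact h0 _

/-- The determinant form on the base model. -/
def volForm (n : ℕ) : BaseModel n [⋀^Fin (n + 1)]→L[ℝ] ℝ :=
  { (EuclideanSpace.basisFun (Fin (n + 1)) ℝ).toBasis.det with
    cont := by
      change Continuous fun v => (EuclideanSpace.basisFun (Fin (n + 1)) ℝ).toBasis.det v
      simp only [Module.Basis.det_apply]
      refine Continuous.matrix_det (continuous_pi fun i => continuous_pi fun k => ?_)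
      exact (EuclideanSpace.proj i : BaseModel n →L[ℝ] ℝ).continuous.comp (continuous_apply k) }

theorem volForm_apply (v : Fin (n + 1) → BaseModel n) :
    volForm n v = Matrix.det (Matrix.of fun i k => v k i) := by
  change (EuclideanSpace.basisFun (Fin (n + 1)) ℝ).toBasis.det v = _
  rw [Module.Basis.det_apply]
  rfl

theorem form_ext {f g : BaseModel n [⋀^Fin (n + 1)]→L[ℝ] ℝ}
    (h : f (fun i => EuclideanSpace.basisFun (Fin (n + 1)) ℝ i) =
      g (fun i => EuclideanSpace.basisFun (Fin (n + 1)) ℝ i)) : f = g := by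
  refine ContinuousAlternatingMap.toAlternatingMap_injective ?_
  rw [AlternatingMap.eq_smul_basis_det (EuclideanSpace.basisFun (Fin (n + 1)) ℝ).toBasis
    f.toAlternatingMap, AlternatingMap.eq_smul_basis_det
    (EuclideanSpace.basisFun (Fin (n + 1)) ℝ).toBasis g.toAlternatingMap]
  congr 1

/-- Every affine map from the right inverses of `P` to `(n+1)`-forms is `γ ↦ γ^* z`, for a form `z`
killed by any two `P`-vertical vectors. -/
theorem exists_phase [FiniteDimensional ℝ T] (A : AffineSubspace ℝ (BaseModel n →L[ℝ] T))
    (hA : ∀ γ, γ ∈ A ↔ ∀ v, P (γ v) = v) [hne : Nonempty A]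
    (l : A →ᵃ[ℝ] (BaseModel n [⋀^Fin (n + 1)]→L[ℝ] ℝ)) :
    ∃ z : T [⋀^Fin (n + 1)]→L[ℝ] ℝ,
      (∀ (u : Fin (n + 1) → T) (i j : Fin (n + 1)), i ≠ j → P (u i) = 0 → P (u j) = 0 →
        z u = 0) ∧
      ∀ γ : A, z.compContinuousLinearMap (γ : BaseModel n →L[ℝ] T) = l γ := by
  classical
  obtain ⟨γ₀⟩ := id hne
  have h₀ := (hA γ₀).1 γ₀.2
  have hdir : ∀ σ : BaseModel n →L[ℝ] T, (∀ v, P (σ v) = 0) → σ ∈ A.direction := by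
    intro σ hσ
    have h1 : (γ₀ : BaseModel n →L[ℝ] T) + σ ∈ A := (hA _).2 fun v => by simp [h₀, hσ]
    have := A.vsub_mem_direction h1 γ₀.2
    simpa using this
  let e := fun i => EuclideanSpace.basisFun (Fin (n + 1)) ℝ i
  let S : Fin (n + 1) → T →ₗ[ℝ] A.direction := fun j =>
    { toFun := fun t => ⟨(EuclideanSpace.proj j : BaseModel n →L[ℝ] ℝ).smulRight
          (t - (γ₀ : BaseModel n →L[ℝ] T) (P t)), hdir _ fun v => by simp [h₀]⟩
      map_add' := fun s t => by
        refine Subtype.ext (ContinuousLinearMap.ext fun v => ?_)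
        simp only [ContinuousLinearMap.smulRight_apply, Submodule.coe_add,
          _root_.add_apply, map_add]
        rw [← smul_add]; congr 1; abel
      map_smul' := fun c t => by
        refine Subtype.ext (ContinuousLinearMap.ext fun v => ?_)
        simp only [ContinuousLinearMap.smulRight_apply, Submodule.coe_smul,
          _root_.smul_apply, map_smul, RingHom.id_apply]
        rw [← smul_sub, smul_comm] }
  have hS : ∀ j t v, (S j t : BaseModel n →L[ℝ] T) v =
    v j • (t - (γ₀ : BaseModel n →L[ℝ] T) (P t)) := fun _ _ _ => rfl
  let θ : Fin (n + 1) → T →L[ℝ] ℝ := fun j => LinearMap.toContinuousLinearMap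
    { toFun := fun t => l.linear (S j t) e
      map_add' := fun s t => by rw [map_add, map_add]; rfl
      map_smul' := fun c t => by rw [map_smul, map_smul]; rfl }
  have hθ : ∀ j t, θ j t = l.linear (S j t) e := fun _ _ => rfl
  let Q : Fin (n + 1) → T →L[ℝ] BaseModel n := fun j =>
    P + ((θ j) - (EuclideanSpace.proj j : BaseModel n →L[ℝ] ℝ).comp P).smulRight (e j)
  have hQ : ∀ j t, Q j t = P t + (θ j t - P t j) • e j := fun _ _ => rfl
  refine ⟨(l γ₀).compContinuousLinearMap P +
    ∑ j, (volForm n).compContinuousLinearMap (Q j), ?_, ?_⟩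
  · intro u i k hik hi hk
    rw [ContinuousAlternatingMap.add_apply, ContinuousAlternatingMap.sum_apply]
    have e1 : (l γ₀).compContinuousLinearMap P u = 0 :=
      (l γ₀).map_coord_zero i (by simpa using hi)
    rw [e1, zero_add]
    refine Finset.sum_eq_zero fun j _ => ?_
    change volForm n (fun m => Q j (u m)) = 0
    have hi' : Q j (u i) = θ j (u i) • e j := by rw [hQ, hi]; simp
    have hk' : Q j (u k) = θ j (u k) • e j := by rw [hQ, hk]; simp
    have : (fun m => Q j (u m)) = Function.update (Function.update (fun m => Q j (u m)) i
        (θ j (u i) • e j)) k (θ j (u k) • e j) := by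
      rw [← hi', ← hk', Function.update_eq_self, Function.update_eq_self]
    rw [this, ContinuousAlternatingMap.map_update_smul, Function.update_comm hik,
      ContinuousAlternatingMap.map_update_smul]
    rw [(volForm n).map_eq_zero_of_eq _ (i := i) (j := k) (by simp [hik.symm]) hik]
    simp
  · intro γ
    have hγ := (hA γ).1 γ.2
    refine form_ext ?_
    change ((l γ₀).compContinuousLinearMap P +
      ∑ j, (volForm n).compContinuousLinearMap (Q j)) (fun i => (γ : BaseModel n →L[ℝ] T) (e i))
        = l γ e
    rw [ContinuousAlternatingMap.add_apply, ContinuousAlternatingMap.sum_apply]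
    have e1 : (l γ₀).compContinuousLinearMap P (fun i => (γ : BaseModel n →L[ℝ] T) (e i)) =
        l γ₀ e := by
      change l γ₀ (fun i => P ((γ : BaseModel n →L[ℝ] T) (e i))) = _
      simp only [hγ]
    have e2 : ∀ j, (volForm n).compContinuousLinearMap (Q j)
        (fun i => (γ : BaseModel n →L[ℝ] T) (e i)) = θ j ((γ : BaseModel n →L[ℝ] T) (e j)) := by
      intro j
      change volForm n (fun i => Q j ((γ : BaseModel n →L[ℝ] T) (e i))) = _
      have : (Matrix.of fun i k => Q j ((γ : BaseModel n →L[ℝ] T) (e k)) i) =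
          (1 : Matrix (Fin (n + 1)) (Fin (n + 1)) ℝ).updateRow j
            (fun k => θ j ((γ : BaseModel n →L[ℝ] T) (e k))) := by
        ext i k
        rw [Matrix.of_apply, hQ, hγ]
        by_cases hij : i = j
        · subst hij; simp [e]
        · simp [hij, e, Matrix.one_apply]
      rw [volForm_apply, this, ← Matrix.cramer_transpose_apply]
      simp
    have e3 : γ -ᵥ γ₀ = ∑ j, S j ((γ : BaseModel n →L[ℝ] T) (e j)) := by
      refine Subtype.ext (ContinuousLinearMap.ext fun v => ?_)
      have hv : v = ∑ j, v j • e j := by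
        simpa [e] using ((EuclideanSpace.basisFun (Fin (n + 1)) ℝ).sum_repr v).symm
      rw [AffineSubspace.coe_vsub, AddSubmonoidClass.coe_finsetSum, _root_.sum_apply]
      simp only [vsub_eq_sub, _root_.sub_apply]
      conv_lhs => rw [hv]
      rw [map_sum, map_sum, ← Finset.sum_sub_distrib]
      refine Finset.sum_congr rfl fun j _ => ?_
      rw [map_smul, map_smul, ← smul_sub]
      rw [hS, hγ]
    have e4 : l γ = l.linear (γ -ᵥ γ₀) + l γ₀ := by
      rw [AffineMap.linearMap_vsub]; simp
    rw [e1, e4, e3, map_sum, ContinuousAlternatingMap.add_apply,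
      ContinuousAlternatingMap.sum_apply, add_comm]
    congr 1
    exact Finset.sum_congr rfl fun j _ => (e2 j).trans (hθ j _)
end Dual

section Forms
variable {H : Type*} [NormedAddCommGroup H] [NormedSpace ℝ H]
  {M : Type*} [TopologicalSpace M] [ChartedSpace H M]
  {H' : Type*} [NormedAddCommGroup H'] [NormedSpace ℝ H']
  {M' : Type*} [TopologicalSpace M'] [ChartedSpace H' M'] {k : ℕ}

variable (H M) in
/-- Differential forms of degree `k` on a manifold `M` modelled on `H` (smoothness is the separate
predicate `DForm.IsSmooth`). -/
abbrev DForm (k : ℕ) := ∀ x : M, TangentSpace 𝓘(ℝ, H) x [⋀^Fin k]→L[ℝ] ℝ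

namespace DForm

/-- The pullback `f^* θ`. -/
def pullback (f : M → M') (θ : DForm H' M' k) : DForm H M k :=
  fun x => (θ (f x)).compContinuousLinearMap (mfderiv 𝓘(ℝ, H) 𝓘(ℝ, H') f x)

/-- The interior product `V ⌟ θ = θ(V, ·, …, ·)`. -/
def interior (V : ∀ x : M, TangentSpace 𝓘(ℝ, H) x) (θ : DForm H M (k + 1)) : DForm H M k :=
  fun x => ContinuousAlternatingMap.curryLeft (E := H) (θ x) (V x)

/-- The local representative `(φ⁻¹)^* θ` of a form in a chart `φ`. -/
def inChart (φ : OpenPartialHomeomorph M H) (θ : DForm H M k) : H → H [⋀^Fin k]→L[ℝ] ℝ :=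
  fun p => (θ (φ.symm p)).compContinuousLinearMap (mfderiv 𝓘(ℝ, H) 𝓘(ℝ, H) φ.symm p)

/-- A form is smooth when its local representatives are. -/
def IsSmooth (θ : DForm H M k) : Prop :=
  ∀ x : M, ContDiffOn ℝ ∞ (θ.inChart (chartAt H x)) (chartAt H x).target

/-- The exterior derivative `dθ`, computed at each point in the preferred chart there. -/
def d (θ : DForm H M k) : DForm H M (k + 1) :=
  fun x => (extDeriv (θ.inChart (chartAt H x)) (chartAt H x x)).compContinuousLinearMap
    (mfderiv 𝓘(ℝ, H) 𝓘(ℝ, H) (chartAt H x) x)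

end DForm
end Forms

section Groups
universe w w'

/-- `C^k` maps, in the sense of Michal and Bastiani, between real topological vector spaces: `f` is
`C⁰` on `s` if it is continuous there, and `C^{k+1}` if it is continuous and has all directional
derivatives `df(x, v)` for `x ∈ s`, and `df` is `C^k` on `s × E`. -/
def BastianiContDiffOn {F : Type w'} [AddCommGroup F] [Module ℝ F] [TopologicalSpace F] :
    ∀ (_ : ℕ) {E : Type w} [AddCommGroup E] [Module ℝ E] [TopologicalSpace E]
      (_ : E → F) (_ : Set E), Prop
  | 0, _, _, _, _, f, s => ContinuousOn f s
  | k + 1, E, _, _, _, f, s => ContinuousOn f s ∧ ∃ df : E × E → F,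
      (∀ x ∈ s, ∀ v : E, Filter.Tendsto (fun t : ℝ => t⁻¹ • (f (x + t • v) - f x)) (𝓝[≠] 0)
        (𝓝 (df (x, v)))) ∧
      BastianiContDiffOn k df (s ×ˢ Set.univ)

/-- Smooth maps in the sense of Michal and Bastiani. -/
def BastianiSmoothOn {F : Type w'} [AddCommGroup F] [Module ℝ F] [TopologicalSpace F]
    {E : Type w} [AddCommGroup E] [Module ℝ E] [TopologicalSpace E] (f : E → F) (s : Set E) :
    Prop :=
  ∀ k : ℕ, BastianiContDiffOn k f s

section
variable (E F H : Type*) [AddCommGroup E] [Module ℝ E] [TopologicalSpace E]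
  [AddCommGroup F] [Module ℝ F] [TopologicalSpace F]
  [AddCommGroup H] [Module ℝ H] [TopologicalSpace H]
  {A B C : Type*} [TopologicalSpace A] [ChartedSpace E A] [TopologicalSpace B] [ChartedSpace F B]
  [TopologicalSpace C] [ChartedSpace H C]

/-- `f : A × B → C` is continuous, and smooth in all charts. -/
structure IsBastianiSmooth₂ (f : A → B → C) : Prop where
  continuous : Continuous fun p : A × B => f p.1 p.2
  smooth : ∀ φ ∈ atlas E A, ∀ ψ ∈ atlas F B, ∀ χ ∈ atlas H C,
    BastianiSmoothOn (fun p : E × F => χ (f (φ.symm p.1) (ψ.symm p.2)))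
      {p | p.1 ∈ φ.target ∧ p.2 ∈ ψ.target ∧ f (φ.symm p.1) (ψ.symm p.2) ∈ χ.source}

/-- `f : A → C` is continuous, and smooth in all charts. -/
structure IsBastianiSmooth (f : A → C) : Prop where
  continuous : Continuous f
  smooth : ∀ φ ∈ atlas E A, ∀ χ ∈ atlas H C,
    BastianiSmoothOn (fun p : E => χ (f (φ.symm p)))
      {p | p ∈ φ.target ∧ f (φ.symm p) ∈ χ.source}
end

variable (𝔤 : Type*) [AddCommGroup 𝔤] [Module ℝ 𝔤] [TopologicalSpace 𝔤]
  (G : Type*) [Group G] [TopologicalSpace G] [ChartedSpace 𝔤 G]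

/-- A (possibly infinite-dimensional) Lie group `G`, modelled on the topological vector space `𝔤`:
a group and smooth manifold with smooth multiplication and inversion. The tangent space of `G` at
`1`, i.e. the Lie algebra, is identified with `𝔤` by the preferred chart at `1`. -/
class IsLieGroup : Prop where
  compatible : ∀ φ ∈ atlas 𝔤 G, ∀ φ' ∈ atlas 𝔤 G,
    BastianiSmoothOn (φ' ∘ φ.symm) (φ.symm.trans φ').source
  mul : IsBastianiSmooth₂ 𝔤 𝔤 𝔤 fun g h : G => g * h
  inv : IsBastianiSmooth 𝔤 𝔤 fun g : G => g⁻¹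

variable {𝔤 G} in
/-- The infinitesimal generator `m ↦ d/dt|₀ act (c t) m` of an action on a manifold `M`, where `c`
is a curve in `G` through `1` with velocity `ξ`. -/
def generator {H : Type*} [NormedAddCommGroup H] [NormedSpace ℝ H]
    {M : Type*} [TopologicalSpace M] [ChartedSpace H M] (act : G → M → M) (ξ : 𝔤) (m : M) :
    TangentSpace 𝓘(ℝ, H) m :=
  mfderiv 𝓘(ℝ, ℝ) 𝓘(ℝ, H)
    (fun t : ℝ => act ((chartAt 𝔤 (1 : G)).symm (chartAt 𝔤 (1 : G) 1 + t • ξ)) m) 0 (1 : ℝ)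

end Groups

section Bundle
variable (n N : ℕ) {X : Type u} [TopologicalSpace X] [ChartedSpace (BaseModel n) X]
  {Y : Type v} [TopologicalSpace Y] [ChartedSpace (TotalModel n N) Y]

/-- `π : Y → X` is a smooth locally trivial fibre bundle, with some manifold `Fib` as its typical
fibre. -/
class IsSmoothFiberBundle (π : Y → X) : Prop where
  contMDiff : ContMDiff 𝓘(ℝ, TotalModel n N) 𝓘(ℝ, BaseModel n) ∞ π
  locally_trivial : ∃ (Fib : Type v) (_ : TopologicalSpace Fib)
    (_ : ChartedSpace (FiberModel N) Fib), IsManifold 𝓘(ℝ, FiberModel N) ∞ Fib ∧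
    ∀ x : X, ∃ e : Bundle.Trivialization Fib π, x ∈ e.baseSet ∧
      ContMDiffOn 𝓘(ℝ, TotalModel n N) (𝓘(ℝ, BaseModel n).prod 𝓘(ℝ, FiberModel N)) ∞
        e e.source ∧
      ContMDiffOn (𝓘(ℝ, BaseModel n).prod 𝓘(ℝ, FiberModel N)) 𝓘(ℝ, TotalModel n N) ∞
        e.toOpenPartialHomeomorph.symm e.target

/-- The tangent map `T_y π : T_y Y → T_{π y} X`. -/
abbrev tproj (π : Y → X) (y : Y) :
    TangentSpace 𝓘(ℝ, TotalModel n N) y →L[ℝ] TangentSpace 𝓘(ℝ, BaseModel n) (π y) :=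
  mfderiv 𝓘(ℝ, TotalModel n N) 𝓘(ℝ, BaseModel n) π y

/-- Smooth bundle coordinates `(x^μ, y^A)` on an open subset of `Y`, over coordinates `x^μ` on an
open subset of `X`. -/
structure AdaptedChart (π : Y → X) where
  tot : OpenPartialHomeomorph Y (TotalModel n N)
  base : OpenPartialHomeomorph X (BaseModel n)
  smooth_tot : ContMDiffOn 𝓘(ℝ, TotalModel n N) 𝓘(ℝ, TotalModel n N) ∞ tot tot.source
  smooth_tot_symm : ContMDiffOn 𝓘(ℝ, TotalModel n N) 𝓘(ℝ, TotalModel n N) ∞ tot.symm tot.target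
  smooth_base : ContMDiffOn 𝓘(ℝ, BaseModel n) 𝓘(ℝ, BaseModel n) ∞ base base.source
  smooth_base_symm : ContMDiffOn 𝓘(ℝ, BaseModel n) 𝓘(ℝ, BaseModel n) ∞ base.symm base.target
  proj_mem : ∀ y ∈ tot.source, π y ∈ base.source
  fst_tot : ∀ y ∈ tot.source, (tot y).1 = base (π y)

variable {n N}

theorem exists_adaptedChart [IsManifold 𝓘(ℝ, BaseModel n) ∞ X] (π : Y → X)
    [h : IsSmoothFiberBundle n N π] (y : Y) : ∃ a : AdaptedChart n N π, y ∈ a.tot.source := by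
  obtain ⟨Fib, _, _, hF, he⟩ := h.locally_trivial
  obtain ⟨e, hy, h1, h2⟩ := he (π y)
  let φ := chartAt (BaseModel n) (π y)
  let χ := chartAt (FiberModel N) (e y).2
  have hφ : ContMDiffOn 𝓘(ℝ, BaseModel n) 𝓘(ℝ, BaseModel n) ∞ φ φ.source := contMDiffOn_chart
  have hφ' : ContMDiffOn 𝓘(ℝ, BaseModel n) 𝓘(ℝ, BaseModel n) ∞ φ.symm φ.target :=
    contMDiffOn_chart_symm
  have hχ : ContMDiffOn 𝓘(ℝ, FiberModel N) 𝓘(ℝ, FiberModel N) ∞ χ χ.source := contMDiffOn_chart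
  have hχ' : ContMDiffOn 𝓘(ℝ, FiberModel N) 𝓘(ℝ, FiberModel N) ∞ χ.symm χ.target :=
    contMDiffOn_chart_symm
  have hys : y ∈ e.source := e.mem_source.2 hy
  refine ⟨⟨e.toOpenPartialHomeomorph.trans (φ.prod χ), φ, ?_, ?_, hφ, hφ', ?_, ?_⟩, ?_⟩
  · have hs : (e.toOpenPartialHomeomorph.trans (φ.prod χ)).source ⊆ e.source :=
      fun z hz => by simp at hz; exact hz.1
    have ht : (e.toOpenPartialHomeomorph.trans (φ.prod χ)).source ⊆
      e ⁻¹' (φ.source ×ˢ χ.source) := fun z hz => by simp at hz; exact hz.2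
    have := (hφ.prodMap hχ).comp (h1.mono hs) ht
    rw [chartedSpaceSelf_prod, ← modelWithCornersSelf_prod] at this
    exact this
  · have hs : (e.toOpenPartialHomeomorph.trans (φ.prod χ)).target ⊆ φ.target ×ˢ χ.target :=
      fun z hz => by rw [OpenPartialHomeomorph.trans_target] at hz; exact hz.1
    have ht : (e.toOpenPartialHomeomorph.trans (φ.prod χ)).target ⊆
      Prod.map φ.symm χ.symm ⁻¹' e.target :=
        fun z hz => by rw [OpenPartialHomeomorph.trans_target] at hz; exact hz.2
    have := h2.comp ((hφ'.prodMap hχ').mono hs) ht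
    rw [chartedSpaceSelf_prod, ← modelWithCornersSelf_prod] at this
    exact this
  · intro z hz
    have hz' := hz
    simp at hz'
    have : (e z).1 = π z := e.coe_fst hz'.1
    rw [← this]; exact hz'.2.1
  · intro z hz
    have hz' := hz
    simp at hz'
    have : (e z).1 = π z := e.coe_fst hz'.1
    simp [this]
  · simp
    refine ⟨hys, ?_, mem_chart_source _ _⟩
    have : (e y).1 = π y := e.coe_fst hys
    rw [this]; exact mem_chart_source _ _

variable (n N) in
/-- The fibre `J¹_y Y = {γ : T_x X → T_y Y linear | T_y π ∘ γ = id}`, `x = π y`, of the first jet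
bundle, an affine space. -/
def jetFiber (π : Y → X) (y : Y) : AffineSubspace ℝ
    (TangentSpace 𝓘(ℝ, BaseModel n) (π y) →L[ℝ] TangentSpace 𝓘(ℝ, TotalModel n N) y) where
  carrier := {γ | (tproj n N π y).comp γ = ContinuousLinearMap.id ℝ _}
  smul_vsub_vadd_mem' := by
    intro c γ₁ γ₂ γ₃ h₁ h₂ h₃
    simp only [Set.mem_ofPred_eq, vsub_eq_sub, vadd_eq_add, ContinuousLinearMap.comp_add,
      ContinuousLinearMap.comp_smul, ContinuousLinearMap.comp_sub] at *
    rw [h₁, h₂, h₃]; simp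

variable (n N) in
/-- The first jet bundle `J¹Y`, as a bundle over `Y`. -/
@[ext]
structure JetBundle (π : Y → X) where
  pt : Y
  jet : jetFiber n N π pt

namespace AdaptedChart
variable {π : Y → X} (a b : AdaptedChart n N π)

/-- The differential of the bundle coordinates at `y`. -/
abbrev dTot (y : Y) : TangentSpace 𝓘(ℝ, TotalModel n N) y →L[ℝ] TotalModel n N :=
  mfderiv 𝓘(ℝ, TotalModel n N) 𝓘(ℝ, TotalModel n N) a.tot y

/-- The differential of the coordinates of the base at `x`. -/
abbrev dBase (x : X) : TangentSpace 𝓘(ℝ, BaseModel n) x →L[ℝ] BaseModel n :=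
  mfderiv 𝓘(ℝ, BaseModel n) 𝓘(ℝ, BaseModel n) a.base x

theorem mdiff_tot : a.tot.MDifferentiable 𝓘(ℝ, TotalModel n N) 𝓘(ℝ, TotalModel n N) :=
  ⟨a.smooth_tot.mdifferentiableOn (by simp), a.smooth_tot_symm.mdifferentiableOn (by simp)⟩

theorem mdiff_base : a.base.MDifferentiable 𝓘(ℝ, BaseModel n) 𝓘(ℝ, BaseModel n) :=
  ⟨a.smooth_base.mdifferentiableOn (by simp), a.smooth_base_symm.mdifferentiableOn (by simp)⟩

variable {a b}

theorem dTot_isInvertible {y : Y} (hy : y ∈ a.tot.source) : (a.dTot y).IsInvertible :=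
  ⟨a.mdiff_tot.mfderiv hy, rfl⟩

theorem dBase_isInvertible {x : X} (hx : x ∈ a.base.source) : (a.dBase x).IsInvertible :=
  ⟨a.mdiff_base.mfderiv hx, rfl⟩

theorem dTot_inverse {y : Y} (hy : y ∈ a.tot.source) :
    (a.dTot y).comp (a.dTot y).inverse = ContinuousLinearMap.id ℝ _ :=
  (dTot_isInvertible hy).self_comp_inverse

theorem inverse_dTot {y : Y} (hy : y ∈ a.tot.source) :
    (a.dTot y).inverse.comp (a.dTot y) = ContinuousLinearMap.id ℝ _ :=
  (dTot_isInvertible hy).inverse_comp_self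

theorem dBase_inverse {x : X} (hx : x ∈ a.base.source) :
    (a.dBase x).comp (a.dBase x).inverse = ContinuousLinearMap.id ℝ _ :=
  (dBase_isInvertible hx).self_comp_inverse

theorem inverse_dBase {x : X} (hx : x ∈ a.base.source) :
    (a.dBase x).inverse.comp (a.dBase x) = ContinuousLinearMap.id ℝ _ :=
  (dBase_isInvertible hx).inverse_comp_self

theorem fst_dTot [h : IsSmoothFiberBundle n N π] {y : Y} (hy : y ∈ a.tot.source) :
    (ContinuousLinearMap.fst ℝ (BaseModel n) (FiberModel N)).comp (a.dTot y) =
      (a.dBase (π y)).comp (tproj n N π y) := by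
  have h1 : HasMFDerivAt 𝓘(ℝ, TotalModel n N) 𝓘(ℝ, BaseModel n) (fun z => (a.tot z).1) y
      ((ContinuousLinearMap.fst ℝ (BaseModel n) (FiberModel N)).comp (a.dTot y)) :=
    ((ContinuousLinearMap.fst ℝ (BaseModel n) (FiberModel N)).hasMFDerivAt).comp y
      (a.mdiff_tot.mdifferentiableAt hy).hasMFDerivAt
  have h2 : HasMFDerivAt 𝓘(ℝ, TotalModel n N) 𝓘(ℝ, BaseModel n) (fun z => a.base (π z)) y
      ((a.dBase (π y)).comp (tproj n N π y)) :=
    (a.mdiff_base.mdifferentiableAt (a.proj_mem y hy)).hasMFDerivAt.comp y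
      ((h.contMDiff y).mdifferentiableAt (by simp)).hasMFDerivAt
  refine hasMFDerivAt_unique h1 (h2.congr_of_eventuallyEq ?_)
  filter_upwards [a.tot.open_source.mem_nhds hy] with z hz using a.fst_tot z hz

theorem tproj_inverse [h : IsSmoothFiberBundle n N π] {y : Y} (hy : y ∈ a.tot.source) :
    (tproj n N π y).comp (a.dTot y).inverse =
      (a.dBase (π y)).inverse.comp (ContinuousLinearMap.fst ℝ (BaseModel n) (FiberModel N)) := by
  have h1 := fst_dTot (a := a) hy
  have h2 := dTot_inverse (a := a) hy
  have h3 := inverse_dBase (a := a) (a.proj_mem y hy)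
  refine ContinuousLinearMap.ext fun v => ?_
  have e1 := DFunLike.congr_fun h1 ((a.dTot y).inverse v)
  have e2 := DFunLike.congr_fun h2 v
  have e3 := DFunLike.congr_fun h3 (tproj n N π y ((a.dTot y).inverse v))
  simp only [ContinuousLinearMap.comp_apply, ContinuousLinearMap.id_apply] at *
  rw [← e3, ← e1, e2]

variable (a) in
/-- The jet at `y` whose fibre coordinates `v^A_μ` are the entries of `A`. -/
def jetOfCoord (y : Y) (A : BaseModel n →L[ℝ] FiberModel N) :
    TangentSpace 𝓘(ℝ, BaseModel n) (π y) →L[ℝ] TangentSpace 𝓘(ℝ, TotalModel n N) y :=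
  ((a.dTot y).inverse.comp ((ContinuousLinearMap.id ℝ (BaseModel n)).prod A)).comp
    (a.dBase (π y))

theorem jetOfCoord_mem [IsSmoothFiberBundle n N π] {y : Y} (hy : y ∈ a.tot.source)
    (A : BaseModel n →L[ℝ] FiberModel N) : a.jetOfCoord y A ∈ jetFiber n N π y := by
  change (tproj n N π y).comp (a.jetOfCoord y A) = _
  have h1 := tproj_inverse (a := a) hy
  have h2 := inverse_dBase (a := a) (a.proj_mem y hy)
  ext1 v
  have e1 := DFunLike.congr_fun h1 (a.dBase (π y) v, A (a.dBase (π y) v))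
  have e2 := DFunLike.congr_fun h2 v
  simp only [ContinuousLinearMap.comp_apply, ContinuousLinearMap.id_apply, jetOfCoord] at *
  exact e1.trans e2

end AdaptedChart

instance [IsManifold 𝓘(ℝ, BaseModel n) ∞ X] (π : Y → X) [IsSmoothFiberBundle n N π] (y : Y) :
    Nonempty (jetFiber n N π y) :=
  let ⟨_, ha⟩ := exists_adaptedChart (n := n) (N := N) π y
  ⟨⟨_, AdaptedChart.jetOfCoord_mem ha 0⟩⟩

namespace AdaptedChart
variable {π : Y → X} {a b : AdaptedChart n N π}
variable (a) in
/-- The fibre coordinates `v^A_μ` of a jet. -/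
def jetCoord {y : Y} (γ : jetFiber n N π y) : BaseModel n →L[ℝ] FiberModel N :=
  ((ContinuousLinearMap.snd ℝ (BaseModel n) (FiberModel N)).comp (a.dTot y)).comp
    ((γ : TangentSpace 𝓘(ℝ, BaseModel n) (π y) →L[ℝ] TangentSpace 𝓘(ℝ, TotalModel n N) y).comp
      (a.dBase (π y)).inverse)

section Transition
variable {H M : Type*} [NormedAddCommGroup H] [NormedSpace ℝ H] [TopologicalSpace M]
  [ChartedSpace H M] {φ₁ φ₂ : OpenPartialHomeomorph M H}

theorem trans_contDiffOn (h₁ : ContMDiffOn 𝓘(ℝ, H) 𝓘(ℝ, H) ∞ φ₁.symm φ₁.target)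
    (h₂ : ContMDiffOn 𝓘(ℝ, H) 𝓘(ℝ, H) ∞ φ₂ φ₂.source) :
    ContDiffOn ℝ ∞ (φ₂ ∘ φ₁.symm) (φ₁.symm.trans φ₂).source := by
  rw [← contMDiffOn_iff_contDiffOn]
  refine h₂.comp (h₁.mono fun p hp => ?_) fun p hp => ?_
  · simp at hp; exact hp.1
  · simp at hp; exact hp.2

theorem trans_fderiv (h₁ : ContMDiffOn 𝓘(ℝ, H) 𝓘(ℝ, H) ∞ φ₁ φ₁.source)
    (h₁' : ContMDiffOn 𝓘(ℝ, H) 𝓘(ℝ, H) ∞ φ₁.symm φ₁.target)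
    (h₂ : ContMDiffOn 𝓘(ℝ, H) 𝓘(ℝ, H) ∞ φ₂ φ₂.source) {x : M} (hx₁ : x ∈ φ₁.source)
    (hx₂ : x ∈ φ₂.source) (v : TangentSpace 𝓘(ℝ, H) x) :
    fderiv ℝ (φ₂ ∘ φ₁.symm) (φ₁ x) (mfderiv 𝓘(ℝ, H) 𝓘(ℝ, H) φ₁ x v) =
      mfderiv 𝓘(ℝ, H) 𝓘(ℝ, H) φ₂ x v := by
  have hm : φ₁ x ∈ (φ₁.symm.trans φ₂).source := by simp [hx₁, hx₂]
  have e0 : DifferentiableAt ℝ (φ₂ ∘ φ₁.symm) (φ₁ x) :=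
    ((trans_contDiffOn h₁' h₂).contDiffAt
      ((φ₁.symm.trans φ₂).open_source.mem_nhds hm)).differentiableAt (by simp)
  have e1 : HasMFDerivAt 𝓘(ℝ, H) 𝓘(ℝ, H) (fun z => (φ₂ ∘ φ₁.symm) (φ₁ z)) x
      ((fderiv ℝ (φ₂ ∘ φ₁.symm) (φ₁ x)).comp (mfderiv 𝓘(ℝ, H) 𝓘(ℝ, H) φ₁ x)) :=
    e0.hasFDerivAt.hasMFDerivAt.comp x
      (((h₁ x hx₁).contMDiffAt (φ₁.open_source.mem_nhds hx₁)).mdifferentiableAt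
        (by simp)).hasMFDerivAt
  have e2 : HasMFDerivAt 𝓘(ℝ, H) 𝓘(ℝ, H) φ₂ x (mfderiv 𝓘(ℝ, H) 𝓘(ℝ, H) φ₂ x) :=
    (((h₂ x hx₂).contMDiffAt (φ₂.open_source.mem_nhds hx₂)).mdifferentiableAt
        (by simp)).hasMFDerivAt
  have := hasMFDerivAt_unique e1 (e2.congr_of_eventuallyEq ?_)
  · exact DFunLike.congr_fun this v
  · filter_upwards [φ₁.open_source.mem_nhds hx₁] with z hz
    simp [hz]
end Transition

theorem dTot_trans {y : Y} (ha : y ∈ a.tot.source) (hb : y ∈ b.tot.source) (w : TotalModel n N) :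
    b.dTot y ((a.dTot y).inverse w) = fderiv ℝ (b.tot ∘ a.tot.symm) (a.tot y) w := by
  have h1 := DFunLike.congr_fun (dTot_inverse ha) w
  have h2 := trans_fderiv a.smooth_tot a.smooth_tot_symm b.smooth_tot ha hb
    ((a.dTot y).inverse w)
  simp only [ContinuousLinearMap.comp_apply, ContinuousLinearMap.id_apply] at h1
  exact h2.symm.trans (congrArg _ h1)

theorem dBase_trans {x : X} (ha : x ∈ a.base.source) (hb : x ∈ b.base.source)
    (w : BaseModel n) :
    b.dBase x ((a.dBase x).inverse w) = fderiv ℝ (b.base ∘ a.base.symm) (a.base x) w := by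
  have h1 := DFunLike.congr_fun (dBase_inverse ha) w
  have h2 := trans_fderiv a.smooth_base a.smooth_base_symm b.smooth_base ha hb
    ((a.dBase x).inverse w)
  simp only [ContinuousLinearMap.comp_apply, ContinuousLinearMap.id_apply] at h1
  exact h2.symm.trans (congrArg _ h1)

theorem dTot_jet [IsSmoothFiberBundle n N π] {y : Y} (hy : y ∈ a.tot.source) (γ : jetFiber n N π y)
    (v : TangentSpace 𝓘(ℝ, BaseModel n) (π y)) :
    a.dTot y (γ.1 v) = (a.dBase (π y) v, a.jetCoord γ (a.dBase (π y) v)) := by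
  have h1 := DFunLike.congr_fun (fst_dTot (a := a) hy) (γ.1 v)
  have h2 := DFunLike.congr_fun γ.2 v
  have h3 := DFunLike.congr_fun (inverse_dBase (a := a) (a.proj_mem y hy)) v
  simp only [ContinuousLinearMap.comp_apply, ContinuousLinearMap.id_apply] at h1 h2 h3
  refine Prod.ext ?_ ?_
  · rw [h2] at h1; exact h1
  · simp only [jetCoord, ContinuousLinearMap.comp_apply]
    rw [h3]; rfl

variable [IsManifold 𝓘(ℝ, BaseModel n) ∞ X] [IsSmoothFiberBundle n N π]

open Classical in
variable (a) in
/-- The jet with given fibre coordinates, as an element of `J¹_y Y`. -/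
def jetMk (y : Y) (A : BaseModel n →L[ℝ] FiberModel N) : jetFiber n N π y :=
  if hy : y ∈ a.tot.source then ⟨a.jetOfCoord y A, jetOfCoord_mem hy A⟩
  else Classical.arbitrary _

theorem jetCoord_jetMk {y : Y} (hy : y ∈ a.tot.source) (A : BaseModel n →L[ℝ] FiberModel N) :
    a.jetCoord (a.jetMk y A) = A := by
  have h1 := dTot_inverse (a := a) hy
  have h2 := dBase_inverse (a := a) (a.proj_mem y hy)
  rw [jetMk, dif_pos hy]
  ext1 v
  have e2 := DFunLike.congr_fun h2 v
  have e1 := DFunLike.congr_fun h1 (v, A v)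
  simp only [ContinuousLinearMap.comp_apply, ContinuousLinearMap.id_apply] at e1 e2
  simp only [jetCoord, jetOfCoord, ContinuousLinearMap.comp_apply,
    ContinuousLinearMap.prod_apply, ContinuousLinearMap.id_apply]
  rw [e2, e1]; rfl

theorem jetMk_jetCoord {y : Y} (hy : y ∈ a.tot.source) (γ : jetFiber n N π y) :
    a.jetMk y (a.jetCoord γ) = γ := by
  rw [jetMk, dif_pos hy]
  refine Subtype.ext ?_
  ext1 v
  have h1 := DFunLike.congr_fun (inverse_dTot (a := a) hy) (γ.1 v)
  simp only [ContinuousLinearMap.comp_apply, ContinuousLinearMap.id_apply] at h1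
  rw [← h1, dTot_jet hy]
  rfl



variable (a) in
/-- The natural coordinates `(x^μ, y^A, v^A_μ)` on `J¹Y`. -/
def jetChart : PartialEquiv (JetBundle n N π)
    (TotalModel n N × (BaseModel n →L[ℝ] FiberModel N)) where
  toFun γ := (a.tot γ.pt, a.jetCoord γ.jet)
  invFun q := ⟨a.tot.symm q.1, a.jetMk (a.tot.symm q.1) q.2⟩
  source := {γ | γ.pt ∈ a.tot.source}
  target := a.tot.target ×ˢ Set.univ
  map_source' γ hγ := ⟨a.tot.map_source hγ, trivial⟩
  map_target' q hq := a.tot.map_target hq.1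
  left_inv' := by
    rintro ⟨y, γ⟩ (hy : y ∈ a.tot.source)
    have h := a.tot.left_inv hy
    change (⟨a.tot.symm (a.tot y), a.jetMk (a.tot.symm (a.tot y)) (a.jetCoord γ)⟩ :
      JetBundle n N π) = ⟨y, γ⟩
    rw [h, jetMk_jetCoord hy]
  right_inv' := by
    rintro ⟨p, A⟩ ⟨hp, -⟩
    exact Prod.ext (a.tot.right_inv hp) (jetCoord_jetMk (a.tot.map_target hp) A)

variable (a b) in
/-- The change of natural coordinates on `J¹Y`. -/
def jetTrans (q : TotalModel n N × (BaseModel n →L[ℝ] FiberModel N)) :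
    TotalModel n N × (BaseModel n →L[ℝ] FiberModel N) :=
  ((b.tot ∘ a.tot.symm) q.1,
    (ContinuousLinearMap.snd ℝ (BaseModel n) (FiberModel N)).comp
      ((fderiv ℝ (b.tot ∘ a.tot.symm) q.1).comp
        ((ContinuousLinearMap.inl ℝ (BaseModel n) (FiberModel N) +
          (ContinuousLinearMap.inr ℝ (BaseModel n) (FiberModel N)).comp q.2).comp
            (fderiv ℝ (a.base ∘ b.base.symm) ((b.tot ∘ a.tot.symm) q.1).1))))

theorem jetChart_trans_source : (a.jetChart.symm.trans b.jetChart).source =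
    (a.tot.symm.trans b.tot).source ×ˢ Set.univ := by
  ext ⟨p, A⟩
  exact ⟨fun h => ⟨⟨h.1.1, h.2⟩, trivial⟩, fun h => ⟨⟨h.1.1, trivial⟩, h.1.2⟩⟩

theorem jetChart_trans_eqOn : Set.EqOn (a.jetChart.symm.trans b.jetChart) (jetTrans a b)
    (a.jetChart.symm.trans b.jetChart).source := by
  rintro ⟨p, A⟩ hp
  rw [jetChart_trans_source] at hp
  obtain ⟨⟨hp1, hp2⟩, -⟩ := hp
  change p ∈ a.tot.target at hp1
  change a.tot.symm p ∈ b.tot.source at hp2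
  have hp3 := a.tot.map_target hp1
  refine Prod.ext rfl ?_
  change b.jetCoord (a.jetMk (a.tot.symm p) A) = _
  refine ContinuousLinearMap.ext fun v => ?_
  have h1 := dBase_trans (a := b) (b := a) (b.proj_mem _ hp2) (a.proj_mem _ hp3) v
  rw [← b.fst_tot _ hp2] at h1
  have h2 := fun w => dTot_trans (a := a) (b := b) hp3 hp2 w
  rw [a.tot.right_inv hp1] at h2
  rw [jetMk, dif_pos hp3]
  simp only [jetCoord, jetOfCoord, ContinuousLinearMap.comp_apply,
    ContinuousLinearMap.prod_apply, ContinuousLinearMap.id_apply, jetTrans]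
  rw [h1, h2]
  simp

theorem contDiffOn_jetTrans : ContDiffOn ℝ ∞ (jetTrans a b)
    (a.jetChart.symm.trans b.jetChart).source := by
  rw [jetChart_trans_source]
  have h1 := trans_contDiffOn a.smooth_tot_symm b.smooth_tot
  have h2 := trans_contDiffOn b.smooth_base_symm a.smooth_base
  have h1' := h1.fderiv_of_isOpen (m := ∞) (a.tot.symm.trans b.tot).open_source (by simp)
  have h2' := h2.fderiv_of_isOpen (m := ∞) (b.base.symm.trans a.base).open_source (by simp)
  have hm : Set.MapsTo (Prod.fst : TotalModel n N × (BaseModel n →L[ℝ] FiberModel N) → _)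
    ((a.tot.symm.trans b.tot).source ×ˢ Set.univ) (a.tot.symm.trans b.tot).source :=
    fun q hq => hq.1
  have g1 := h1.comp contDiff_fst.contDiffOn hm
  have g1' := h1'.comp contDiff_fst.contDiffOn hm
  have g2' := h2'.comp (contDiff_fst.comp_contDiffOn g1) (by
    rintro ⟨p, A⟩ ⟨⟨hp1, hp2⟩, -⟩
    change p ∈ a.tot.target at hp1
    change a.tot.symm p ∈ b.tot.source at hp2
    have hp3 := a.tot.map_target hp1
    have hb := b.proj_mem _ hp2
    simp only [Function.comp_apply, b.fst_tot _ hp2]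
    simp [hb, a.proj_mem _ hp3])
  refine g1.prodMk (contDiffOn_const.clm_comp (g1'.clm_comp
    (ContDiffOn.clm_comp (contDiffOn_const.add (contDiffOn_const.clm_comp ?_)) g2')))
  exact contDiff_snd.contDiffOn

end AdaptedChart

variable (n N) in
/-- The fibre `Z_y`: the `(n+1)`-forms `z` on `T_y Y` with `v ⌟ w ⌟ z = 0` for all vertical `v, w`. -/
def phaseFiber (π : Y → X) (y : Y) :
    Submodule ℝ (TangentSpace 𝓘(ℝ, TotalModel n N) y [⋀^Fin (n + 1)]→L[ℝ] ℝ) where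
  carrier := {z | ∀ (u : Fin (n + 1) → TangentSpace 𝓘(ℝ, TotalModel n N) y) (i j : Fin (n + 1)),
    i ≠ j → tproj n N π y (u i) = 0 → tproj n N π y (u j) = 0 → z u = 0}
  add_mem' := by
    intro z z' hz hz' u i j hij hi hj
    rw [ContinuousAlternatingMap.add_apply, hz u i j hij hi hj, hz' u i j hij hi hj, add_zero]
  zero_mem' := by intro u i j _ _ _; rfl
  smul_mem' := by
    intro c z hz u i j hij hi hj
    rw [ContinuousAlternatingMap.smul_apply, hz u i j hij hi hj, smul_zero]

variable (n N) in
/-- The covariant phase space `Z`, as a bundle over `Y`. -/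
@[ext]
structure PhaseSpace (π : Y → X) where
  pt : Y
  form : phaseFiber n N π pt

/-- The model of the fibres of `Z`. -/
def PhaseModel (n N : ℕ) : Submodule ℝ (TotalModel n N [⋀^Fin (n + 1)]→L[ℝ] ℝ) where
  carrier := {z | ∀ (u : Fin (n + 1) → TotalModel n N) (i j : Fin (n + 1)),
    i ≠ j → (u i).1 = 0 → (u j).1 = 0 → z u = 0}
  add_mem' := by
    intro z z' hz hz' u i j hij hi hj
    rw [ContinuousAlternatingMap.add_apply, hz u i j hij hi hj, hz' u i j hij hi hj, add_zero]
  zero_mem' := by intro u i j _ _ _; rfl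
  smul_mem' := by
    intro c z hz u i j hij hi hj
    rw [ContinuousAlternatingMap.smul_apply, hz u i j hij hi hj, smul_zero]

/-- The components of a form, i.e. its values on tuples of basis vectors. -/
def PhaseModel.ev (n N : ℕ) : PhaseModel n N →ₗ[ℝ]
    ((Fin (n + 1) → Module.Basis.ofVectorSpaceIndex ℝ (TotalModel n N)) → ℝ) where
  toFun z s := z.1 fun i => Module.Basis.ofVectorSpace ℝ (TotalModel n N) (s i)
  map_add' _ _ := rfl
  map_smul' _ _ := rfl

theorem PhaseModel.ev_injective (n N : ℕ) : Function.Injective (PhaseModel.ev n N) := by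
  intro z z' h
  refine Subtype.ext (ContinuousAlternatingMap.toAlternatingMap_injective ?_)
  refine Module.Basis.ext_alternating (Module.Basis.ofVectorSpace ℝ (TotalModel n N))
    fun s _ => congrFun h s

theorem contDiffOn_of_coord {W V ι : Type*} [NormedAddCommGroup W] [NormedSpace ℝ W]
    [NormedAddCommGroup V] [NormedSpace ℝ V] [Finite ι] (ev : W →ₗ[ℝ] (ι → ℝ))
    (hev : Function.Injective ev) {f : V → W} {S : Set V}
    (h : ∀ s, ContDiffOn ℝ ∞ (fun q => ev (f q) s) S) : ContDiffOn ℝ ∞ f S := by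
  have := Fintype.ofFinite ι
  obtain ⟨R, hR⟩ := LinearMap.exists_leftInverse_of_injective ev
    (LinearMap.ker_eq_bot.2 hev)
  have h1 : ContDiffOn ℝ ∞ (fun q => ev (f q)) S := contDiffOn_pi.2 h
  have h2 := (LinearMap.toContinuousLinearMap R).contDiff.comp_contDiffOn h1
  refine h2.congr fun q _ => ?_
  exact (DFunLike.congr_fun hR (f q)).symm

theorem PhaseModel.contDiffOn_of_ev {V : Type*} [NormedAddCommGroup V] [NormedSpace ℝ V]
    {f : V → PhaseModel n N} {S : Set V}
    (h : ∀ u : Fin (n + 1) → TotalModel n N, ContDiffOn ℝ ∞ (fun q => (f q).1 u) S) :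
    ContDiffOn ℝ ∞ f S :=
  contDiffOn_of_coord (PhaseModel.ev n N) (PhaseModel.ev_injective n N) fun _ => h _

theorem PhaseModel.contDiffOn_apply {V : Type*} [NormedAddCommGroup V] [NormedSpace ℝ V]
    {f : V → PhaseModel n N} {g : V → Fin (n + 1) → TotalModel n N} {S : Set V}
    (hf : ContDiffOn ℝ ∞ f S) (hg : ContDiffOn ℝ ∞ g S) :
    ContDiffOn ℝ ∞ (fun q => (f q).1 (g q)) S := by
  let B : PhaseModel n N →L[ℝ]
      ContinuousMultilinearMap ℝ (fun _ : Fin (n + 1) => TotalModel n N) ℝ :=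
    (ContinuousAlternatingMap.toContinuousMultilinearMapCLM ℝ).comp (PhaseModel n N).subtypeL
  have := ContinuousLinearMap.analyticOnNhd_uncurry_of_multilinear (𝕜 := ℝ)
    (Em := fun _ : Fin (n + 1) => TotalModel n N) (F := ℝ) (G := PhaseModel n N) B (s := Set.univ)
  have h2 : ContDiff ℝ ∞ (fun p : PhaseModel n N × (Fin (n + 1) → TotalModel n N) => B p.1 p.2) :=
    contDiffOn_univ.1 (this.contDiffOn uniqueDiffOn_univ)
  exact h2.comp_contDiffOn (hf.prodMk hg)

namespace AdaptedChart
variable {π : Y → X} {a b : AdaptedChart n N π} [IsSmoothFiberBundle n N π]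

theorem tproj_inverse_eq_zero {y : Y} (hy : y ∈ a.tot.source) {w : TotalModel n N}
    (hw : w.1 = 0) : tproj n N π y ((a.dTot y).inverse w) = 0 := by
  have := DFunLike.congr_fun (tproj_inverse (a := a) hy) w
  refine this.trans ?_
  change (a.dBase (π y)).inverse w.1 = 0
  rw [hw, _root_.map_zero]

theorem fst_dTot_eq_zero {y : Y} (hy : y ∈ a.tot.source)
    {w : TangentSpace 𝓘(ℝ, TotalModel n N) y} (hw : tproj n N π y w = 0) :
    (a.dTot y w).1 = 0 := by
  have := DFunLike.congr_fun (fst_dTot (a := a) hy) w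
  refine this.trans ?_
  change a.dBase (π y) (tproj n N π y w) = 0
  rw [hw, _root_.map_zero]

open Classical in
variable (a) in
/-- The fibre coordinates of an element of `Z`: the form, expressed in bundle coordinates. -/
def phaseCoord {y : Y} (z : phaseFiber n N π y) : PhaseModel n N :=
  if hy : y ∈ a.tot.source then
    ⟨z.1.compContinuousLinearMap (a.dTot y).inverse, fun _ i j hij hi hj =>
      z.2 _ i j hij (tproj_inverse_eq_zero hy hi) (tproj_inverse_eq_zero hy hj)⟩
  else 0

open Classical in
variable (a) in
/-- The element of `Z_y` with given fibre coordinates. -/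
def phaseMk (y : Y) (z : PhaseModel n N) : phaseFiber n N π y :=
  if hy : y ∈ a.tot.source then
    ⟨z.1.compContinuousLinearMap (a.dTot y), fun _ i j hij hi hj =>
      z.2 _ i j hij (fst_dTot_eq_zero hy hi) (fst_dTot_eq_zero hy hj)⟩
  else 0

theorem phaseCoord_phaseMk {y : Y} (hy : y ∈ a.tot.source) (z : PhaseModel n N) :
    a.phaseCoord (a.phaseMk y z) = z := by
  rw [phaseMk, phaseCoord, dif_pos hy, dif_pos hy]
  refine Subtype.ext (ContinuousAlternatingMap.ext fun u => ?_)
  exact congrArg z.1 (funext fun i => DFunLike.congr_fun (dTot_inverse hy) (u i))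

theorem phaseMk_phaseCoord {y : Y} (hy : y ∈ a.tot.source) (z : phaseFiber n N π y) :
    a.phaseMk y (a.phaseCoord z) = z := by
  rw [phaseMk, phaseCoord, dif_pos hy, dif_pos hy]
  refine Subtype.ext (ContinuousAlternatingMap.ext fun u => ?_)
  exact congrArg z.1 (funext fun i => DFunLike.congr_fun (inverse_dTot hy) (u i))

variable (a) in
/-- The natural coordinates on `Z`. -/
def phaseChart : PartialEquiv (PhaseSpace n N π) (TotalModel n N × PhaseModel n N) where
  toFun z := (a.tot z.pt, a.phaseCoord z.form)
  invFun q := ⟨a.tot.symm q.1, a.phaseMk (a.tot.symm q.1) q.2⟩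
  source := {z | z.pt ∈ a.tot.source}
  target := a.tot.target ×ˢ Set.univ
  map_source' z hz := ⟨a.tot.map_source hz, trivial⟩
  map_target' q hq := a.tot.map_target hq.1
  left_inv' := by
    rintro ⟨y, z⟩ (hy : y ∈ a.tot.source)
    have h := a.tot.left_inv hy
    change (⟨a.tot.symm (a.tot y), a.phaseMk (a.tot.symm (a.tot y)) (a.phaseCoord z)⟩ :
      PhaseSpace n N π) = ⟨y, z⟩
    rw [h, phaseMk_phaseCoord hy]
  right_inv' := by
    rintro ⟨p, z⟩ ⟨hp, -⟩
    exact Prod.ext (a.tot.right_inv hp) (phaseCoord_phaseMk (a.tot.map_target hp) z)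

theorem phaseChart_trans_source : (a.phaseChart.symm.trans b.phaseChart).source =
    (a.tot.symm.trans b.tot).source ×ˢ Set.univ := by
  ext ⟨p, A⟩
  exact ⟨fun h => ⟨⟨h.1.1, h.2⟩, trivial⟩, fun h => ⟨⟨h.1.1, trivial⟩, h.1.2⟩⟩

theorem contDiffOn_phaseTrans : ContDiffOn ℝ ∞ (a.phaseChart.symm.trans b.phaseChart)
    (a.phaseChart.symm.trans b.phaseChart).source := by
  rw [phaseChart_trans_source]
  have h1 := trans_contDiffOn a.smooth_tot_symm b.smooth_tot
  have h2 := trans_contDiffOn b.smooth_tot_symm a.smooth_tot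
  have h2' := h2.fderiv_of_isOpen (m := ∞) (b.tot.symm.trans a.tot).open_source (by simp)
  have hm : Set.MapsTo (Prod.fst : TotalModel n N × PhaseModel n N → _)
    ((a.tot.symm.trans b.tot).source ×ˢ Set.univ) (a.tot.symm.trans b.tot).source :=
    fun q hq => hq.1
  have g1 := h1.comp contDiff_fst.contDiffOn hm
  have g2' := h2'.comp g1 (by
    rintro ⟨p, A⟩ ⟨⟨hp1, hp2⟩, -⟩
    change p ∈ a.tot.target at hp1
    change a.tot.symm p ∈ b.tot.source at hp2
    have hp3 := a.tot.map_target hp1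
    simp [hp2, hp3])
  refine g1.prodMk (PhaseModel.contDiffOn_of_ev fun u => ?_)
  refine (PhaseModel.contDiffOn_apply (f := Prod.snd)
    (g := fun q i => fderiv ℝ (a.tot ∘ b.tot.symm) ((b.tot ∘ a.tot.symm) q.1) (u i))
    contDiff_snd.contDiffOn (contDiffOn_pi.2 fun i => g2'.clm_apply contDiffOn_const)).congr ?_
  rintro ⟨p, z⟩ ⟨⟨hp1, hp2⟩, -⟩
  change p ∈ a.tot.target at hp1
  change a.tot.symm p ∈ b.tot.source at hp2
  have hp3 := a.tot.map_target hp1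
  change (b.phaseCoord (a.phaseMk (a.tot.symm p) z)).1 u = _
  rw [phaseMk, phaseCoord, dif_pos hp3, dif_pos hp2]
  exact congrArg z.1 (funext fun i => dTot_trans hp2 hp3 (u i))

end AdaptedChart

section Actions
/-- The actions of the Lie group `G` on `X` and `Y` are smooth. -/
class IsSmoothAction (n N : ℕ) (𝔤 : Type*) [AddCommGroup 𝔤] [Module ℝ 𝔤] [TopologicalSpace 𝔤]
    (G : Type*) [Group G] [TopologicalSpace G] [ChartedSpace 𝔤 G]
    (X Y : Type*) [TopologicalSpace X] [ChartedSpace (BaseModel n) X]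
    [TopologicalSpace Y] [ChartedSpace (TotalModel n N) Y] [MulAction G X] [MulAction G Y] :
    Prop where
  base : IsBastianiSmooth₂ 𝔤 (BaseModel n) (BaseModel n) fun (g : G) (x : X) => g • x
  tot : IsBastianiSmooth₂ 𝔤 (TotalModel n N) (TotalModel n N) fun (g : G) (y : Y) => g • y

variable (n N) (G : Type*) [Group G] [MulAction G X] [MulAction G Y]

/-- Each element of `G` acts on `X` by a diffeomorphism `η_X` and on `Y` by a smooth bundle
automorphism `η_Y` covering `η_X`. -/
class IsAutAction (π : Y → X) : Prop where
  contMDiff_base : ∀ g : G, ContMDiff 𝓘(ℝ, BaseModel n) 𝓘(ℝ, BaseModel n) ∞ fun x : X => g • x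
  contMDiff_tot : ∀ g : G, ContMDiff 𝓘(ℝ, TotalModel n N) 𝓘(ℝ, TotalModel n N) ∞
    fun y : Y => g • y
  proj_smul : ∀ (g : G) (y : Y), π (g • y) = g • π y

variable {n N} {G} {π : Y → X}

/-- The tangent map `T η_Y` at `y`. -/
abbrev dSmulTot (g : G) (y : Y) :
    TangentSpace 𝓘(ℝ, TotalModel n N) y →L[ℝ] TangentSpace 𝓘(ℝ, TotalModel n N) (g • y) :=
  mfderiv 𝓘(ℝ, TotalModel n N) 𝓘(ℝ, TotalModel n N) (fun y' : Y => g • y') y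

/-- The tangent map `T η_X` at `x`. -/
abbrev dSmulBase (g : G) (x : X) :
    TangentSpace 𝓘(ℝ, BaseModel n) x →L[ℝ] TangentSpace 𝓘(ℝ, BaseModel n) (g • x) :=
  mfderiv 𝓘(ℝ, BaseModel n) 𝓘(ℝ, BaseModel n) (fun x' : X => g • x') x

theorem tproj_dSmulTot [hG : IsAutAction n N G π] [h : IsSmoothFiberBundle n N π] (g : G) (y : Y)
    (w : TangentSpace 𝓘(ℝ, TotalModel n N) y) :
    tproj n N π (g • y) (dSmulTot g y w) = dSmulBase g (π y) (tproj n N π y w) := by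
  have hπ := fun y => ((h.contMDiff y).mdifferentiableAt (by simp)).hasMFDerivAt
  have h1 := (hπ (g • y)).comp y
    (((hG.contMDiff_tot g y).mdifferentiableAt (by simp)).hasMFDerivAt)
  have h2 := (((hG.contMDiff_base g (π y)).mdifferentiableAt (by simp)).hasMFDerivAt).comp y (hπ y)
  have h3 := hasMFDerivAt_unique h1 (h2.congr_of_eventuallyEq
    (Filter.Eventually.of_forall fun y' => hG.proj_smul g y'))
  exact DFunLike.congr_fun h3 w

theorem dSmulBase_dSmulBase_inv (hG : IsAutAction n N G π) (g : G) (y : Y)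
    (v : TangentSpace 𝓘(ℝ, BaseModel n) (π (g • y))) :
    dSmulBase g (π y) (dSmulBase g⁻¹ (π (g • y)) v) = v := by
  have hy : g⁻¹ • π (g • y) = π y := by rw [hG.proj_smul, inv_smul_smul]
  have h1 := ((hG.contMDiff_base g⁻¹ (π (g • y))).mdifferentiableAt (by simp)).hasMFDerivAt
  have h2 := ((hG.contMDiff_base g (g⁻¹ • π (g • y))).mdifferentiableAt (by simp)).hasMFDerivAt
  have h3 := hasMFDerivAt_unique (h2.comp (π (g • y)) h1)
    ((hasMFDerivAt_id (I := 𝓘(ℝ, BaseModel n)) (π (g • y))).congr_of_eventuallyEq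
      (Filter.Eventually.of_forall fun x => smul_inv_smul g x))
  have h4 := DFunLike.congr_fun h3 v
  rw [← hy]
  exact h4

variable [hG : IsAutAction n N G π] [IsSmoothFiberBundle n N π]

variable (n N π) in
/-- The lift `η_{J¹Y}(γ) = T η_Y ∘ γ ∘ T η_X⁻¹` of the action to `J¹Y`. -/
def jetLift (g : G) (γ : JetBundle n N π) : JetBundle n N π :=
  ⟨g • γ.pt, (dSmulTot g γ.pt).comp (γ.jet.1.comp (dSmulBase g⁻¹ (π (g • γ.pt)))), by
    refine ContinuousLinearMap.ext fun v => ?_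
    refine (tproj_dSmulTot (π := π) g γ.pt (γ.jet.1 (dSmulBase g⁻¹ (π (g • γ.pt)) v))).trans ?_
    have h1 := DFunLike.congr_fun γ.jet.2 (dSmulBase g⁻¹ (π (g • γ.pt)) v)
    refine (congrArg (dSmulBase g (π γ.pt)) h1).trans ?_
    exact dSmulBase_dSmulBase_inv hG g γ.pt v⟩

variable (n N π) in
/-- The lift `η_Z(z) = (η_Y⁻¹)^* z` of the action to `Z`. -/
def phaseLift (g : G) (z : PhaseSpace n N π) : PhaseSpace n N π :=
  ⟨g • z.pt, z.form.1.compContinuousLinearMap (dSmulTot g⁻¹ (g • z.pt)), by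
    intro u i j hij hi hj
    have h : ∀ w : TangentSpace 𝓘(ℝ, TotalModel n N) (g • z.pt),
        tproj n N π (g • z.pt) w = 0 → tproj n N π z.pt (dSmulTot g⁻¹ (g • z.pt) w) = 0 := by
      intro w hw
      have h1 := tproj_dSmulTot (π := π) g⁻¹ (g • z.pt) w
      rw [hw, _root_.map_zero] at h1
      have h2 : ∀ y' (_ : y' = z.pt) (w' : TotalModel n N), tproj n N π y' w' = 0 →
          tproj n N π z.pt w' = 0 := by
        rintro _ rfl _ h
        exact h
      exact h2 _ (inv_smul_smul g z.pt) _ h1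
    exact z.form.2 _ i j hij (h _ hi) (h _ hj)⟩

end Actions

variable [IsManifold 𝓘(ℝ, BaseModel n) ∞ X]

namespace JetBundle
variable (π : Y → X) [IsSmoothFiberBundle n N π]

open AdaptedChart in
variable (n N) in
/-- The atlas of natural coordinates `(x^μ, y^A, v^A_μ)` on `J¹Y`. -/
def core : ChartedSpaceCore (TotalModel n N × (BaseModel n →L[ℝ] FiberModel N))
    (JetBundle n N π) where
  atlas := {e | ∃ a : AdaptedChart n N π, a.jetChart = e}
  chartAt γ := jetChart (exists_adaptedChart (n := n) (N := N) π γ.pt).choose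
  mem_chart_source γ := (exists_adaptedChart (n := n) (N := N) π γ.pt).choose_spec
  chart_mem_atlas _ := ⟨_, rfl⟩
  open_source := by
    rintro _ _ ⟨a, rfl⟩ ⟨b, rfl⟩
    rw [jetChart_trans_source]
    exact (a.tot.symm.trans b.tot).open_source.prod isOpen_univ
  continuousOn_toFun := by
    rintro _ _ ⟨a, rfl⟩ ⟨b, rfl⟩
    exact contDiffOn_jetTrans.continuousOn.congr jetChart_trans_eqOn

instance : TopologicalSpace (JetBundle n N π) := (core n N π).toTopologicalSpace

instance : ChartedSpace (TotalModel n N × (BaseModel n →L[ℝ] FiberModel N)) (JetBundle n N π) :=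
  (core n N π).toChartedSpace

open AdaptedChart in
instance : IsManifold 𝓘(ℝ, TotalModel n N × (BaseModel n →L[ℝ] FiberModel N)) ∞
    (JetBundle n N π) := by
  refine isManifold_of_contDiffOn _ _ _ fun e e' he he' => ?_
  obtain ⟨e₀, h₀, ha⟩ := Set.mem_iUnion₂.1 he
  obtain ⟨e₁, h₁, hb⟩ := Set.mem_iUnion₂.1 he'
  obtain ⟨a, rfl⟩ : ∃ a : AdaptedChart n N π, a.jetChart = e₀ := h₀
  obtain ⟨b, rfl⟩ : ∃ a : AdaptedChart n N π, a.jetChart = e₁ := h₁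
  rw [Set.mem_singleton_iff] at ha hb
  subst ha hb
  have := (contDiffOn_jetTrans (a := a) (b := b)).congr jetChart_trans_eqOn
  simpa using! this

end JetBundle

namespace PhaseSpace
variable (π : Y → X) [IsSmoothFiberBundle n N π]

open AdaptedChart in
variable (n N) in
/-- The atlas of natural coordinates on `Z`. -/
def core : ChartedSpaceCore (TotalModel n N × PhaseModel n N) (PhaseSpace n N π) where
  atlas := {e | ∃ a : AdaptedChart n N π, a.phaseChart = e}
  chartAt z := phaseChart (exists_adaptedChart (n := n) (N := N) π z.pt).choose
  mem_chart_source z := (exists_adaptedChart (n := n) (N := N) π z.pt).choose_spec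
  chart_mem_atlas _ := ⟨_, rfl⟩
  open_source := by
    rintro _ _ ⟨a, rfl⟩ ⟨b, rfl⟩
    rw [phaseChart_trans_source]
    exact (a.tot.symm.trans b.tot).open_source.prod isOpen_univ
  continuousOn_toFun := by
    rintro _ _ ⟨a, rfl⟩ ⟨b, rfl⟩
    exact contDiffOn_phaseTrans.continuousOn

instance : TopologicalSpace (PhaseSpace n N π) := (core n N π).toTopologicalSpace

instance : ChartedSpace (TotalModel n N × PhaseModel n N) (PhaseSpace n N π) :=
  (core n N π).toChartedSpace

open AdaptedChart in
instance : IsManifold 𝓘(ℝ, TotalModel n N × PhaseModel n N) ∞ (PhaseSpace n N π) := by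
  refine isManifold_of_contDiffOn _ _ _ fun e e' he he' => ?_
  obtain ⟨e₀, h₀, ha⟩ := Set.mem_iUnion₂.1 he
  obtain ⟨e₁, h₁, hb⟩ := Set.mem_iUnion₂.1 he'
  obtain ⟨a, rfl⟩ : ∃ a : AdaptedChart n N π, a.phaseChart = e₀ := h₀
  obtain ⟨b, rfl⟩ : ∃ a : AdaptedChart n N π, a.phaseChart = e₁ := h₁
  rw [Set.mem_singleton_iff] at ha hb
  subst ha hb
  have := contDiffOn_phaseTrans (a := a) (b := b)
  simpa using! this

end PhaseSpace

section Affine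
variable {E E' F : Type*} [AddCommGroup E] [Module ℝ E]
  [NormedAddCommGroup E'] [NormedSpace ℝ E'] [NormedAddCommGroup F] [NormedSpace ℝ F]

/-- The directional derivatives of a differentiable function on an affine space are linear. -/
theorem exists_linear_deriv (A : AffineSubspace ℝ E) [Nonempty A] (C : E →ₗ[ℝ] E') {G : E' → F}
    (hG : Differentiable ℝ G) (f : A → F) (hf : ∀ γ : A, f γ = G (C γ)) (γ : A) :
    ∃ D : A.direction →ₗ[ℝ] F, ∀ γ' : A,
      deriv (fun ε : ℝ => f (AffineMap.lineMap γ γ' ε)) 0 = D (γ' -ᵥ γ) := by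
  refine ⟨(fderiv ℝ G (C γ)).toLinearMap.comp (C.comp A.direction.subtype), fun γ' => ?_⟩
  have h1 : ∀ ε : ℝ, C (AffineMap.lineMap γ γ' ε : A) =
      C γ + ε • C (γ' -ᵥ γ : A.direction) := by
    intro ε
    rw [← map_smul, ← map_add, add_comm]
    rfl
  have h2 : (fun ε : ℝ => f (AffineMap.lineMap γ γ' ε)) =
      fun ε : ℝ => G (C γ + ε • C (γ' -ᵥ γ : A.direction)) := by
    funext ε; rw [hf, h1]
  have h3 : HasDerivAt (fun ε : ℝ => C γ + ε • C (γ' -ᵥ γ : A.direction))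
      (C (γ' -ᵥ γ : A.direction)) 0 := by
    simpa using ((hasDerivAt_id (0 : ℝ)).smul_const (C (γ' -ᵥ γ : A.direction))).const_add (C γ)
  have h4 := (hG (C γ + (0 : ℝ) • C (γ' -ᵥ γ : A.direction))).hasFDerivAt.comp_hasDerivAt
    (0 : ℝ) h3
  rw [zero_smul, add_zero] at h4
  rw [h2]
  exact h4.deriv

/-- The affine map `γ' ↦ c + g γ'`, where `g γ'` depends linearly on `γ' - γ`. -/
def affineOfDeriv {E F : Type*} [AddCommGroup E] [Module ℝ E] [AddCommGroup F] [Module ℝ F]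
    (A : AffineSubspace ℝ E) [Nonempty A] (γ : A) (c : F) (g : A → F)
    (h : ∃ D : A.direction →ₗ[ℝ] F, ∀ γ' : A, g γ' = D (γ' -ᵥ γ)) : A →ᵃ[ℝ] F where
  toFun γ' := c + g γ'
  linear := h.choose
  map_vadd' γ' σ := by
    have h' := h.choose_spec
    rw [h', h', vadd_vsub_assoc, map_add, vadd_eq_add]
    abel

variable {V V' W : Type*} [TopologicalSpace V] [AddCommGroup V] [Module ℝ V]
  [NormedAddCommGroup V'] [NormedSpace ℝ V']
  [TopologicalSpace W] [AddCommGroup W] [Module ℝ W] [IsTopologicalAddGroup W]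
  [ContinuousConstSMul ℝ W]

/-- The linear map `σ ↦ P ∘ σ ∘ Q`. -/
def compLin (P : W →L[ℝ] F) (Q : V' →L[ℝ] V) : (V →L[ℝ] W) →ₗ[ℝ] (V' →L[ℝ] F) where
  toFun σ := P.comp (σ.comp Q)
  map_add' _ _ := ContinuousLinearMap.ext fun _ => map_add P _ _
  map_smul' _ _ := ContinuousLinearMap.ext fun _ => map_smul P _ _
end Affine

section Legendre
variable (π : Y → X) [IsSmoothFiberBundle n N π]

variable (n N) in
/-- The fibre over `y` of the affine dual `J¹Y^⋆`: the affine maps `J¹_y Y → Λ^{n+1} T_x^* X`,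
`x = π y`. -/
abbrev DualJetFiber (y : Y) :=
  jetFiber n N π y →ᵃ[ℝ] (TangentSpace 𝓘(ℝ, BaseModel n) (π y) [⋀^Fin (n + 1)]→L[ℝ] ℝ)

variable {π}

/-- The map `Φ : Z_y → J¹_y Y^⋆`, `Φ(z)(γ) = γ^* z`, is onto. -/
theorem exists_phase_of_dual {y : Y} (l : DualJetFiber n N π y) : ∃ z : phaseFiber n N π y,
    ∀ γ : jetFiber n N π y, z.1.compContinuousLinearMap γ.1 = l γ := by
  obtain ⟨z, hz, hzl⟩ := exists_phase (T := TotalModel n N) (tproj n N π y) (jetFiber n N π y)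
    (hne := (inferInstance : Nonempty (jetFiber n N π y)))
    (fun γ => ⟨fun h v => DFunLike.congr_fun h v, fun h => ContinuousLinearMap.ext h⟩) l
  exact ⟨⟨z, hz⟩, hzl⟩

/-- The map `Φ : Z_y → J¹_y Y^⋆`, `Φ(z)(γ) = γ^* z`, is one-to-one. -/
theorem phase_unique {y : Y} {z z' : phaseFiber n N π y}
    (h : ∀ γ : jetFiber n N π y, z.1.compContinuousLinearMap γ.1 =
      z'.1.compContinuousLinearMap γ.1) : z = z' := by
  obtain ⟨γ₀⟩ : Nonempty (jetFiber n N π y) := inferInstance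
  refine sub_eq_zero.1 (Subtype.ext ?_)
  refine phase_eq_zero (T := TotalModel n N) (tproj n N π y) (γ₀ := γ₀.1)
    (fun v => DFunLike.congr_fun γ₀.2 v) (z - z').2 fun γ hγ => ?_
  have := h ⟨γ, ContinuousLinearMap.ext hγ⟩
  refine ContinuousAlternatingMap.ext fun u => ?_
  exact sub_eq_zero.2 (DFunLike.congr_fun this u)

/-- The inverse of the canonical isomorphism `Φ : Z_y → J¹_y Y^⋆`, `Φ(z)(γ) = γ^* z`. -/
def dualToPhase {y : Y} (l : DualJetFiber n N π y) : phaseFiber n N π y :=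
  (exists_phase_of_dual l).choose

theorem dualToPhase_spec {y : Y} (l : DualJetFiber n N π y) (γ : jetFiber n N π y) :
    (dualToPhase l).1.compContinuousLinearMap γ.1 = l γ :=
  (exists_phase_of_dual l).choose_spec γ

variable (n N π) in
/-- A Lagrangian density: a smooth bundle map `𝓛 : J¹Y → Λ^{n+1} T^* X` over `X`. Smoothness means
that the representative of `𝓛` in each preferred chart of `X` is smooth. -/
structure Lagrangian where
  toFun : ∀ γ : JetBundle n N π,
    TangentSpace 𝓘(ℝ, BaseModel n) (π γ.pt) [⋀^Fin (n + 1)]→L[ℝ] ℝ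
  smooth : ∀ x₀ : X, ContMDiffOn 𝓘(ℝ, TotalModel n N × (BaseModel n →L[ℝ] FiberModel N))
    𝓘(ℝ, BaseModel n [⋀^Fin (n + 1)]→L[ℝ] ℝ) ∞
    (fun γ => (toFun γ).compContinuousLinearMap
      (mfderiv 𝓘(ℝ, BaseModel n) 𝓘(ℝ, BaseModel n) (chartAt (BaseModel n) x₀) (π γ.pt)).inverse)
    {γ | π γ.pt ∈ (chartAt (BaseModel n) x₀).source}

namespace Lagrangian
variable (L : Lagrangian n N π)

/-- The derivative `d/dε 𝓛(γ + ε(γ' - γ))` at `ε = 0`, within the fibre `J¹_y Y`. -/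
def fiberDeriv (y : Y) (γ γ' : jetFiber n N π y) :
    TangentSpace 𝓘(ℝ, BaseModel n) (π y) [⋀^Fin (n + 1)]→L[ℝ] ℝ :=
  deriv (F := BaseModel n [⋀^Fin (n + 1)]→L[ℝ] ℝ)
    (fun ε : ℝ => L.toFun ⟨y, AffineMap.lineMap γ γ' ε⟩) 0

theorem contMDiff_fiberIncl (y : Y) :
    ContMDiff 𝓘(ℝ, BaseModel n →L[ℝ] FiberModel N)
      𝓘(ℝ, TotalModel n N × (BaseModel n →L[ℝ] FiberModel N)) ∞
      (fun A => (⟨y, (exists_adaptedChart (n := n) (N := N) π y).choose.jetMk y A⟩ :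
        JetBundle n N π)) := by
  obtain ⟨γ⟩ : Nonempty (jetFiber n N π y) := inferInstance
  have hy := (exists_adaptedChart (n := n) (N := N) π y).choose_spec
  let e := chartAt (TotalModel n N × (BaseModel n →L[ℝ] FiberModel N))
    (⟨y, γ⟩ : JetBundle n N π)
  have he : ∀ A, e.symm ((exists_adaptedChart (n := n) (N := N) π y).choose.tot y, A) =
      (⟨y, (exists_adaptedChart (n := n) (N := N) π y).choose.jetMk y A⟩ :
        JetBundle n N π) := by
    intro A
    exact congrArg (fun y' => (⟨y', (exists_adaptedChart (n := n) (N := N)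
      π y).choose.jetMk y' A⟩ : JetBundle n N π))
      ((exists_adaptedChart (n := n) (N := N) π y).choose.tot.left_inv hy)
  have h1 : ContMDiffOn 𝓘(ℝ, TotalModel n N × (BaseModel n →L[ℝ] FiberModel N))
      𝓘(ℝ, TotalModel n N × (BaseModel n →L[ℝ] FiberModel N)) ∞ e.symm e.target :=
    contMDiffOn_chart_symm
  have h2 : ContMDiff 𝓘(ℝ, BaseModel n →L[ℝ] FiberModel N)
      𝓘(ℝ, TotalModel n N × (BaseModel n →L[ℝ] FiberModel N)) ∞
      (fun A : BaseModel n →L[ℝ] FiberModel N =>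
        ((exists_adaptedChart (n := n) (N := N) π y).choose.tot y, A)) :=
    (contDiff_const.prodMk contDiff_id).contMDiff
  have h3 := h1.comp_contMDiff h2 fun A =>
    ⟨(exists_adaptedChart (n := n) (N := N) π y).choose.tot.map_source hy, trivial⟩
  exact h3.congr fun A => (he A).symm

theorem differentiable_fiber (y : Y) :
    Differentiable ℝ (F := BaseModel n [⋀^Fin (n + 1)]→L[ℝ] ℝ)
      (fun A : BaseModel n →L[ℝ] FiberModel N =>
        L.toFun ⟨y, (exists_adaptedChart (n := n) (N := N) π y).choose.jetMk y A⟩) := by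
  have h1 := (L.smooth (π y)).comp_contMDiff (contMDiff_fiberIncl (π := π) y)
    fun A => mem_chart_source (BaseModel n) (π y)
  have h2 := h1.contDiff.differentiable (by simp)
  let D : BaseModel n →L[ℝ] BaseModel n :=
    mfderiv 𝓘(ℝ, BaseModel n) 𝓘(ℝ, BaseModel n) (chartAt (BaseModel n) (π y)) (π y)
  have hD : D.inverse.comp D = ContinuousLinearMap.id ℝ _ :=
    ContinuousLinearMap.IsInvertible.inverse_comp_self
      ⟨((mdifferentiable_chart (I := 𝓘(ℝ, BaseModel n)) (π y)).mfderiv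
        (mem_chart_source (BaseModel n) (π y))), rfl⟩
  have h3 := (ContinuousAlternatingMap.compContinuousLinearMapCLM (𝕜 := ℝ) (F := ℝ)
    (ι := Fin (n + 1)) D).differentiable.comp h2
  have h4 : (fun A : BaseModel n →L[ℝ] FiberModel N =>
      (L.toFun ⟨y, (exists_adaptedChart (n := n) (N := N) π y).choose.jetMk y A⟩ :
        BaseModel n [⋀^Fin (n + 1)]→L[ℝ] ℝ)) = fun A =>
      ((L.toFun ⟨y, (exists_adaptedChart (n := n) (N := N) π y).choose.jetMk y A⟩ :
        BaseModel n [⋀^Fin (n + 1)]→L[ℝ] ℝ).compContinuousLinearMap D.inverse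
        ).compContinuousLinearMap D := by
    funext A
    refine ContinuousAlternatingMap.ext fun u => ?_
    exact congrArg _ (funext fun i => (DFunLike.congr_fun hD (u i)).symm)
  rw [h4]
  exact h3

/-- The fibre derivative depends linearly on `γ' - γ`. -/
theorem exists_fiberDeriv (y : Y) (γ : jetFiber n N π y) :
    ∃ D : (jetFiber n N π y).direction →ₗ[ℝ] (BaseModel n [⋀^Fin (n + 1)]→L[ℝ] ℝ),
      ∀ γ' : jetFiber n N π y, L.fiberDeriv y γ γ' = D (γ' -ᵥ γ) := by
  have ha := (exists_adaptedChart (n := n) (N := N) π y).choose_spec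
  let a := (exists_adaptedChart (n := n) (N := N) π y).choose
  refine exists_linear_deriv (F := BaseModel n [⋀^Fin (n + 1)]→L[ℝ] ℝ) (jetFiber n N π y)
    (compLin ((ContinuousLinearMap.snd ℝ (BaseModel n) (FiberModel N)).comp (a.dTot y))
      (a.dBase (π y)).inverse) (L.differentiable_fiber y) (fun γ' => L.toFun ⟨y, γ'⟩)
    (fun γ' => ?_) γ
  have h : a.jetMk y (a.jetCoord γ') = γ' := AdaptedChart.jetMk_jetCoord ha γ'
  change L.toFun ⟨y, γ'⟩ = L.toFun ⟨y, a.jetMk y (a.jetCoord γ')⟩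
  rw [h]

/-- The affine map `γ' ↦ 𝓛(γ) + d/dε 𝓛(γ + ε(γ' - γ))`, in `J¹_y Y^⋆`. -/
def legendreDual (y : Y) (γ : jetFiber n N π y) : DualJetFiber n N π y :=
  affineOfDeriv (jetFiber n N π y) γ (L.toFun ⟨y, γ⟩) (L.fiberDeriv y γ) (L.exists_fiberDeriv y γ)

theorem legendreDual_apply (y : Y) (γ γ' : jetFiber n N π y) :
    L.legendreDual y γ γ' = L.toFun ⟨y, γ⟩ + L.fiberDeriv y γ γ' := rfl

/-- The covariant Legendre transform `𝔽𝓛 : J¹Y → J¹Y^⋆ ≅ Z`. -/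
def legendre (γ : JetBundle n N π) : PhaseSpace n N π :=
  ⟨γ.pt, dualToPhase (L.legendreDual γ.pt γ.jet)⟩

end Lagrangian
end Legendre

section Main
variable {𝔤 : Type*} [AddCommGroup 𝔤] [Module ℝ 𝔤] [TopologicalSpace 𝔤]
  {G : Type*} [Group G] [TopologicalSpace G] [ChartedSpace 𝔤 G] [MulAction G X] [MulAction G Y]
  {π : Y → X} [IsSmoothFiberBundle n N π]

variable (n N π) in
/-- The canonical `(n+1)`-form `Θ` on `Z`: `Θ(z)(u₀, …, u_n) = z(T u₀, …, T u_n)`, where `T` is the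
tangent map of `Z → Y`. -/
def canonicalForm : DForm (TotalModel n N × PhaseModel n N) (PhaseSpace n N π) (n + 1) :=
  fun z => z.form.1.compContinuousLinearMap
    (mfderiv 𝓘(ℝ, TotalModel n N × PhaseModel n N) 𝓘(ℝ, TotalModel n N)
      (PhaseSpace.pt : PhaseSpace n N π → Y) z)

section
variable (n N π G) [IsAutAction n N G π]

/-- The infinitesimal generator `ξ_{J¹Y}` of the lifted action on `J¹Y`. -/
def jetGenerator (ξ : 𝔤) (γ : JetBundle n N π) :
    TangentSpace 𝓘(ℝ, TotalModel n N × (BaseModel n →L[ℝ] FiberModel N)) γ :=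
  generator (fun (g : G) γ' => jetLift n N π g γ') ξ γ

/-- The infinitesimal generator `ξ_Z` of the lifted action on `Z`. -/
def phaseGenerator (ξ : 𝔤) (z : PhaseSpace n N π) :
    TangentSpace 𝓘(ℝ, TotalModel n N × PhaseModel n N) z :=
  generator (fun (g : G) z' => phaseLift n N π g z') ξ z

/-- The special covariant momentum map `J(ξ) = ξ_Z ⌟ Θ` on `Z`. -/
def momentumMap (ξ : 𝔤) : DForm (TotalModel n N × PhaseModel n N) (PhaseSpace n N π) n :=
  (canonicalForm n N π).interior (phaseGenerator n N G π ξ)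

/-- A covariant momentum map for the lifted action on `J¹Y`, relative to the `(n+2)`-form `Ω`: a
map `γ ↦ (ξ ↦ J(ξ)(γ))` with values in the continuous linear maps from `𝔤` to the `n`-covectors,
such that each `J(ξ)` is a smooth `n`-form with `dJ(ξ) = ξ_{J¹Y} ⌟ Ω`. -/
structure IsCovariantMomentumMap
    (Ω : DForm (TotalModel n N × (BaseModel n →L[ℝ] FiberModel N)) (JetBundle n N π) (n + 2))
    (J : 𝔤 → DForm (TotalModel n N × (BaseModel n →L[ℝ] FiberModel N)) (JetBundle n N π) n) :
    Prop where
  linear : ∀ γ : JetBundle n N π, IsLinearMap ℝ fun ξ =>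
    (J ξ γ : (TotalModel n N × (BaseModel n →L[ℝ] FiberModel N)) [⋀^Fin n]→L[ℝ] ℝ)
  continuous : ∀ γ : JetBundle n N π, Continuous fun ξ =>
    (J ξ γ : (TotalModel n N × (BaseModel n →L[ℝ] FiberModel N)) [⋀^Fin n]→L[ℝ] ℝ)
  smooth : ∀ ξ, (J ξ).IsSmooth
  interior_eq : ∀ ξ, Ω.interior (jetGenerator n N G π ξ) = (J ξ).d

end

namespace Lagrangian
variable (L : Lagrangian n N π)

variable (G) in
/-- Equivariance of the Lagrangian density: `𝓛(η_{J¹Y}(γ)) = (η_X⁻¹)^* 𝓛(γ)`. -/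
def IsEquivariant [IsAutAction n N G π] : Prop :=
  ∀ (g : G) (γ : JetBundle n N π), L.toFun (jetLift n N π g γ) =
    (L.toFun γ).compContinuousLinearMap (dSmulBase g⁻¹ (π (g • γ.pt)))

/-- The Cartan form `Θ_𝓛 = 𝔽𝓛^* Θ`. -/
def cartanForm :
    DForm (TotalModel n N × (BaseModel n →L[ℝ] FiberModel N)) (JetBundle n N π) (n + 1) :=
  (canonicalForm n N π).pullback L.legendre

/-- `Ω_𝓛 = -d Θ_𝓛`. -/
def multisymplecticForm :
    DForm (TotalModel n N × (BaseModel n →L[ℝ] FiberModel N)) (JetBundle n N π) (n + 2) :=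
  -L.cartanForm.d

variable (G) in
/-- `J^𝓛(ξ) = 𝔽𝓛^* J(ξ)`. -/
def lagrangianMomentumMap [IsAutAction n N G π] (ξ : 𝔤) :
    DForm (TotalModel n N × (BaseModel n →L[ℝ] FiberModel N)) (JetBundle n N π) n :=
  (momentumMap n N G π ξ).pullback L.legendre

end Lagrangian
end Main
end Bundle
end FieldTheory
end

open FieldTheory

/-! Everything rests on equivariance of the Legendre transform, on a pointwise formula for the
Cartan form, and on Cartan's formula for invariant forms.

Equivariance (`Lagrangian.phaseLift_legendre`): an element of `Z` is determined by its pullbacks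
along jets. Every jet over `g • y` is the lift of a jet over `y`, and the lift is affine on fibres,
so it carries the segment from `γ` to `δ` to the segment between their lifts. Differentiating the
equivariance of the density along such segments gives equivariance of `𝔽𝓛`.

Cartan form: since `𝔽𝓛` covers the identity of `Y`, `Θ_𝓛(γ)` is the form `𝔽𝓛(γ)` evaluated on
projections to `TY` (`Lagrangian.cartanForm_apply`). The derivative of `𝔽𝓛` drops out. In natural
coordinates `𝔽𝓛` is characterised by its values on graphs of linear maps, where it equals the
density plus a directional derivative of it (`Lagrangian.coordForm_graph`). This gives smoothness of
`𝔽𝓛` and of `Θ_𝓛`. Invariance follows because `T η_Y` and the pullback by `η_Y⁻¹` cancel.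

Momentum map: equivariance along a curve in the group shows that `T𝔽𝓛` sends `ξ_{J¹Y}` to `ξ_Z`, so
`J^𝓛(ξ) = ξ_{J¹Y} ⌟ Θ_𝓛`. From `L_ξ Θ_𝓛 = 0` and Cartan's formula, `d(ξ_{J¹Y} ⌟ Θ_𝓛) = -ξ_{J¹Y} ⌟
dΘ_𝓛`. No exponential map or flow is required: differentiating the invariance at `t = 0` uses only a
smooth family of maps starting at the identity (`extDeriv_interior_of_invariant`), and the family
attached to a straight line in the chart of the group at `1` is one.

The group may be infinite-dimensional, but only through finite-dimensional slices: along affine maps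
from finite-dimensional spaces, Michal–Bastiani smoothness becomes ordinary smoothness
(`BastianiContDiffOn.contDiffOn`). Linearity and continuity of `J^𝓛` in `ξ` come from the generator
on `Y`, the only part of `ξ_{J¹Y}` that `Θ_𝓛` sees. -/

noncomputable section
namespace FieldTheory

/-! ### Michal–Bastiani calculus and its agreement with ordinary calculus in finite dimension -/

section Bastiani

/-- Precomposition with a continuous affine map preserves Michal–Bastiani differentiability. -/
theorem BastianiContDiffOn.comp_affine {F : Type*} [AddCommGroup F] [Module ℝ F]
    [TopologicalSpace F] (k : ℕ) :
    ∀ {E : Type*} [AddCommGroup E] [Module ℝ E] [TopologicalSpace E] [IsTopologicalAddGroup E]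
      {E' : Type*} [AddCommGroup E'] [Module ℝ E'] [TopologicalSpace E']
      {f : E → F} {s : Set E} (_ : BastianiContDiffOn k f s) (c : E) (A : E' →L[ℝ] E),
      BastianiContDiffOn k (fun p => f (c + A p)) ((fun p => c + A p) ⁻¹' s) := by
  -- The spaces `E` and `E'` stay quantified inside the induction, because the derivative lives on
  -- `E × E`.
  induction k with
  | zero =>
    intro E _ _ _ _ E' _ _ _ f s h c A
    have hA : Continuous fun p => c + A p := by fun_prop
    exact ContinuousOn.comp (g := f) h hA.continuousOn fun p hp => hp
  | succ k ih =>
    intro E _ _ _ _ E' _ _ _ f s h c A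
    obtain ⟨hf, df, hdf, hk⟩ := h
    have hA : Continuous fun p => c + A p := by fun_prop
    refine ⟨ContinuousOn.comp (g := f) hf hA.continuousOn fun p hp => hp,
      fun q => df (c + A q.1, A q.2), fun x hx v => ?_, ?_⟩
    · have := hdf (c + A x) hx (A v)
      simpa only [map_add, map_smul, add_assoc] using this
    -- The derivative of the composite is `df` after another affine map, with base point `(c, 0)`
    -- and linear part `A × A`.
    · have h1 := ih hk ((c, 0) : E × E) (A.prodMap A)
      have e1 : (fun q : E' × E' => df (c + A q.1, A q.2)) =
          fun q => df (((c, 0) : E × E) + (A.prodMap A) q) :=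
        funext fun q => congrArg df (Prod.ext rfl (zero_add (A q.2)).symm)
      have e2 : ((fun p => c + A p) ⁻¹' s) ×ˢ (Set.univ : Set E') =
          (fun q => ((c, 0) : E × E) + (A.prodMap A) q) ⁻¹' (s ×ˢ Set.univ) := by
        ext q; simp
      rw [e1, e2]
      exact h1

variable {E F : Type*} [NormedAddCommGroup E] [NormedSpace ℝ E] [FiniteDimensional ℝ E]
  [NormedAddCommGroup F] [NormedSpace ℝ F]

/-- A function on an open subset of a finite-dimensional space whose directional derivatives exist
and are jointly continuous is strictly differentiable. -/
theorem hasStrictFDerivAt_of_directional {f : E → F} {s : Set E} (hs : IsOpen s)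
    {df : E × E → F}
    (h : ∀ x ∈ s, ∀ v : E, Filter.Tendsto (fun t : ℝ => t⁻¹ • (f (x + t • v) - f x)) (𝓝[≠] 0)
        (𝓝 (df (x, v)))) (hc : ContinuousOn df (s ×ˢ Set.univ)) {x : E} (hx : x ∈ s) :
    ∃ f' : E →L[ℝ] F, (∀ v, f' v = df (x, v)) ∧ HasStrictFDerivAt f f' x := by
  have hd : ∀ x ∈ s, ∀ v, HasDerivAt (fun t : ℝ => f (x + t • v)) (df (x, v)) 0 := by
    intro x hx v
    rw [hasDerivAt_iff_tendsto_slope]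
    refine (h x hx v).congr fun t => ?_
    simp [slope, vsub_eq_sub]
  have hd' : ∀ x v (t₀ : ℝ), x + t₀ • v ∈ s →
      HasDerivAt (fun t : ℝ => f (x + t • v)) (df (x + t₀ • v, v)) t₀ := by
    intro x v t₀ ht
    have h1 := hd _ ht v
    have h2 := HasDerivAt.scomp (h := fun t => t - t₀) (h' := 1) t₀
      (by rw [sub_self]; exact h1) ((hasDerivAt_id t₀).sub_const t₀)
    rw [one_smul] at h2
    refine h2.congr_of_eventuallyEq (Filter.Eventually.of_forall fun t => ?_)
    simp only [Function.comp_apply]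
    congr 1
    rw [sub_smul]; abel
  -- Homogeneity comes from rescaling time. The case `c = 0` is included and gives `df (z, 0) = 0`.
  -- The derivative `h2` is placed at `0 * c` to match the chain rule for `t ↦ t * c`.
  have hom : ∀ z ∈ s, ∀ (c : ℝ) v, df (z, c • v) = c • df (z, v) := by
    intro z hz c v
    have h1 := hd z hz (c • v)
    have h2 : HasDerivAt (fun t : ℝ => f (z + t • v)) (df (z, v)) (0 * c) := by
      rw [zero_mul]; exact hd z hz v
    have h3 := h2.scomp (0 : ℝ) ((hasDerivAt_id (0 : ℝ)).mul_const c)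
    rw [one_mul] at h3
    refine h1.unique (h3.congr_of_eventuallyEq (Filter.Eventually.of_forall fun t => ?_))
    simp [mul_smul]
  -- Compactness of the unit sphere makes the continuity of `df` in the base point uniform over
  -- directions; homogeneity extends the bound to all `v`. This is where finite dimension of `E`
  -- enters.
  have key : ∀ ε > 0, ∃ δ > 0, Metric.ball x δ ⊆ s ∧ ∀ z ∈ Metric.ball x δ, ∀ v,
      ‖df (z, v) - df (x, v)‖ ≤ ε * ‖v‖ := by
    intro ε hε
    have h1 : ∀ᶠ z in 𝓝 x, ∀ v ∈ Metric.sphere (0 : E) 1, ‖df (z, v) - df (x, v)‖ < ε := by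
      refine (isCompact_sphere (0 : E) 1).eventually_forall_of_forall_eventually fun v _ => ?_
      have h2 : ContinuousAt df (x, v) :=
        hc.continuousAt ((hs.prod isOpen_univ).mem_nhds ⟨hx, trivial⟩)
      have h3 : ContinuousAt (fun q : E × E => ‖df (q.1, q.2) - df (x, q.2)‖) (x, v) := by
        refine (ContinuousAt.sub h2 ?_).norm
        exact ContinuousAt.comp (f := fun q : E × E => (x, q.2)) (x := (x, v)) (g := df) h2
          (by fun_prop)
      have h4 : ‖df (x, v) - df (x, v)‖ < ε := by simpa using hε
      have := h3.eventually (gt_mem_nhds h4)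
      simpa using! this
    obtain ⟨δ, hδ, hb⟩ := Metric.eventually_nhds_iff_ball.1 (h1.and (hs.mem_nhds hx))
    refine ⟨δ, hδ, fun z hz => (hb z hz).2, fun z hz v => ?_⟩
    by_cases hv : v = 0
    · subst hv
      have e := fun z hz => hom z hz 0 0
      simp only [zero_smul] at e
      rw [e z (hb z hz).2, e x hx]; simp
    · have h2 := (hb z hz).1 (‖v‖⁻¹ • v) (by simp [norm_smul, hv])
      rw [hom z (hb z hz).2, hom x hx, ← smul_sub, norm_smul, norm_inv, norm_norm,
        inv_mul_lt_iff₀ (norm_pos_iff.2 hv)] at h2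
      rw [mul_comm]; exact h2.le
  -- Mean value inequality on the segment from `y` to `z` for `f` minus the candidate derivative at
  -- `x`. Once additivity is known, this is exactly strict differentiability.
  have mv : ∀ ε > 0, ∃ δ > 0, ∀ y ∈ Metric.ball x δ, ∀ z ∈ Metric.ball x δ,
      ‖f z - f y - df (x, z - y)‖ ≤ ε * ‖z - y‖ := by
    intro ε hε
    obtain ⟨δ, hδ, hb, hk⟩ := key ε hε
    refine ⟨δ, hδ, fun y hy z hz => ?_⟩
    have hseg : ∀ t ∈ Set.Icc (0 : ℝ) 1, y + t • (z - y) ∈ Metric.ball x δ := fun t ht =>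
      (convex_ball x δ).add_smul_sub_mem hy hz ht
    have := norm_image_sub_le_of_norm_deriv_le_segment_01'
      (f := fun t : ℝ => f (y + t • (z - y)) - t • df (x, z - y))
      (f' := fun t => df (y + t • (z - y), z - y) - df (x, z - y)) (C := ε * ‖z - y‖)
      (fun t ht => by
        have h1 := hd' y (z - y) t (hb (hseg t ht))
        have h2 := (hasDerivAt_id t).smul_const (df (x, z - y))
        rw [one_smul] at h2
        exact (h1.sub h2).hasDerivWithinAt)
      (fun t ht => hk _ (hseg t ⟨ht.1, ht.2.le⟩) _)
    simp only [one_smul, zero_smul, sub_zero, add_zero, add_sub_cancel] at this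
    rw [sub_right_comm] at this
    exact this
  -- Additivity: go from `x` to `x + t(v + w)` directly and by way of `x + tv`. Both increments are
  -- approximated with error of order `ε t`, so dividing by `t` bounds the defect by a multiple of
  -- `ε`.
  have hadd : ∀ v w, df (x, v + w) = df (x, v) + df (x, w) := by
    intro v w
    rw [← sub_eq_zero, ← norm_le_zero_iff]
    refine le_of_forall_pos_le_add fun η hη => ?_
    rw [zero_add]
    obtain ⟨ε, hε, hεη⟩ : ∃ ε > 0, ε * (‖v + w‖ + ‖v‖ + ‖w‖) ≤ η := by
      -- The summand `1` keeps the denominator positive when `v = w = 0`.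
      refine ⟨η / (‖v + w‖ + ‖v‖ + ‖w‖ + 1), by positivity, ?_⟩
      rw [div_mul_eq_mul_div, div_le_iff₀ (by positivity)]
      nlinarith [norm_nonneg (v + w), norm_nonneg v, norm_nonneg w]
    obtain ⟨δ, hδ, hm⟩ := mv ε hε
    have hcv : ∀ u : E, ∀ᶠ t : ℝ in 𝓝[>] 0, x + t • u ∈ Metric.ball x δ := by
      intro u
      have : Continuous fun t : ℝ => x + t • u := by fun_prop
      refine nhdsWithin_le_nhds (this.continuousAt.preimage_mem_nhds ?_)
      simpa using Metric.ball_mem_nhds x hδ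
    obtain ⟨t, ⟨h1, h2⟩, ht⟩ := (((hcv v).and (hcv (v + w))).and
      (self_mem_nhdsWithin (s := Set.Ioi (0 : ℝ)))).exists
    have ht' : (0 : ℝ) < t := ht
    have hx' := Metric.mem_ball_self (x := x) hδ
    have e1 := hm _ hx' _ h2
    have e2 := hm _ hx' _ h1
    have e3 := hm _ h1 _ h2
    have a1 : x + t • (v + w) - x = t • (v + w) := by abel
    have a2 : x + t • v - x = t • v := by abel
    have a3 : x + t • (v + w) - (x + t • v) = t • w := by rw [smul_add]; abel
    rw [a1, hom x hx, norm_smul, Real.norm_of_nonneg ht'.le] at e1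
    rw [a2, hom x hx, norm_smul, Real.norm_of_nonneg ht'.le] at e2
    rw [a3, hom x hx, norm_smul, Real.norm_of_nonneg ht'.le] at e3
    have e4 : t • (df (x, v + w) - (df (x, v) + df (x, w))) =
      (f (x + t • v) - f x - t • df (x, v)) +
      (f (x + t • (v + w)) - f (x + t • v) - t • df (x, w)) -
      (f (x + t • (v + w)) - f x - t • df (x, v + w)) := by
      rw [smul_sub, smul_add]; abel
    have e5 : t * ‖df (x, v + w) - (df (x, v) + df (x, w))‖ ≤
        t * (ε * (‖v + w‖ + ‖v‖ + ‖w‖)) := by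
      calc _ = ‖t • (df (x, v + w) - (df (x, v) + df (x, w)))‖ := by
            rw [norm_smul, Real.norm_of_nonneg ht'.le]
        _ ≤ _ := by
            rw [e4]
            refine (norm_sub_le _ _).trans (?_)
            have := norm_add_le (f (x + t • v) - f x - t • df (x, v))
              (f (x + t • (v + w)) - f (x + t • v) - t • df (x, w))
            linarith
    exact (le_of_mul_le_mul_left e5 ht').trans hεη
  let f' : E →L[ℝ] F := LinearMap.toContinuousLinearMap
    { toFun := fun v => df (x, v)
      map_add' := hadd
      map_smul' := hom x hx }
  refine ⟨f', fun v => rfl, HasStrictFDerivAt.of_isLittleO ?_⟩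
  rw [Asymptotics.isLittleO_iff]
  intro ε hε
  obtain ⟨δ, hδ, hm⟩ := mv ε hε
  filter_upwards [prod_mem_nhds (Metric.ball_mem_nhds x hδ) (Metric.ball_mem_nhds x hδ)] with p hp
  exact hm _ hp.2 _ hp.1

/-- Joint continuity of the directional derivatives gives a Fréchet derivative. A map into
continuous linear maps on a finite-dimensional space is `C^k` once its value on each fixed `v` is,
and freezing `v` in `df` is precomposition with an affine map `E → E × E`. The induction therefore
returns to functions on `E` itself. -/
theorem BastianiContDiffOn.contDiffOn (k : ℕ) {f : E → F} {s : Set E} (hs : IsOpen s)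
    (h : BastianiContDiffOn k f s) : ContDiffOn ℝ k f s := by
  induction k generalizing f with
  | zero => exact contDiffOn_zero.2 h
  | succ k ih =>
    obtain ⟨-, df, hdf, hk⟩ := h
    -- Continuity is the whole content of `C⁰` and the first component of `C^{k+1}`, whence the case
    -- distinction.
    have hc : ContinuousOn df (s ×ˢ Set.univ) := by
      cases k with
      | zero => exact hk
      | succ k => exact hk.1
    rw [show ((k + 1 : ℕ) : WithTop ℕ∞) = (k : WithTop ℕ∞) + 1 by norm_cast,
      contDiffOn_succ_iff_fderiv_of_isOpen hs]
    have h1 := fun x (hx : x ∈ s) => hasStrictFDerivAt_of_directional hs hdf hc hx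
    refine ⟨fun x hx => ?_, by simp, ?_⟩
    · obtain ⟨f', -, h2⟩ := h1 x hx
      exact h2.hasFDerivAt.differentiableAt.differentiableWithinAt
    · rw [contDiffOn_clm_apply]
      intro v
      have h3 := BastianiContDiffOn.comp_affine k hk ((0, v) : E × E)
        (ContinuousLinearMap.inl ℝ E E)
      have h4 : (fun p : E => ((0, v) : E × E) + ContinuousLinearMap.inl ℝ E E p) ⁻¹'
          (s ×ˢ Set.univ) = s := by
        ext p; simp
      rw [h4] at h3
      refine (ih h3).congr fun x hx => ?_
      obtain ⟨f', h5, h2⟩ := h1 x hx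
      rw [h2.hasFDerivAt.fderiv, h5]; simp

theorem BastianiSmoothOn.contDiffOn {f : E → F} {s : Set E} (hs : IsOpen s)
    (h : BastianiSmoothOn f s) : ContDiffOn ℝ ∞ f s :=
  contDiffOn_infty.2 fun k => (h k).contDiffOn k hs

theorem BastianiSmoothOn.comp_affine {F : Type*} [AddCommGroup F] [Module ℝ F]
    [TopologicalSpace F] {E : Type*} [AddCommGroup E] [Module ℝ E] [TopologicalSpace E]
    [IsTopologicalAddGroup E] {E' : Type*} [AddCommGroup E'] [Module ℝ E'] [TopologicalSpace E']
    {f : E → F} {s : Set E} (h : BastianiSmoothOn f s) (c : E) (A : E' →L[ℝ] E) :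
    BastianiSmoothOn (fun p => f (c + A p)) ((fun p => c + A p) ⁻¹' s) :=
  fun k => (h k).comp_affine k c A

/-- The derivative of a Michal–Bastiani smooth map is linear and continuous in the direction. -/
theorem BastianiSmoothOn.exists_clm {F : Type*} [NormedAddCommGroup F] [NormedSpace ℝ F]
    {E : Type*} [AddCommGroup E] [Module ℝ E] [TopologicalSpace E]
    [IsTopologicalAddGroup E] [ContinuousSMul ℝ E] {f : E → F} {s : Set E} (hs : IsOpen s)
    (h : BastianiSmoothOn f s) {x : E} (hx : x ∈ s) :
    ∃ f' : E →L[ℝ] F, ∀ v, HasDerivAt (fun t : ℝ => f (x + t • v)) (f' v) 0 := by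
  obtain ⟨-, df, hdf, hc⟩ := h 1
  have hd : ∀ v, HasDerivAt (fun t : ℝ => f (x + t • v)) (df (x, v)) 0 := by
    intro v
    rw [hasDerivAt_iff_tendsto_slope]
    refine (hdf x hx v).congr fun t => ?_
    simp [slope, vsub_eq_sub]
  -- Linearity involves only two directions at a time, so it can be checked on the plane `x + a v +
  -- b w`, where the function is differentiable in the ordinary sense.
  have hlin : ∀ (a b : ℝ) v w, df (x, a • v + b • w) = a • df (x, v) + b • df (x, w) := by
    intro a b v w
    let A : ℝ × ℝ →L[ℝ] E := (ContinuousLinearMap.fst ℝ ℝ ℝ).smulRight v +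
      (ContinuousLinearMap.snd ℝ ℝ ℝ).smulRight w
    have hA : ∀ q, A q = q.1 • v + q.2 • w := fun _ => rfl
    have hcont : Continuous fun p : ℝ × ℝ => x + A p := by fun_prop
    have h1 := ((h.comp_affine x A).contDiffOn (hs.preimage hcont)).contDiffAt
      ((hs.preimage hcont).mem_nhds (x := 0) (by simpa using hx))
    have h2 := (h1.differentiableAt (by simp)).hasFDerivAt
    have h3 : ∀ q : ℝ × ℝ, df (x, A q) = fderiv ℝ (fun p => f (x + A p)) 0 q := by
      intro q
      have h4 : HasFDerivAt (fun p => f (x + A p)) (fderiv ℝ (fun p => f (x + A p)) 0)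
        ((0 : ℝ) • q) := by rw [zero_smul]; exact h2
      have h5 := h4.comp_hasDerivAt (0 : ℝ) ((hasDerivAt_id (0 : ℝ)).smul_const q)
      rw [one_smul] at h5
      refine (hd (A q)).unique (h5.congr_of_eventuallyEq (Filter.Eventually.of_forall fun t => ?_))
      simp
    have e1 := h3 (a, b)
    have e2 := h3 (1, 0)
    have e3 := h3 (0, 1)
    simp only [hA, one_smul, zero_smul, add_zero, zero_add] at e1 e2 e3
    rw [e1, e2, e3, ← map_smul, ← map_smul, ← map_add]
    simp
  have hcont : Continuous fun v => df (x, v) := by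
    rw [← continuousOn_univ]
    exact ContinuousOn.comp (g := df) hc (by fun_prop) fun v _ => ⟨hx, trivial⟩
  exact ⟨⟨⟨⟨fun v => df (x, v), fun v w => by simpa using hlin 1 1 v w⟩,
    fun c v => by simpa using hlin c 0 v 0⟩, hcont⟩, hd⟩

end Bastiani

/-! ### Smooth dependence of forms on parameters, and Cartan's formula in a vector space -/

section Forms
variable {E : Type*} [NormedAddCommGroup E] [NormedSpace ℝ E]

/-- A map to a finite-dimensional space is smooth if its compositions with a separating family of
linear functionals are. -/
theorem contDiffOn_of_separating {V W ι : Type*} [NormedAddCommGroup V] [NormedSpace ℝ V]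
    [NormedAddCommGroup W] [NormedSpace ℝ W] [FiniteDimensional ℝ W] (ev : ι → W →ₗ[ℝ] ℝ)
    (hev : ∀ w, (∀ i, ev i w = 0) → w = 0) {f : V → W} {S : Set V}
    (h : ∀ i, ContDiffOn ℝ ∞ (fun q => ev i (f q)) S) : ContDiffOn ℝ ∞ f S := by
  -- A separating family spans the dual: otherwise a nonzero functional on the dual vanishes on its
  -- span. By reflexivity that functional is evaluation at some `w`, and separation forces `w = 0`.
  have htop : Submodule.span ℝ (Set.range ev) = ⊤ := by
    by_contra hne
    obtain ⟨α, hα, hle⟩ := Submodule.exists_le_ker_of_lt_top _ (lt_top_iff_ne_top.2 hne)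
    obtain ⟨w, rfl⟩ := (Module.evalEquiv ℝ W).surjective α
    refine hα ?_
    rw [hev w fun i => hle (Submodule.subset_span ⟨i, rfl⟩), map_zero]
  have hall : ∀ φ : W →ₗ[ℝ] ℝ, ContDiffOn ℝ ∞ (fun q => φ (f q)) S := by
    intro φ
    have hφ : φ ∈ Submodule.span ℝ (Set.range ev) := by rw [htop]; trivial
    induction hφ using Submodule.span_induction with
    | mem φ hφ => obtain ⟨i, rfl⟩ := hφ; exact h i
    | zero => exact contDiffOn_const
    | add φ ψ _ _ h1 h2 => exact h1.add h2
    | smul c φ _ h1 => exact contDiffOn_const.smul h1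
  let b := Module.finBasis ℝ W
  exact contDiffOn_of_coord b.equivFun.toLinearMap b.equivFun.injective
    fun i => hall (b.coord i)

variable {k : ℕ}

instance [FiniteDimensional ℝ E] : FiniteDimensional ℝ (E [⋀^Fin k]→L[ℝ] ℝ) := by
  refine FiniteDimensional.of_injective
    (⟨⟨fun z => z.toMultilinearMap, fun _ _ => rfl⟩, fun _ _ => rfl⟩ :
      (E [⋀^Fin k]→L[ℝ] ℝ) →ₗ[ℝ] MultilinearMap ℝ (fun _ : Fin k => E) ℝ) fun z z' h => ?_
  exact ContinuousAlternatingMap.ext fun u => DFunLike.congr_fun h u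

/-- Evaluations at fixed tuples of vectors separate alternating forms, so smoothness can be tested
on constant arguments. -/
theorem contDiffOn_form_iff [FiniteDimensional ℝ E] {V : Type*} [NormedAddCommGroup V]
    [NormedSpace ℝ V] {f : V → E [⋀^Fin k]→L[ℝ] ℝ} {S : Set V}
    (h : ∀ u : Fin k → E, ContDiffOn ℝ ∞ (fun q => f q u) S) : ContDiffOn ℝ ∞ f S :=
  contDiffOn_of_separating
    (fun u : Fin k → E => (⟨⟨fun z => z u, fun _ _ => rfl⟩, fun _ _ => rfl⟩ :
      (E [⋀^Fin k]→L[ℝ] ℝ) →ₗ[ℝ] ℝ))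
    (fun _ hw => ContinuousAlternatingMap.ext hw) h

/-- The evaluation `(z, u) ↦ z u` is linear in `z` and multilinear in `u`, hence jointly analytic.
-/
theorem contDiffOn_form_apply {V : Type*} [NormedAddCommGroup V] [NormedSpace ℝ V]
    {f : V → E [⋀^Fin k]→L[ℝ] ℝ} {g : V → Fin k → E} {S : Set V}
    (hf : ContDiffOn ℝ ∞ f S) (hg : ContDiffOn ℝ ∞ g S) :
    ContDiffOn ℝ ∞ (fun q => f q (g q)) S := by
  let B : (E [⋀^Fin k]→L[ℝ] ℝ) →L[ℝ] ContinuousMultilinearMap ℝ (fun _ : Fin k => E) ℝ :=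
    ContinuousAlternatingMap.toContinuousMultilinearMapCLM ℝ
  have := ContinuousLinearMap.analyticOnNhd_uncurry_of_multilinear (𝕜 := ℝ)
    (Em := fun _ : Fin k => E) (F := ℝ) (G := E [⋀^Fin k]→L[ℝ] ℝ) B (s := Set.univ)
  have h2 : ContDiff ℝ ∞ (fun p : (E [⋀^Fin k]→L[ℝ] ℝ) × (Fin k → E) => B p.1 p.2) :=
    contDiffOn_univ.1 (this.contDiffOn uniqueDiffOn_univ)
  exact h2.comp_contDiffOn (hf.prodMk hg)

/-- Cartan's formula at a point, for a form invariant under a smooth family `Ψ t` of local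
diffeomorphisms with `Ψ 0 = id` and infinitesimal generator `V`: `d (V ⌟ α) = - V ⌟ dα`. -/
theorem extDeriv_interior_of_invariant {α : E → E [⋀^Fin (k + 1)]→L[ℝ] ℝ} {Ψ : ℝ × E → E} {p : E}
    (hα : DifferentiableAt ℝ α p) (hΨ : ContDiffAt ℝ 2 Ψ (0, p))
    (hid : ∀ᶠ q in 𝓝 p, Ψ (0, q) = q)
    (hinv : ∀ᶠ t : ℝ in 𝓝 0, (α (Ψ (t, p))).compContinuousLinearMap
      ((fderiv ℝ Ψ (t, p)).comp (ContinuousLinearMap.inr ℝ ℝ E)) = α p) :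
    extDeriv (fun q => (α q).curryLeft (fderiv ℝ Ψ (0, q) (1, 0))) p =
      -(extDeriv α p).curryLeft (fderiv ℝ Ψ (0, p) (1, 0)) := by
  set V : E → E := fun q => fderiv ℝ Ψ (0, q) (1, 0) with hV
  have hp : Ψ (0, p) = p := hid.self_of_nhds
  have hDΨ : HasFDerivAt (fderiv ℝ Ψ) (fderiv ℝ (fderiv ℝ Ψ) (0, p)) (0, p) :=
    ((hΨ.fderiv_right (m := 1) (by norm_num)).differentiableAt (by simp)).hasFDerivAt
  -- Symmetry of second derivatives lets `∂_t` and `∂_q` be exchanged: the time derivative of `D(Ψ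
  -- t)` at `t = 0` is `DV`.
  have hsymm : ∀ v w, fderiv ℝ (fderiv ℝ Ψ) (0, p) v w = fderiv ℝ (fderiv ℝ Ψ) (0, p) w v :=
    (hΨ.isSymmSndFDerivAt (by simp)).eq
  have hΨ1 : HasFDerivAt Ψ (fderiv ℝ Ψ (0, p)) (0, p) :=
    (hΨ.differentiableAt (by simp)).hasFDerivAt
  have hinr : HasFDerivAt (fun q : E => ((0 : ℝ), q)) (ContinuousLinearMap.inr ℝ ℝ E) p :=
    hasFDerivAt_prodMk_right 0 p
  have hVd : HasFDerivAt V ((ContinuousLinearMap.apply ℝ E ((1 : ℝ), (0 : E))).comp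
      ((fderiv ℝ (fderiv ℝ Ψ) (0, p)).comp (ContinuousLinearMap.inr ℝ ℝ E))) p :=
    (ContinuousLinearMap.apply ℝ E ((1 : ℝ), (0 : E))).hasFDerivAt.comp p
      (HasFDerivAt.comp p hDΨ hinr)
  have hDid : ∀ u, fderiv ℝ Ψ (0, p) (0, u) = u := by
    intro u
    have h1 := (HasFDerivAt.comp p hΨ1 hinr).unique ((hasFDerivAt_id p).congr_of_eventuallyEq hid)
    exact DFunLike.congr_fun h1 u
  have hVα : DifferentiableAt ℝ (fun q => (α q).curryLeft (V q)) p := by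
    have h1 : DifferentiableAt ℝ (fun q => (α q).curryLeft) p :=
      DifferentiableAt.comp (g := fun z : E [⋀^Fin (k + 1)]→L[ℝ] ℝ => z.curryLeft) p
        (ContinuousAlternatingMap.curryLeftLI (𝕜 := ℝ) (E := E) (F := ℝ)
          (n := k)).toContinuousLinearMap.differentiableAt hα
    exact h1.clm_apply hVd.differentiableAt
  refine ContinuousAlternatingMap.ext fun u => ?_
  -- the derivative at `t = 0` of the pulled back form
  have hgi : ∀ i, HasDerivAt (fun t : ℝ => fderiv ℝ Ψ (t, p) (0, u i)) (fderiv ℝ V p (u i)) 0 := by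
    intro i
    have hinl : HasFDerivAt (fun t : ℝ => (t, p)) (ContinuousLinearMap.inl ℝ ℝ E) 0 :=
      hasFDerivAt_prodMk_left 0 p
    have h1 := ((ContinuousLinearMap.apply ℝ E ((0 : ℝ), u i)).hasFDerivAt.comp (0 : ℝ)
      (HasFDerivAt.comp (0 : ℝ) hDΨ hinl)).hasDerivAt
    have h2 : fderiv ℝ V p (u i) = fderiv ℝ (fderiv ℝ Ψ) (0, p) (1, 0) (0, u i) := by
      rw [hVd.fderiv, hsymm]; rfl
    rw [h2]
    exact h1
  have hΨt : HasDerivAt (fun t : ℝ => Ψ (t, p)) (V p) 0 := by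
    have hinl : HasFDerivAt (fun t : ℝ => (t, p)) (ContinuousLinearMap.inl ℝ ℝ E) 0 :=
      hasFDerivAt_prodMk_left 0 p
    exact (HasFDerivAt.comp (0 : ℝ) hΨ1 hinl).hasDerivAt
  have hαt : HasDerivAt (fun t : ℝ => α (Ψ (t, p))) (fderiv ℝ α p (V p)) 0 := by
    have : HasFDerivAt α (fderiv ℝ α p) (Ψ (0, p)) := by rw [hp]; exact hα.hasFDerivAt
    exact this.comp_hasDerivAt (0 : ℝ) hΨt
  -- This is `L_V α = 0` written out: the invariance identity differentiated at `t = 0` by the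
  -- product rule, using `D(Ψ 0) = id`.
  have hsum : fderiv ℝ α p (V p) u +
      ∑ i, α p (Function.update u i (fderiv ℝ V p (u i))) = 0 := by
    have h1 := (hαt.hasFDerivAt.continuousAlternatingMap_apply
      (g := fun i t => fderiv ℝ Ψ (t, p) (0, u i)) fun i => (hgi i).hasFDerivAt).hasDerivAt
    have h2 : HasDerivAt (fun t : ℝ => α (Ψ (t, p)) fun i => fderiv ℝ Ψ (t, p) (0, u i)) 0 0 :=
      (hasDerivAt_const (0 : ℝ) (α p u)).congr_of_eventuallyEq (by
        filter_upwards [hinv] with t ht using DFunLike.congr_fun ht u)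
    have h3 := h1.unique h2
    simp only [hDid, hp] at h3
    simpa [ContinuousMultilinearMap.toContinuousLinearMap] using! h3
  -- Both exterior derivatives are expanded as alternating sums. In `dα(V, u)` the term of index `0`
  -- is `Dα(V) u`. The remaining terms have sign `(-1)^(i+1)` and cancel those of `d(V ⌟ α)` in
  -- which `α` is differentiated. What is left is `hsum`.
  rw [extDeriv_apply hVα]
  rw [ContinuousAlternatingMap.neg_apply]
  rw [ContinuousAlternatingMap.curryLeft_apply_apply, extDeriv_apply hα,
    Fin.sum_univ_succ (n := k + 1)]
  change _ = -((-1) ^ ((0 : Fin (k + 2)) : ℕ) • _ + ∑ i : Fin (k + 1), (-1) ^ (i.succ : ℕ) •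
    fderiv ℝ (fun q => α q (i.succ.removeNth (Fin.cons (V p) u : Fin (k + 2) → E))) p (u i))
  have hfd : ∀ (w : Fin (k + 1) → E) v, fderiv ℝ (fun q => α q w) p v = fderiv ℝ α p v w := by
    intro w v
    have := (hα.hasFDerivAt.continuousAlternatingMap_apply
      (g := fun i _ => w i) fun i => hasFDerivAt_const (w i) p).fderiv
    rw [show (fun q => α q w) = fun q => α q fun i => w i from rfl, this]
    simp
  have hterm : ∀ i : Fin (k + 1), fderiv ℝ (fun q => (α q).curryLeft (V q) (i.removeNth u)) p (u i) =
      fderiv ℝ α p (u i) (Fin.cons (V p) (i.removeNth u)) +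
        α p (Fin.cons (fderiv ℝ V p (u i)) (i.removeNth u)) := by
    intro i
    have h1 := hα.hasFDerivAt.continuousAlternatingMap_apply
      (g := fun j q => (Fin.cons (V q) (i.removeNth u) : Fin (k + 1) → E) j)
      (g' := fun j => (Fin.cons (fderiv ℝ V p) (fun _ => 0) : Fin (k + 1) → E →L[ℝ] E) j) (fun j => by
        refine Fin.cases ?_ (fun j => ?_) j
        · exact hVd.differentiableAt.hasFDerivAt
        · exact hasFDerivAt_const _ _)
    have h2 : (fun q => (α q).curryLeft (V q) (i.removeNth u)) = fun q => α q fun j =>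
      (Fin.cons (V q) (i.removeNth u) : Fin (k + 1) → E) j := rfl
    rw [h2, h1.fderiv]
    simp [Fin.sum_univ_succ]
  -- Moving the `i`-th argument to the front costs the sign `(-1)^i`, which brings `hsum` to the
  -- shape of the alternating sums.
  have hins : ∀ (i : Fin (k + 1)) (w : E), α p (Function.update u i w) =
      (-1) ^ i.val • α p (Fin.cons w (i.removeNth u)) := by
    intro i w
    rw [← Fin.insertNth_removeNth, ContinuousAlternatingMap.map_insertNth]
    rfl
  have hrem : ∀ i : Fin (k + 1), (i.succ.removeNth (Fin.cons (V p) u : Fin (k + 2) → E)) =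
      Fin.cons (V p) (i.removeNth u) := fun i => Fin.cons_comp_succ_succAbove ..
  simp only [hins] at hsum
  simp only [hfd, hterm, smul_add, Finset.sum_add_distrib]
  simp only [Matrix.vecCons, Fin.cons_zero, hrem, Fin.val_zero, pow_zero, one_smul,
    Fin.val_succ, pow_succ, mul_neg, mul_one, neg_smul, Finset.sum_neg_distrib, Fin.removeNth_zero,
    Fin.tail_cons]
  linarith

end Forms
end FieldTheory
end

/-! ### Natural coordinates and smoothness of the Legendre transform -/

noncomputable section
namespace FieldTheory
universe u v
variable {n N : ℕ} {X : Type u} [TopologicalSpace X] [ChartedSpace (BaseModel n) X]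
  {Y : Type v} [TopologicalSpace Y] [ChartedSpace (TotalModel n N) Y]
  [IsManifold 𝓘(ℝ, BaseModel n) ∞ X] {π : Y → X} [IsSmoothFiberBundle n N π]

/-- The model space of the first jet bundle. -/
abbrev JetModel (n N : ℕ) := TotalModel n N × (BaseModel n →L[ℝ] FiberModel N)

namespace AdaptedChart
variable (a : AdaptedChart n N π)

/-- The natural coordinates on `J¹Y`, as a chart of its atlas. -/
def jetHomeo : OpenPartialHomeomorph (JetBundle n N π) (JetModel n N) :=
  (JetBundle.core n N π).openPartialHomeomorph a.jetChart ⟨a, rfl⟩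

/-- The natural coordinates on `Z`, as a chart of its atlas. -/
def phaseHomeo : OpenPartialHomeomorph (PhaseSpace n N π) (TotalModel n N × PhaseModel n N) :=
  (PhaseSpace.core n N π).openPartialHomeomorph a.phaseChart ⟨a, rfl⟩

theorem jetHomeo_mem_atlas : a.jetHomeo ∈ atlas (JetModel n N) (JetBundle n N π) :=
  Set.mem_iUnion₂.2 ⟨a.jetChart, ⟨a, rfl⟩, rfl⟩

theorem phaseHomeo_mem_atlas :
    a.phaseHomeo ∈ atlas (TotalModel n N × PhaseModel n N) (PhaseSpace n N π) :=
  Set.mem_iUnion₂.2 ⟨a.phaseChart, ⟨a, rfl⟩, rfl⟩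

theorem contMDiffOn_jetHomeo :
    ContMDiffOn 𝓘(ℝ, JetModel n N) 𝓘(ℝ, JetModel n N) ∞ a.jetHomeo a.jetHomeo.source :=
  contMDiffOn_of_mem_maximalAtlas
    (StructureGroupoid.subset_maximalAtlas _ a.jetHomeo_mem_atlas)

theorem contMDiffOn_jetHomeo_symm :
    ContMDiffOn 𝓘(ℝ, JetModel n N) 𝓘(ℝ, JetModel n N) ∞ a.jetHomeo.symm a.jetHomeo.target :=
  contMDiffOn_symm_of_mem_maximalAtlas
    (StructureGroupoid.subset_maximalAtlas _ a.jetHomeo_mem_atlas)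

theorem contMDiffOn_phaseHomeo :
    ContMDiffOn 𝓘(ℝ, TotalModel n N × PhaseModel n N) 𝓘(ℝ, TotalModel n N × PhaseModel n N) ∞
      a.phaseHomeo a.phaseHomeo.source :=
  contMDiffOn_of_mem_maximalAtlas
    (StructureGroupoid.subset_maximalAtlas _ a.phaseHomeo_mem_atlas)

theorem contMDiffOn_phaseHomeo_symm :
    ContMDiffOn 𝓘(ℝ, TotalModel n N × PhaseModel n N) 𝓘(ℝ, TotalModel n N × PhaseModel n N) ∞
      a.phaseHomeo.symm a.phaseHomeo.target :=
  contMDiffOn_symm_of_mem_maximalAtlas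
    (StructureGroupoid.subset_maximalAtlas _ a.phaseHomeo_mem_atlas)

theorem mem_jetHomeo_target {q : JetModel n N} : q ∈ a.jetHomeo.target ↔ q.1 ∈ a.tot.target :=
  ⟨fun h => h.1, fun h => ⟨h, trivial⟩⟩

theorem mem_phaseHomeo_target {q : TotalModel n N × PhaseModel n N} :
    q ∈ a.phaseHomeo.target ↔ q.1 ∈ a.tot.target :=
  ⟨fun h => h.1, fun h => ⟨h, trivial⟩⟩

/-- The fibre coordinate of a jet is the restriction of a linear map `σ ↦ P ∘ σ ∘ Q`, so it and its
inverse respect affine combinations. Derivatives along segments in `J¹_y Y` thereby become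
derivatives along segments of matrices. -/
theorem lineMap_jetMk {y : Y} (hy : y ∈ a.tot.source) (A B : BaseModel n →L[ℝ] FiberModel N)
    (ε : ℝ) : AffineMap.lineMap (a.jetMk y A) (a.jetMk y B) ε = a.jetMk y (A + ε • (B - A)) := by
  rw [← AdaptedChart.jetMk_jetCoord hy (AffineMap.lineMap (a.jetMk y A) (a.jetMk y B) ε)]
  congr 1
  let C := compLin ((ContinuousLinearMap.snd ℝ (BaseModel n) (FiberModel N)).comp (a.dTot y))
    (a.dBase (π y)).inverse
  have e : C (ε • ((a.jetMk y B).1 - (a.jetMk y A).1) + (a.jetMk y A).1) =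
      a.jetCoord (a.jetMk y A) + ε • (a.jetCoord (a.jetMk y B) - a.jetCoord (a.jetMk y A)) := by
    rw [map_add, map_smul, map_sub]
    exact add_comm _ _
  rw [jetCoord_jetMk hy, jetCoord_jetMk hy] at e
  exact e

end AdaptedChart

theorem JetBundle.exists_chartAt_eq (γ : JetBundle n N π) : ∃ a : AdaptedChart n N π,
    chartAt (JetModel n N) γ = a.jetHomeo ∧ γ.pt ∈ a.tot.source :=
  ⟨_, rfl, (exists_adaptedChart (n := n) (N := N) π γ.pt).choose_spec⟩

theorem JetBundle.contMDiff_pt : ContMDiff 𝓘(ℝ, JetModel n N) 𝓘(ℝ, TotalModel n N) ∞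
    (JetBundle.pt : JetBundle n N π → Y) := by
  intro γ
  obtain ⟨a, ha⟩ := exists_adaptedChart (n := n) (N := N) π γ.pt
  have hγ : a.jetHomeo.source ∈ 𝓝 γ := a.jetHomeo.open_source.mem_nhds ha
  have h1 : ContMDiffOn 𝓘(ℝ, JetModel n N) 𝓘(ℝ, TotalModel n N) ∞
      (fun γ => (a.jetHomeo γ).1) a.jetHomeo.source :=
    (contDiff_fst (𝕜 := ℝ) (E := TotalModel n N)
      (F := BaseModel n →L[ℝ] FiberModel N)).contMDiff.comp_contMDiffOn a.contMDiffOn_jetHomeo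
  have h2 := a.smooth_tot_symm.comp h1 fun γ hγ => a.tot.map_source hγ
  exact (h2.congr fun γ hγ => (a.tot.left_inv hγ).symm).contMDiffAt hγ

theorem PhaseSpace.contMDiff_pt : ContMDiff 𝓘(ℝ, TotalModel n N × PhaseModel n N)
    𝓘(ℝ, TotalModel n N) ∞ (PhaseSpace.pt : PhaseSpace n N π → Y) := by
  intro z
  obtain ⟨a, ha⟩ := exists_adaptedChart (n := n) (N := N) π z.pt
  have hz : a.phaseHomeo.source ∈ 𝓝 z := a.phaseHomeo.open_source.mem_nhds ha
  have h1 : ContMDiffOn 𝓘(ℝ, TotalModel n N × PhaseModel n N) 𝓘(ℝ, TotalModel n N) ∞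
      (fun z => (a.phaseHomeo z).1) a.phaseHomeo.source :=
    (contDiff_fst (𝕜 := ℝ) (E := TotalModel n N)
      (F := PhaseModel n N)).contMDiff.comp_contMDiffOn a.contMDiffOn_phaseHomeo
  have h2 := a.smooth_tot_symm.comp h1 fun z hz => a.tot.map_source hz
  exact (h2.congr fun z hz => (a.tot.left_inv hz).symm).contMDiffAt hz

/-- A form of the phase model is determined by its pullbacks along the graphs of linear maps. -/
theorem PhaseModel.contDiffOn_of_graph {V : Type*} [NormedAddCommGroup V] [NormedSpace ℝ V]
    {f : V → PhaseModel n N} {S : Set V}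
    (h : ∀ (B : BaseModel n →L[ℝ] FiberModel N) (w : Fin (n + 1) → BaseModel n),
      ContDiffOn ℝ ∞ (fun q => (f q).1 fun i => (w i, B (w i))) S) : ContDiffOn ℝ ∞ f S := by
  refine contDiffOn_of_separating
    (fun p : (BaseModel n →L[ℝ] FiberModel N) × (Fin (n + 1) → BaseModel n) =>
      (⟨⟨fun z => z.1 fun i => (p.2 i, p.1 (p.2 i)), fun _ _ => rfl⟩, fun _ _ => rfl⟩ :
        PhaseModel n N →ₗ[ℝ] ℝ)) (fun z hz => Subtype.ext ?_) fun p => h p.1 p.2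
  -- The right inverses of the first projection are exactly the graph maps `v ↦ (v, B v)`, so the
  -- separation lemma for jets applies to the model.
  refine phase_eq_zero (ContinuousLinearMap.fst ℝ (BaseModel n) (FiberModel N))
    (γ₀ := ContinuousLinearMap.inl ℝ _ _) (fun v => rfl) z.2 fun γ hγ => ?_
  refine ContinuousAlternatingMap.ext fun w => ?_
  have := hz ((ContinuousLinearMap.snd ℝ (BaseModel n) (FiberModel N)).comp γ, w)
  refine (congrArg z.1 (funext fun i => ?_)).trans this
  exact Prod.ext (hγ (w i)) rfl

namespace Lagrangian
variable (L : Lagrangian n N π) (a : AdaptedChart n N π)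

/-- The representative of the Lagrangian density in natural coordinates. -/
def density (q : JetModel n N) : BaseModel n [⋀^Fin (n + 1)]→L[ℝ] ℝ :=
  (L.toFun (a.jetHomeo.symm q)).compContinuousLinearMap (a.dBase (π (a.tot.symm q.1))).inverse

/-- Smoothness of a Lagrangian density is stated in the preferred charts of `X`. Passing to the base
coordinates of `a` inserts the derivative of the transition map, which is smooth in the base
coordinate. -/
theorem contDiffOn_density : ContDiffOn ℝ ∞ (L.density a) a.jetHomeo.target := by
  intro q₀ hq₀
  let x₀ := π (a.tot.symm q₀.1)
  let φ := chartAt (BaseModel n) x₀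
  -- The overlap with the preferred chart at the base point of `q₀`. It is visible in coordinates
  -- because the first component of the bundle coordinates is the base coordinate.
  let S : Set (JetModel n N) := a.jetHomeo.target ∩ {q | q.1.1 ∈ (a.base.symm.trans φ).source}
  have hbase : ∀ q ∈ a.jetHomeo.target, π (a.tot.symm q.1) ∈ a.base.source ∧
      q.1.1 = a.base (π (a.tot.symm q.1)) := by
    intro q hq
    have h1 := a.tot.map_target ((a.mem_jetHomeo_target).1 hq)
    refine ⟨a.proj_mem _ h1, ?_⟩
    rw [← a.fst_tot _ h1, a.tot.right_inv ((a.mem_jetHomeo_target).1 hq)]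
  have hS : ∀ q ∈ S, π (a.tot.symm q.1) ∈ φ.source := by
    rintro q ⟨hq, -, hq2⟩
    change a.base.symm q.1.1 ∈ φ.source at hq2
    rwa [(hbase q hq).2, a.base.left_inv (hbase q hq).1] at hq2
  have hSo : IsOpen S :=
    a.jetHomeo.open_target.inter
      ((a.base.symm.trans φ).open_source.preimage (by fun_prop))
  have hq₀S : q₀ ∈ S := by
    refine ⟨hq₀, ?_, ?_⟩
    · change q₀.1.1 ∈ a.base.target
      rw [(hbase q₀ hq₀).2]; exact a.base.map_source (hbase q₀ hq₀).1
    · change a.base.symm q₀.1.1 ∈ φ.source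
      rw [(hbase q₀ hq₀).2, a.base.left_inv (hbase q₀ hq₀).1]
      exact mem_chart_source _ _
  have hg : ContDiffOn ℝ ∞ (fun q : JetModel n N =>
      ((L.toFun (a.jetHomeo.symm q)).compContinuousLinearMap
        (mfderiv 𝓘(ℝ, BaseModel n) 𝓘(ℝ, BaseModel n) φ (π (a.tot.symm q.1))).inverse :
          BaseModel n [⋀^Fin (n + 1)]→L[ℝ] ℝ)) S := by
    rw [← contMDiffOn_iff_contDiffOn]
    exact (L.smooth x₀).comp (a.contMDiffOn_jetHomeo_symm.mono Set.inter_subset_left) hS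
  have hφ : ContMDiffOn 𝓘(ℝ, BaseModel n) 𝓘(ℝ, BaseModel n) ∞ φ φ.source := contMDiffOn_chart
  have htr := (AdaptedChart.trans_contDiffOn a.smooth_base_symm hφ).fderiv_of_isOpen (m := ∞)
    (a.base.symm.trans φ).open_source (by simp)
  have htr' : ContDiffOn ℝ ∞ (fun q : JetModel n N => fderiv ℝ (φ ∘ a.base.symm) q.1.1) S :=
    htr.comp (f := fun q : JetModel n N => q.1.1) (by fun_prop) fun q hq => hq.2
  have hd : ContDiffOn ℝ ∞ (L.density a) S := by
    refine contDiffOn_form_iff fun w => ?_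
    refine (contDiffOn_form_apply hg (contDiffOn_pi.2 fun i =>
      htr'.clm_apply (contDiffOn_const (c := w i)))).congr fun q hq => ?_
    have hx := hbase q hq.1
    refine congrArg (L.toFun (a.jetHomeo.symm q)) (funext fun i => ?_)
    -- A vector given in the coordinates of `a` is carried to the chart `φ` by the transition
    -- derivative and then back to the tangent space by the inverse of `Tφ`.
    have e1 := AdaptedChart.trans_fderiv a.smooth_base a.smooth_base_symm hφ hx.1 (hS q hq)
      ((a.dBase (π (a.tot.symm q.1))).inverse (w i))
    have e2 := DFunLike.congr_fun (AdaptedChart.dBase_inverse hx.1) (w i)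
    simp only [ContinuousLinearMap.comp_apply, ContinuousLinearMap.id_apply] at e2
    have e3 : (mfderiv 𝓘(ℝ, BaseModel n) 𝓘(ℝ, BaseModel n) φ (π (a.tot.symm q.1))).IsInvertible :=
      ⟨(mdifferentiable_chart (I := 𝓘(ℝ, BaseModel n)) x₀).mfderiv (hS q hq), rfl⟩
    have e4 := DFunLike.congr_fun e3.inverse_comp_self
      ((a.dBase (π (a.tot.symm q.1))).inverse (w i))
    simp only [ContinuousLinearMap.comp_apply, ContinuousLinearMap.id_apply] at e4
    refine e4.symm.trans (congrArg (mfderiv 𝓘(ℝ, BaseModel n) 𝓘(ℝ, BaseModel n) φ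
      (π (a.tot.symm q.1))).inverse (e1.symm.trans ?_))
    exact congr (congrArg (fun x => ⇑(fderiv ℝ (φ ∘ a.base.symm) x)) hx.2.symm) e2
  exact (hd.contDiffAt (hSo.mem_nhds hq₀S)).contDiffWithinAt

/-- The fibre coordinates of the Legendre transform, in natural coordinates. -/
def coordForm (q : JetModel n N) : PhaseModel n N :=
  a.phaseCoord (L.legendre (a.jetHomeo.symm q)).form

/-- The defining relation of `𝔽𝓛` in coordinates. Pairing with the jet of coordinates `B` is
pullback along its graph, and the segment from `A = q.2` to `B` moves only the fibre coordinates, in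
the direction `B - A`. -/
theorem coordForm_graph {q : JetModel n N} (hq : q ∈ a.jetHomeo.target)
    (B : BaseModel n →L[ℝ] FiberModel N) (w : Fin (n + 1) → BaseModel n) :
    (L.coordForm a q).1 (fun i => (w i, B (w i))) =
      L.density a q w + fderiv ℝ (L.density a) q (0, B - q.2) w := by
  obtain ⟨p, A⟩ := q
  have hp : p ∈ a.tot.target := (a.mem_jetHomeo_target).1 hq
  have hy := a.tot.map_target hp
  set y := a.tot.symm p with hydef
  have hx := a.proj_mem y hy
  let γ := a.jetMk y A
  let γ' := a.jetMk y B
  let D : BaseModel n →L[ℝ] BaseModel n := (a.dBase (π y)).inverse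
  have hline : ∀ ε : ℝ, AffineMap.lineMap γ γ' ε = a.jetMk y (A + ε • (B - A)) :=
    a.lineMap_jetMk hy A B
  have hD : ∀ v, D (a.dBase (π y) v) = v := fun v =>
    DFunLike.congr_fun (AdaptedChart.inverse_dBase hx) v
  have hD' : ∀ v, a.dBase (π y) (D v) = v := fun v =>
    DFunLike.congr_fun (AdaptedChart.dBase_inverse hx) v
  have hderiv : L.fiberDeriv y γ γ' = (fderiv ℝ (L.density a) (p, A)
      (0, B - A)).compContinuousLinearMap (a.dBase (π y) : BaseModel n →L[ℝ] BaseModel n) := by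
    have h1 := (((L.contDiffOn_density a).contDiffAt
      (a.jetHomeo.open_target.mem_nhds hq)).differentiableAt (by simp)).hasFDerivAt
    have h3 : HasDerivAt (fun ε : ℝ => L.density a ((p, A) + ε • (0, B - A)))
      (fderiv ℝ (L.density a) (p, A) (0, B - A)) 0 := h1.hasLineDerivAt (0, B - A)
    -- Along the segment the base point is constant, so the passage from `density` back to `𝓛` is
    -- one fixed continuous linear map and commutes with the derivative.
    let K : (BaseModel n [⋀^Fin (n + 1)]→L[ℝ] ℝ) →L[ℝ] (BaseModel n [⋀^Fin (n + 1)]→L[ℝ] ℝ) :=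
      ContinuousAlternatingMap.compContinuousLinearMapCLM (𝕜 := ℝ) (F := ℝ)
        (ι := Fin (n + 1)) (a.dBase (π y) : BaseModel n →L[ℝ] BaseModel n)
    have h4 := HasFDerivAt.comp_hasDerivAt (0 : ℝ) K.hasFDerivAt h3
    refine HasDerivAt.deriv (h4.congr_of_eventuallyEq (Filter.Eventually.of_forall fun ε => ?_))
    refine ContinuousAlternatingMap.ext fun u => ?_
    have e1 : (p, A) + ε • ((0, B - A) : JetModel n N) = (p, A + ε • (B - A)) :=
      Prod.ext (by simp) rfl
    refine (congrArg (fun δ => L.toFun ⟨y, δ⟩ u) (hline ε)).trans (Eq.trans ?_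
      (congrArg (fun q => L.density a q fun i => a.dBase (π y) (u i)) e1).symm)
    exact congrArg (L.toFun ⟨y, a.jetMk y (A + ε • (B - A))⟩) (funext fun i => (hD (u i)).symm)
  have hγ' : ∀ v, (a.dTot y).inverse (v, B v) = γ'.1 (D v) := by
    intro v
    have e1 := DFunLike.congr_fun (AdaptedChart.inverse_dTot hy) (γ'.1 (D v))
    simp only [ContinuousLinearMap.comp_apply, ContinuousLinearMap.id_apply] at e1
    refine (congrArg (a.dTot y).inverse ?_).trans e1
    refine ((AdaptedChart.dTot_jet hy γ' (D v)).trans ?_).symm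
    rw [AdaptedChart.jetCoord_jetMk hy]
    exact congrArg (fun v => (v, B v)) (hD' v)
  have h1 : (L.coordForm a (p, A)).1 (fun i => (w i, B (w i))) =
      (dualToPhase (L.legendreDual y γ)).1 (fun i => γ'.1 (D (w i))) := by
    change (a.phaseCoord (dualToPhase (L.legendreDual y γ))).1 _ = _
    rw [AdaptedChart.phaseCoord, dif_pos hy]
    exact congrArg (dualToPhase (L.legendreDual y γ)).1 (funext fun i => hγ' (w i))
  have h2 := DFunLike.congr_fun (dualToPhase_spec (L.legendreDual y γ) γ') (fun i => D (w i))
  rw [h1]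
  refine h2.trans ?_
  rw [legendreDual_apply, hderiv]
  change L.toFun ⟨y, γ⟩ (fun i => D (w i)) + fderiv ℝ (L.density a) (p, A) (0, B - A)
    (fun i => a.dBase (π y) (D (w i))) = _
  simp only [hD']
  rfl

/-- The inverse of `Φ` is obtained by choice and offers no formula to differentiate. Graphs separate
the forms of the phase model, and on each graph the value is explicit and smooth. -/
theorem contDiffOn_coordForm : ContDiffOn ℝ ∞ (L.coordForm a) a.jetHomeo.target := by
  refine PhaseModel.contDiffOn_of_graph fun B w => ?_
  have h1 := L.contDiffOn_density a
  have h2 := h1.fderiv_of_isOpen (m := ∞) a.jetHomeo.open_target (by simp)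
  have h3 : ContDiffOn ℝ ∞ (fun q : JetModel n N => ((0, B - q.2) : JetModel n N))
    a.jetHomeo.target := by fun_prop
  exact ((contDiffOn_form_apply h1 (contDiffOn_const (c := w))).add
    (contDiffOn_form_apply (h2.clm_apply h3) (contDiffOn_const (c := w)))).congr
      fun q hq => L.coordForm_graph a hq B w

/-- `fiberDeriv` is a `deriv`, which defaults to zero. Genuine differentiability is what allows it
to be composed with the linear maps coming from the group action. -/
theorem hasDerivAt_fiberDeriv (y : Y) (γ γ' : jetFiber n N π y) :
    HasDerivAt (F := BaseModel n [⋀^Fin (n + 1)]→L[ℝ] ℝ)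
      (fun ε : ℝ => L.toFun ⟨y, AffineMap.lineMap γ γ' ε⟩) (L.fiberDeriv y γ γ') 0 := by
  let a := (exists_adaptedChart (n := n) (N := N) π y).choose
  have hy : y ∈ a.tot.source := (exists_adaptedChart (n := n) (N := N) π y).choose_spec
  have h1 : HasDerivAt (F := BaseModel n [⋀^Fin (n + 1)]→L[ℝ] ℝ) (fun ε : ℝ => L.toFun
      ⟨y, a.jetMk y (a.jetCoord γ + ε • (a.jetCoord γ' - a.jetCoord γ))⟩) _ 0 :=
    (L.differentiable_fiber y (a.jetCoord γ)).hasFDerivAt.hasLineDerivAt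
      (a.jetCoord γ' - a.jetCoord γ)
  have h2 : ∀ ε : ℝ, AffineMap.lineMap γ γ' ε =
      a.jetMk y (a.jetCoord γ + ε • (a.jetCoord γ' - a.jetCoord γ)) := by
    intro ε
    have := a.lineMap_jetMk hy (a.jetCoord γ) (a.jetCoord γ') ε
    rwa [AdaptedChart.jetMk_jetCoord hy, AdaptedChart.jetMk_jetCoord hy] at this
  let F : jetFiber n N π y → BaseModel n [⋀^Fin (n + 1)]→L[ℝ] ℝ := fun δ => L.toFun ⟨y, δ⟩
  have h3 : HasDerivAt (fun ε : ℝ => F (AffineMap.lineMap γ γ' ε)) _ 0 :=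
    h1.congr_of_eventuallyEq (Filter.Eventually.of_forall fun ε => congrArg F (h2 ε))
  exact h3.differentiableAt.hasDerivAt

/-- In natural coordinates the map is `q ↦ (q.1, coordForm q)`, since it covers the identity of `Y`.
-/
theorem contMDiff_legendre : ContMDiff 𝓘(ℝ, JetModel n N)
    𝓘(ℝ, TotalModel n N × PhaseModel n N) ∞ L.legendre := by
  intro γ
  obtain ⟨a, ha⟩ := exists_adaptedChart (n := n) (N := N) π γ.pt
  have hγ : a.jetHomeo.source ∈ 𝓝 γ := a.jetHomeo.open_source.mem_nhds ha
  have h1 : ContDiffOn ℝ ∞ (fun q : JetModel n N => (q.1, L.coordForm a q)) a.jetHomeo.target :=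
    contDiff_fst.contDiffOn.prodMk (L.contDiffOn_coordForm a)
  have h2 := (contMDiffOn_iff_contDiffOn.2 h1).comp a.contMDiffOn_jetHomeo
    fun γ hγ => a.jetHomeo.map_source hγ
  have h3 := a.contMDiffOn_phaseHomeo_symm.comp h2 fun γ hγ =>
    a.mem_phaseHomeo_target.2 (a.tot.map_source hγ)
  refine (h3.congr fun γ hγ => ?_).contMDiffAt hγ
  have e1 : a.jetHomeo.symm (a.jetHomeo γ) = γ := a.jetHomeo.left_inv hγ
  have e2 : a.phaseHomeo.symm (a.phaseHomeo (L.legendre γ)) = L.legendre γ :=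
    a.phaseHomeo.left_inv hγ
  exact e2.symm.trans (congrArg (fun γ' => a.phaseHomeo.symm ((a.jetHomeo γ).1,
    a.phaseCoord (L.legendre γ').form)) e1).symm

end Lagrangian
end FieldTheory
end

/-! ### The lifted action and equivariance of the Legendre transform -/

noncomputable section
namespace FieldTheory
universe u v
variable {n N : ℕ} {X : Type u} [TopologicalSpace X] [ChartedSpace (BaseModel n) X]
  {Y : Type v} [TopologicalSpace Y] [ChartedSpace (TotalModel n N) Y]

section Actions
variable {H M : Type*} [NormedAddCommGroup H] [NormedSpace ℝ H] [TopologicalSpace M]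
  [ChartedSpace H M] {G : Type*} [Group G] [MulAction G M]

/-- The tangent map of the translation by `g` at `m`, as an endomorphism of the model space. -/
def dSmul (H : Type*) [NormedAddCommGroup H] [NormedSpace ℝ H] {M : Type*} [TopologicalSpace M]
    [ChartedSpace H M] {G : Type*} [Group G] [MulAction G M] (g : G) (m : M) : H →L[ℝ] H :=
  mfderiv 𝓘(ℝ, H) 𝓘(ℝ, H) (fun m' : M => g • m') m

theorem dSmul_one (m : M) : dSmul H (1 : G) m = ContinuousLinearMap.id ℝ H := by
  have h : (fun m' : M => (1 : G) • m') = id := funext fun m' => one_smul G m'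
  have h1 := congrArg (β := H →L[ℝ] H) (fun f : M → M => mfderiv 𝓘(ℝ, H) 𝓘(ℝ, H) f m) h
  exact h1.trans mfderiv_id

theorem dSmul_mul (hG : ∀ g : G, ContMDiff 𝓘(ℝ, H) 𝓘(ℝ, H) ∞ fun m : M => g • m) (g h : G)
    (m : M) : dSmul H (g * h) m = (dSmul H g (h • m)).comp (dSmul H h m) := by
  have e : (fun m' : M => (g * h) • m') = (fun m' => g • m') ∘ fun m' => h • m' :=
    funext fun m' => mul_smul g h m'
  have h1 := congrArg (β := H →L[ℝ] H) (fun f : M → M => mfderiv 𝓘(ℝ, H) 𝓘(ℝ, H) f m) e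
  exact h1.trans (mfderiv_comp m ((hG g _).mdifferentiableAt (by simp))
    ((hG h _).mdifferentiableAt (by simp)))

theorem dSmul_inv_dSmul (hG : ∀ g : G, ContMDiff 𝓘(ℝ, H) 𝓘(ℝ, H) ∞ fun m : M => g • m) (g : G)
    (m : M) (v : H) : dSmul H g⁻¹ (g • m) (dSmul H g m v) = v := by
  have h := dSmul_mul (H := H) hG g⁻¹ g m
  rw [inv_mul_cancel, dSmul_one] at h
  exact (DFunLike.congr_fun h v).symm

end Actions

variable {π : Y → X}

/-- Jets at different points have different types, but every tangent space is a copy of the model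
space. Values can therefore be compared there before the base points are identified. -/
theorem JetBundle.ext_model {γ γ' : JetBundle n N π} (h : γ.pt = γ'.pt)
    (h' : ∀ v : BaseModel n, (γ.jet.1 v : TotalModel n N) = γ'.jet.1 v) : γ = γ' := by
  obtain ⟨y, γ⟩ := γ
  obtain ⟨y', γ'⟩ := γ'
  obtain rfl : y = y' := h
  congr 1
  exact Subtype.ext (ContinuousLinearMap.ext h')

variable {G : Type*} [Group G] [MulAction G X] [MulAction G Y] [hG : IsAutAction n N G π]
  [IsSmoothFiberBundle n N π]

theorem jetLift_jet_apply (g : G) (γ : JetBundle n N π) (v : BaseModel n) :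
    (jetLift n N π g γ).jet.1 v = dSmul (TotalModel n N) g γ.pt
      (γ.jet.1 (dSmul (BaseModel n) g⁻¹ (π (g • γ.pt)) v)) := rfl

theorem jetLift_one (γ : JetBundle n N π) : jetLift n N π (1 : G) γ = γ := by
  refine JetBundle.ext_model (one_smul G γ.pt) fun v => ?_
  refine (jetLift_jet_apply 1 γ v).trans ?_
  rw [dSmul_one, inv_one, dSmul_one]
  rfl

theorem jetLift_mul (g h : G) (γ : JetBundle n N π) :
    jetLift n N π (g * h) γ = jetLift n N π g (jetLift n N π h γ) := by
  refine JetBundle.ext_model (mul_smul g h γ.pt) fun v => ?_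
  refine (jetLift_jet_apply (g * h) γ v).trans ?_
  refine Eq.trans ?_ (jetLift_jet_apply g (jetLift n N π h γ) v).symm
  have e := jetLift_jet_apply h γ (dSmul (BaseModel n) g⁻¹ (π (g • (h • γ.pt))) v)
  refine Eq.trans ?_ (congrArg (dSmul (TotalModel n N) g (h • γ.pt)) e).symm
  -- The chain rule is applied on `Y` to `g * h` and on `X` to `h⁻¹ * g⁻¹`. The intermediate base
  -- point `g⁻¹ • π (g • (h • γ.pt))` then simplifies to `π (h • γ.pt)`.
  rw [dSmul_mul hG.contMDiff_tot, mul_inv_rev, dSmul_mul hG.contMDiff_base, mul_smul,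
    hG.proj_smul g, inv_smul_smul]
  rfl

/-- Lifting by `g⁻¹` provides the preimage. Its base point is only propositionally equal to `y`, so
the whole jet is generalized before the point is substituted. -/
theorem exists_jetLift_eq (g : G) {y : Y} (γ' : jetFiber n N π (g • y)) :
    ∃ δ : jetFiber n N π y, jetLift n N π g ⟨y, δ⟩ = ⟨g • y, γ'⟩ := by
  have h1 : jetLift n N π g (jetLift n N π g⁻¹ ⟨g • y, γ'⟩) = ⟨g • y, γ'⟩ := by
    rw [← jetLift_mul, mul_inv_cancel, jetLift_one]
  have h2 : (jetLift n N π g⁻¹ ⟨g • y, γ'⟩).pt = y := inv_smul_smul g y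
  generalize jetLift n N π g⁻¹ ⟨g • y, γ'⟩ = Γ at h1 h2
  obtain ⟨y', δ⟩ := Γ
  obtain rfl : y' = y := h2
  exact ⟨δ, h1⟩

variable [IsManifold 𝓘(ℝ, BaseModel n) ∞ X]

namespace Lagrangian
variable (L : Lagrangian n N π)

/-- Both sides are tested on jets `γ'` over `g • y`, and each of these is the lift of some `δ` over
`y`. The pairing with `γ'` on either side is the pairing of `𝔽𝓛(γ)` with `δ`, pulled back by `T
η_X⁻¹`. -/
theorem phaseLift_legendre (hL : L.IsEquivariant G) (g : G) (γ : JetBundle n N π) :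
    phaseLift n N π g (L.legendre γ) = L.legendre (jetLift n N π g γ) := by
  obtain ⟨y, γ⟩ := γ
  let γg : jetFiber n N π (g • y) := (jetLift n N π g ⟨y, γ⟩).jet
  let R : BaseModel n →L[ℝ] BaseModel n := dSmul (BaseModel n) g⁻¹ (π (g • y))
  refine congrArg (PhaseSpace.mk (π := π) (g • y)) (phase_unique (y := g • y)
    fun (γ' : jetFiber n N π (g • y)) => ?_)
  obtain ⟨δ, hδ⟩ := exists_jetLift_eq (y := y) g γ'
  have h' : (jetLift n N π g ⟨y, δ⟩).jet = γ' := by injection hδ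
  -- On a fibre the lift is `σ ↦ T η_Y ∘ σ ∘ T η_X⁻¹`, which is the restriction of a linear map;
  -- hence it maps segments to segments.
  have hline : ∀ ε : ℝ, jetLift n N π g ⟨y, AffineMap.lineMap γ δ ε⟩ =
      ⟨g • y, AffineMap.lineMap γg γ' ε⟩ := by
    intro ε
    refine JetBundle.ext_model rfl fun v => ?_
    have e1 : ∀ w : BaseModel n, (dSmul (TotalModel n N) g y (δ.1 (R w)) : TotalModel n N) =
        γ'.1 w := by
      intro w
      exact congrArg (fun Γ : jetFiber n N π (g • y) => (Γ.1 w : TotalModel n N)) h'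
    let K : TotalModel n N →L[ℝ] TotalModel n N := dSmul (TotalModel n N) g y
    have e2 : ∀ p q : TotalModel n N, K (ε • (p - q) + q) = ε • (K p - K q) + K q := by
      intro p q
      rw [map_add, map_smul, map_sub]
    let q : TotalModel n N := γg.1 v
    exact (e2 (δ.1 (R v)) (γ.1 (R v))).trans
      (congrArg (fun w : TotalModel n N => ε • (w - q) + q) (e1 v))
  have hLε : ∀ δ : jetFiber n N π y, (L.toFun (jetLift n N π g ⟨y, δ⟩) :
      BaseModel n [⋀^Fin (n + 1)]→L[ℝ] ℝ) =
      (L.toFun ⟨y, δ⟩ : BaseModel n [⋀^Fin (n + 1)]→L[ℝ] ℝ).compContinuousLinearMap R :=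
    fun δ => hL g ⟨y, δ⟩
  -- Equivariance of `𝓛` holds at every point of the segment with the same `R`, so it passes to the
  -- derivative at `ε = 0`.
  have hder : L.fiberDeriv (g • y) γg γ' =
      (L.fiberDeriv y γ δ : BaseModel n [⋀^Fin (n + 1)]→L[ℝ] ℝ).compContinuousLinearMap R := by
    let K : (BaseModel n [⋀^Fin (n + 1)]→L[ℝ] ℝ) →L[ℝ] (BaseModel n [⋀^Fin (n + 1)]→L[ℝ] ℝ) :=
      ContinuousAlternatingMap.compContinuousLinearMapCLM (𝕜 := ℝ) (F := ℝ)
        (ι := Fin (n + 1)) R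
    have h4 := HasFDerivAt.comp_hasDerivAt (0 : ℝ) K.hasFDerivAt (L.hasDerivAt_fiberDeriv y γ δ)
    have h5 := h4.congr_of_eventuallyEq
      (f₁ := fun ε : ℝ => L.toFun ⟨g • y, AffineMap.lineMap γg γ' ε⟩)
      (Filter.Eventually.of_forall fun ε => by
        have e1 := congrArg (β := BaseModel n [⋀^Fin (n + 1)]→L[ℝ] ℝ)
          (fun Γ : JetBundle n N π => L.toFun Γ) (hline ε)
        exact e1.symm.trans (hLε _))
    exact h5.deriv
  refine ContinuousAlternatingMap.ext fun u => ?_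
  have e1 := DFunLike.congr_fun (dualToPhase_spec (L.legendreDual (g • y) γg) γ') u
  have e2 := DFunLike.congr_fun (dualToPhase_spec (L.legendreDual y γ) δ) (fun i => R (u i))
  have e3 : L.toFun ⟨g • y, γg⟩ u = L.toFun ⟨y, γ⟩ (fun i => R (u i)) :=
    DFunLike.congr_fun (hLε γ) u
  have e4 : L.fiberDeriv (g • y) γg γ' u = L.fiberDeriv y γ δ (fun i => R (u i)) :=
    DFunLike.congr_fun hder u
  refine Eq.trans ?_ ((e2.trans (congrArg₂ (· + ·) e3 e4).symm).trans e1.symm)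
  refine congrArg (dualToPhase (L.legendreDual y γ)).1 (funext fun i => ?_)
  -- The pullback by `η_Y⁻¹` in the action on `Z` cancels the factor `T η_Y` in `γ' = T η_Y ∘ δ ∘
  -- R`.
  have e4 := dSmul_inv_dSmul (H := TotalModel n N) hG.contMDiff_tot g y (δ.1 (R (u i)))
  refine Eq.trans ?_ e4
  exact congrArg (fun Γ : jetFiber n N π (g • y) =>
    dSmul (TotalModel n N) g⁻¹ (g • y) (Γ.1 (u i))) h'.symm

end Lagrangian
end FieldTheory
end

/-! ### Smoothness of the lifted action on the jet bundle -/

noncomputable section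
namespace FieldTheory
universe u v
variable {n N : ℕ} {X : Type u} [TopologicalSpace X] [ChartedSpace (BaseModel n) X]
  {Y : Type v} [TopologicalSpace Y] [ChartedSpace (TotalModel n N) Y]
  {π : Y → X} {G : Type*} [Group G] [MulAction G Y]

/-- The composite of the graph of `A` with `D`. -/
def graphImage (D : TotalModel n N →L[ℝ] TotalModel n N) (A : BaseModel n →L[ℝ] FiberModel N) :
    BaseModel n →L[ℝ] TotalModel n N :=
  D.comp ((ContinuousLinearMap.id ℝ (BaseModel n)).prod A)

/-- The linear map whose graph is the image of the graph of `A` under `D`. -/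
def prolong (D : TotalModel n N →L[ℝ] TotalModel n N) (A : BaseModel n →L[ℝ] FiberModel N) :
    BaseModel n →L[ℝ] FiberModel N :=
  ((ContinuousLinearMap.snd ℝ (BaseModel n) (FiberModel N)).comp (graphImage D A)).comp
    ((ContinuousLinearMap.fst ℝ (BaseModel n) (FiberModel N)).comp (graphImage D A)).inverse

/-- If `R` reparametrizes the image of the graph of `A` as the graph of `B`, then `R` is a right
inverse of the base component, and in finite dimension a two-sided one. So the `inverse` in
`prolong` is a true inverse and not its default value. -/
theorem prolong_eq {D : TotalModel n N →L[ℝ] TotalModel n N}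
    {A B : BaseModel n →L[ℝ] FiberModel N} {R : BaseModel n →L[ℝ] BaseModel n}
    (h : ∀ v, graphImage D A (R v) = (v, B v)) :
    ((ContinuousLinearMap.fst ℝ (BaseModel n) (FiberModel N)).comp
      (graphImage D A)).IsInvertible ∧ prolong D A = B := by
  let P := (ContinuousLinearMap.fst ℝ (BaseModel n) (FiberModel N)).comp (graphImage D A)
  have h1 : P.comp R = ContinuousLinearMap.id ℝ _ :=
    ContinuousLinearMap.ext fun v => congrArg Prod.fst (h v)
  have h2 : R.comp P = ContinuousLinearMap.id ℝ _ := by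
    have e1 : P.toLinearMap.comp R.toLinearMap = LinearMap.id :=
      LinearMap.ext fun v => DFunLike.congr_fun h1 v
    have e2 := (LinearMap.comp_eq_id_comm ..).1 e1
    exact ContinuousLinearMap.ext fun v => DFunLike.congr_fun e2 v
  refine ⟨⟨ContinuousLinearEquiv.equivOfInverse P R (DFunLike.congr_fun h2)
    (DFunLike.congr_fun h1), rfl⟩, ?_⟩
  have h3 : P.inverse = R := ContinuousLinearMap.inverse_eq h1 h2
  refine ContinuousLinearMap.ext fun v => ?_
  change (graphImage D A (P.inverse v)).2 = _
  rw [h3, h]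

namespace AdaptedChart
variable (a b : AdaptedChart n N π)

variable {I : Set ℝ} {c : ℝ → G}

/-- The domain of the local representative of the family of translations `c t`. -/
def smulDomain (I : Set ℝ) (c : ℝ → G) : Set (ℝ × TotalModel n N) :=
  {q | (q.1 ∈ I ∧ q.2 ∈ a.tot.target) ∧ c q.1 • a.tot.symm q.2 ∈ b.tot.source}

theorem contMDiffOn_smul_symm
    (h : ContMDiffOn (𝓘(ℝ, ℝ).prod 𝓘(ℝ, TotalModel n N)) 𝓘(ℝ, TotalModel n N) ∞
      (fun q : ℝ × Y => c q.1 • q.2) (I ×ˢ Set.univ)) :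
    ContMDiffOn 𝓘(ℝ, ℝ × TotalModel n N) 𝓘(ℝ, TotalModel n N) ∞
      (fun q : ℝ × TotalModel n N => c q.1 • a.tot.symm q.2) (I ×ˢ a.tot.target) := by
  have h1 : ContMDiffOn 𝓘(ℝ, ℝ × TotalModel n N) 𝓘(ℝ, TotalModel n N) ∞
      (fun q : ℝ × TotalModel n N => a.tot.symm q.2) (I ×ˢ a.tot.target) :=
    a.smooth_tot_symm.comp (contDiff_snd (𝕜 := ℝ) (E := ℝ)
      (F := TotalModel n N)).contMDiff.contMDiffOn fun q hq => hq.2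
  have h2 := (contDiff_fst (𝕜 := ℝ) (n := ∞) (E := ℝ)
    (F := TotalModel n N)).contMDiff.contMDiffOn (s := I ×ˢ a.tot.target)
  exact h.comp (h2.prodMk h1) fun q hq => ⟨hq.1, trivial⟩

theorem isOpen_smulDomain (hI : IsOpen I)
    (h : ContMDiffOn (𝓘(ℝ, ℝ).prod 𝓘(ℝ, TotalModel n N)) 𝓘(ℝ, TotalModel n N) ∞
      (fun q : ℝ × Y => c q.1 • q.2) (I ×ˢ Set.univ)) : IsOpen (smulDomain a b I c) :=
  (contMDiffOn_smul_symm a h).continuousOn.isOpen_inter_preimage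
    (hI.prod a.tot.open_target) b.tot.open_source

theorem contDiffOn_smul
    (h : ContMDiffOn (𝓘(ℝ, ℝ).prod 𝓘(ℝ, TotalModel n N)) 𝓘(ℝ, TotalModel n N) ∞
      (fun q : ℝ × Y => c q.1 • q.2) (I ×ˢ Set.univ)) :
    ContDiffOn ℝ ∞ (fun q : ℝ × TotalModel n N => b.tot (c q.1 • a.tot.symm q.2))
      (smulDomain a b I c) :=
  contMDiffOn_iff_contDiffOn.1 (b.smooth_tot.comp
    ((contMDiffOn_smul_symm a h).mono fun _ hq => hq.1) fun _ hq => hq.2)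

variable [MulAction G X] [hG : IsAutAction n N G π]

theorem fderiv_smul_dTot {g : G} {y : Y} (hy : y ∈ a.tot.source) (hgy : g • y ∈ b.tot.source)
    (w : TotalModel n N) :
    fderiv ℝ (fun p => b.tot (g • a.tot.symm p)) (a.tot y) (a.dTot y w) =
      b.dTot (g • y) (dSmul (TotalModel n N) g y w) := by
  have hl := a.tot.left_inv hy
  have h1 : ContMDiffAt 𝓘(ℝ, TotalModel n N) 𝓘(ℝ, TotalModel n N) ∞
      (fun p => b.tot (g • a.tot.symm p)) (a.tot y) := by
    have e1 := a.smooth_tot_symm.contMDiffAt (a.tot.open_target.mem_nhds (a.tot.map_source hy))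
    have e2 := (hG.contMDiff_tot g (a.tot.symm (a.tot y))).comp (a.tot y) e1
    have e3 := b.smooth_tot.contMDiffAt (b.tot.open_source.mem_nhds
      (show g • a.tot.symm (a.tot y) ∈ b.tot.source by rwa [hl]))
    exact e3.comp (a.tot y) e2
  have h2 := (((contMDiffAt_iff_contDiffAt.1 h1).differentiableAt
    (by simp)).hasFDerivAt.hasMFDerivAt).comp y (a.mdiff_tot.mdifferentiableAt hy).hasMFDerivAt
  have h3 : HasMFDerivAt 𝓘(ℝ, TotalModel n N) 𝓘(ℝ, TotalModel n N) (fun z => b.tot (g • z)) y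
      ((b.dTot (g • y)).comp (dSmulTot g y)) :=
    (b.mdiff_tot.mdifferentiableAt hgy).hasMFDerivAt.comp y
      ((hG.contMDiff_tot g y).mdifferentiableAt (by simp)).hasMFDerivAt
  have h4 := hasMFDerivAt_unique h2 (h3.congr_of_eventuallyEq (by
    filter_upwards [a.tot.open_source.mem_nhds hy] with z hz
    simp [hz]))
  exact DFunLike.congr_fun h4 w

variable [IsSmoothFiberBundle n N π]

/-- Writes the lift through the derivative of the action on `Y` alone: the tangent map on the base
is recovered by inverting the base component of the image of the graph. Regularity of the lift in
all variables then follows from that of the action on `Y`. -/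
theorem jetCoord_jetLift {g : G} {γ : JetBundle n N π} (hy : γ.pt ∈ a.tot.source)
    (hgy : g • γ.pt ∈ b.tot.source) :
    ((ContinuousLinearMap.fst ℝ (BaseModel n) (FiberModel N)).comp (graphImage
      (fderiv ℝ (fun p => b.tot (g • a.tot.symm p)) (a.tot γ.pt))
        (a.jetCoord γ.jet))).IsInvertible ∧
    prolong (fderiv ℝ (fun p => b.tot (g • a.tot.symm p)) (a.tot γ.pt)) (a.jetCoord γ.jet) =
      b.jetCoord (jetLift n N π g γ).jet := by
  let S : BaseModel n →L[ℝ] BaseModel n := dSmul (BaseModel n) g⁻¹ (π (g • γ.pt))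
  let D₁ : BaseModel n →L[ℝ] BaseModel n := a.dBase (π γ.pt)
  let D₂ : BaseModel n →L[ℝ] BaseModel n := (b.dBase (π (g • γ.pt))).inverse
  -- The witness is `T η_X⁻¹` in base coordinates; its existence proves the required invertibility.
  refine prolong_eq (R := D₁.comp (S.comp D₂)) fun v => ?_
  have e1 := AdaptedChart.dTot_jet hy γ.jet (S (D₂ v))
  have e2 := fderiv_smul_dTot a b hy hgy (γ.jet.1 (S (D₂ v)))
  have e3 := AdaptedChart.dTot_jet (a := b) hgy (jetLift n N π g γ).jet (D₂ v)
  have e4 : b.dBase (π (g • γ.pt)) (D₂ v) = v :=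
    DFunLike.congr_fun (AdaptedChart.dBase_inverse (b.proj_mem _ hgy)) v
  refine (congrArg (fderiv ℝ (fun p => b.tot (g • a.tot.symm p)) (a.tot γ.pt)) e1.symm).trans ?_
  refine e2.trans (Eq.trans e3 ?_)
  exact congrArg (fun w => (w, b.jetCoord (jetLift n N π g γ).jet w)) e4

variable [IsManifold 𝓘(ℝ, BaseModel n) ∞ X]

theorem contDiffOn_jetLift (hI : IsOpen I)
    (h : ContMDiffOn (𝓘(ℝ, ℝ).prod 𝓘(ℝ, TotalModel n N)) 𝓘(ℝ, TotalModel n N) ∞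
      (fun q : ℝ × Y => c q.1 • q.2) (I ×ˢ Set.univ)) :
    ContDiffOn ℝ ∞ (fun q : ℝ × JetModel n N =>
        b.jetHomeo (jetLift n N π (c q.1) (a.jetHomeo.symm q.2)))
      {q | (q.1, q.2.1) ∈ smulDomain a b I c} := by
  let F : ℝ × TotalModel n N → TotalModel n N := fun q => b.tot (c q.1 • a.tot.symm q.2)
  have hW := isOpen_smulDomain a b hI h
  have hF : ContDiffOn ℝ ∞ F (smulDomain a b I c) := contDiffOn_smul a b h
  have hF' := hF.fderiv_of_isOpen (m := ∞) hW (by simp)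
  let D : ℝ × JetModel n N → TotalModel n N →L[ℝ] TotalModel n N := fun q =>
    (fderiv ℝ F (q.1, q.2.1)).comp (ContinuousLinearMap.inr ℝ ℝ (TotalModel n N))
  let S : Set (ℝ × JetModel n N) := {q | (q.1, q.2.1) ∈ smulDomain a b I c}
  have hr : ContDiff ℝ ∞ (fun q : ℝ × JetModel n N => (q.1, q.2.1)) := by fun_prop
  have hFS : ContDiffOn ℝ ∞ (fun q : ℝ × JetModel n N => F (q.1, q.2.1)) S :=
    hF.comp hr.contDiffOn fun q hq => hq
  have hD : ContDiffOn ℝ ∞ D S :=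
    (hF'.comp hr.contDiffOn fun q hq => hq).clm_comp contDiffOn_const
  have hM : ContDiffOn ℝ ∞ (fun q => graphImage (D q) q.2.2) S := by
    have e : ∀ q : ℝ × JetModel n N, (ContinuousLinearMap.id ℝ (BaseModel n)).prod q.2.2 =
        ContinuousLinearMap.inl ℝ (BaseModel n) (FiberModel N) +
          (ContinuousLinearMap.inr ℝ (BaseModel n) (FiberModel N)).comp q.2.2 := fun q =>
      ContinuousLinearMap.ext fun v => Prod.ext (add_zero _).symm (zero_add _).symm
    simp only [graphImage, e]
    refine hD.clm_comp (contDiffOn_const.add (contDiffOn_const.clm_comp ?_))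
    exact (contDiff_snd.comp contDiff_snd).contDiffOn
  -- The partial derivative of `F` in the point, which depends smoothly on `(t, p)`, is the
  -- derivative with `t` frozen, to which the coordinate formula for the lift applies.
  have hDq : ∀ q ∈ S, D q = fderiv ℝ (fun p => b.tot (c q.1 • a.tot.symm p)) q.2.1 := by
    intro q hq
    have h1 := ((hF.contDiffAt (hW.mem_nhds hq)).differentiableAt (by simp)).hasFDerivAt
    exact (HasFDerivAt.comp q.2.1 h1 (hasFDerivAt_prodMk_right q.1 q.2.1)).fderiv.symm
  have key : ∀ q ∈ S,
      ((ContinuousLinearMap.fst ℝ (BaseModel n) (FiberModel N)).comp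
        (graphImage (D q) q.2.2)).IsInvertible ∧ prolong (D q) q.2.2 =
          b.jetCoord (jetLift n N π (c q.1) (a.jetHomeo.symm q.2)).jet := by
    intro q hq
    have hq2 : q.2.1 ∈ a.tot.target := hq.1.2
    have := jetCoord_jetLift a b (g := c q.1) (γ := a.jetHomeo.symm q.2) (a.tot.map_target hq2) hq.2
    have e1 : a.tot (a.jetHomeo.symm q.2).pt = q.2.1 := a.tot.right_inv hq2
    have e2 : a.jetCoord (a.jetHomeo.symm q.2).jet = q.2.2 :=
      jetCoord_jetMk (a.tot.map_target hq2) q.2.2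
    rw [e1, e2, ← hDq q hq] at this
    exact this
  -- Inversion of continuous linear maps is smooth at invertible ones, and `key` supplies
  -- invertibility at each point of `S`.
  have hP : ContDiffOn ℝ ∞ (fun q => prolong (D q) q.2.2) S := by
    refine ContDiffOn.clm_comp (contDiffOn_const.clm_comp hM) fun q hq => ?_
    have h1 := (contDiffOn_const (c := ContinuousLinearMap.fst ℝ (BaseModel n)
      (FiberModel N))).clm_comp hM q hq
    exact ((key q hq).1.contDiffAt_map_inverse).comp_contDiffWithinAt q h1
  exact (hFS.prodMk hP).congr fun q hq => Prod.ext rfl (key q hq).2.symm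

end AdaptedChart

variable [MulAction G X] [hG : IsAutAction n N G π] [IsSmoothFiberBundle n N π]
  [IsManifold 𝓘(ℝ, BaseModel n) ∞ X]

theorem contMDiffOn_jetLift {I : Set ℝ} {c : ℝ → G} (hI : IsOpen I)
    (h : ContMDiffOn (𝓘(ℝ, ℝ).prod 𝓘(ℝ, TotalModel n N)) 𝓘(ℝ, TotalModel n N) ∞
      (fun q : ℝ × Y => c q.1 • q.2) (I ×ˢ Set.univ)) :
    ContMDiffOn (𝓘(ℝ, ℝ).prod 𝓘(ℝ, JetModel n N)) 𝓘(ℝ, JetModel n N) ∞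
      (fun q : ℝ × JetBundle n N π => jetLift n N π (c q.1) q.2) (I ×ˢ Set.univ) := by
  rintro ⟨t, γ⟩ ⟨ht : t ∈ I, -⟩
  obtain ⟨a, ha⟩ := exists_adaptedChart (n := n) (N := N) π γ.pt
  obtain ⟨b, hb⟩ := exists_adaptedChart (n := n) (N := N) π (c t • γ.pt)
  let W : Set (ℝ × JetModel n N) := {q | (q.1, q.2.1) ∈ AdaptedChart.smulDomain a b I c}
  have hW : IsOpen W := (AdaptedChart.isOpen_smulDomain a b hI h).preimage (by fun_prop)
  have h1 : ContMDiffOn (𝓘(ℝ, ℝ).prod 𝓘(ℝ, JetModel n N)) 𝓘(ℝ, ℝ × JetModel n N) ∞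
      (fun q : ℝ × JetBundle n N π => (q.1, a.jetHomeo q.2)) (Set.univ ×ˢ a.jetHomeo.source) :=
    contMDiffOn_fst.prodMk_space (a.contMDiffOn_jetHomeo.comp contMDiffOn_snd fun q hq => hq.2)
  let V : Set (ℝ × JetBundle n N π) := (Set.univ ×ˢ a.jetHomeo.source) ∩
    (fun q : ℝ × JetBundle n N π => (q.1, a.jetHomeo q.2)) ⁻¹' W
  have hV : IsOpen V :=
    h1.continuousOn.isOpen_inter_preimage (isOpen_univ.prod a.jetHomeo.open_source) hW
  have h2 := (contMDiffOn_iff_contDiffOn.2 (AdaptedChart.contDiffOn_jetLift a b hI h)).comp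
    (h1.mono (Set.inter_subset_left (t := (fun q : ℝ × JetBundle n N π =>
      (q.1, a.jetHomeo q.2)) ⁻¹' W))) fun q hq => hq.2
  have hl : ∀ q ∈ V, a.jetHomeo.symm (a.jetHomeo q.2) = q.2 := fun q hq =>
    a.jetHomeo.left_inv hq.1.2
  have hs : ∀ q ∈ V, jetLift n N π (c q.1) q.2 ∈ b.jetHomeo.source := by
    intro q hq
    have e := hq.2.2
    change c q.1 • a.tot.symm (a.tot q.2.pt) ∈ b.tot.source at e
    rw [a.tot.left_inv hq.1.2] at e
    exact e
  have h3 := b.contMDiffOn_jetHomeo_symm.comp h2 fun q hq => by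
    change b.jetHomeo (jetLift n N π (c q.1) (a.jetHomeo.symm (a.jetHomeo q.2))) ∈ b.jetHomeo.target
    rw [hl q hq]
    exact b.jetHomeo.map_source (hs q hq)
  have h4 := h3.congr (f₁ := fun q : ℝ × JetBundle n N π => jetLift n N π (c q.1) q.2)
    fun q hq => by
      change _ = b.jetHomeo.symm (b.jetHomeo (jetLift n N π (c q.1)
        (a.jetHomeo.symm (a.jetHomeo q.2))))
      rw [hl q hq, b.jetHomeo.left_inv (hs q hq)]
  have hmem : (t, γ) ∈ V := by
    refine ⟨⟨trivial, ha⟩, ⟨ht, a.tot.map_source ha⟩, ?_⟩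
    change c t • a.tot.symm (a.tot γ.pt) ∈ b.tot.source
    rwa [a.tot.left_inv ha]
  exact (h4.contMDiffAt (hV.mem_nhds hmem)).contMDiffWithinAt

/-- A single translation is the family along the constant curve `g`. -/
theorem contMDiff_jetLift (g : G) :
    ContMDiff 𝓘(ℝ, JetModel n N) 𝓘(ℝ, JetModel n N) ∞ (jetLift n N π g) := by
  have h : ContMDiffOn (𝓘(ℝ, ℝ).prod 𝓘(ℝ, TotalModel n N)) 𝓘(ℝ, TotalModel n N) ∞
      (fun q : ℝ × Y => g • q.2) (Set.univ ×ˢ Set.univ) :=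
    ((hG.contMDiff_tot g).comp contMDiff_snd).contMDiffOn
  have h1 := contMDiffOn_jetLift (π := π) (c := fun _ => g) isOpen_univ h
  rw [Set.univ_prod_univ, contMDiffOn_univ] at h1
  exact h1.comp ((contMDiff_const (c := (0 : ℝ))).prodMk contMDiff_id)

end FieldTheory
end

/-! ### Curves in the group and infinitesimal generators -/

noncomputable section
namespace FieldTheory
section Curves
variable {H M : Type*} [NormedAddCommGroup H] [NormedSpace ℝ H] [TopologicalSpace M]
  [ChartedSpace H M] {H' M' : Type*} [NormedAddCommGroup H'] [NormedSpace ℝ H']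
  [TopologicalSpace M'] [ChartedSpace H' M']

/-- The tangent space at `m` is identified with `H` through the preferred chart at `m`, so the
velocity is the derivative in that chart with no correction factor. -/
theorem mfderiv_curve {f : ℝ → M} {m : M} (h0 : f 0 = m) (hc : ContinuousAt f 0) {v : H}
    (h : HasDerivAt (fun t => chartAt H m (f t)) v 0) :
    (mfderiv 𝓘(ℝ, ℝ) 𝓘(ℝ, H) f 0 (1 : ℝ) : H) = v := by
  subst h0
  have h1 : HasMFDerivAt 𝓘(ℝ, ℝ) 𝓘(ℝ, H) f 0 (ContinuousLinearMap.toSpanSingleton ℝ v) := by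
    refine ⟨hc, ?_⟩
    exact h.hasFDerivAt.hasFDerivWithinAt
  have h2 := DFunLike.congr_fun h1.mfderiv (1 : ℝ)
  exact h2.trans (one_smul ℝ v)

theorem mfderiv_comp_curve {f : ℝ → M} {F : M → M'} {m : M} (h0 : f 0 = m)
    (hf : MDifferentiableAt 𝓘(ℝ, ℝ) 𝓘(ℝ, H) f 0)
    (hF : MDifferentiableAt 𝓘(ℝ, H) 𝓘(ℝ, H') F m) :
    (mfderiv 𝓘(ℝ, ℝ) 𝓘(ℝ, H') (fun t => F (f t)) 0 (1 : ℝ) : H') =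
      mfderiv 𝓘(ℝ, H) 𝓘(ℝ, H') F m (mfderiv 𝓘(ℝ, ℝ) 𝓘(ℝ, H) f 0 (1 : ℝ) : H) := by
  subst h0
  have := mfderiv_comp (I := 𝓘(ℝ, ℝ)) (0 : ℝ) hF hf
  exact DFunLike.congr_fun this (1 : ℝ)

end Curves

theorem isOpen_chartDomain {K H G M : Type*} [TopologicalSpace K] [TopologicalSpace H]
    [TopologicalSpace G] [TopologicalSpace M] [SMul G M] (hact : Continuous fun p : G × M => p.1 • p.2)
    (φ : OpenPartialHomeomorph G K) (ψ χ : OpenPartialHomeomorph M H) :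
    IsOpen {p : K × H | p.1 ∈ φ.target ∧ p.2 ∈ ψ.target ∧ φ.symm p.1 • ψ.symm p.2 ∈ χ.source} := by
  have h1 : ContinuousOn (fun p : K × H => φ.symm p.1 • ψ.symm p.2) (φ.target ×ˢ ψ.target) :=
    hact.comp_continuousOn ((φ.continuousOn_symm.comp continuousOn_fst fun p hp => hp.1).prodMk
      (ψ.continuousOn_symm.comp continuousOn_snd fun p hp => hp.2))
  have h2 := h1.isOpen_inter_preimage (φ.open_target.prod ψ.open_target) χ.open_source
  convert h2 using 1
  ext p
  exact and_assoc.symm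

section Groups
variable {𝔤 : Type*} [AddCommGroup 𝔤] [Module ℝ 𝔤] [TopologicalSpace 𝔤]
  {G : Type*} [Group G] [TopologicalSpace G] [ChartedSpace 𝔤 G]

variable (G) in
/-- The curve through `1` in `G` which is the straight line of direction `ξ` in the chart at `1`. -/
def chartLine (ξ : 𝔤) (t : ℝ) : G :=
  (chartAt 𝔤 (1 : G)).symm (chartAt 𝔤 (1 : G) 1 + t • ξ)

variable (G) in
/-- The parameters for which the straight line of direction `ξ` stays in the chart at `1`. -/
def lineDomain (ξ : 𝔤) : Set ℝ :=
  {t | chartAt 𝔤 (1 : G) 1 + t • ξ ∈ (chartAt 𝔤 (1 : G)).target}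

theorem zero_mem_lineDomain (ξ : 𝔤) : (0 : ℝ) ∈ lineDomain G ξ := by
  change chartAt 𝔤 (1 : G) 1 + (0 : ℝ) • ξ ∈ (chartAt 𝔤 (1 : G)).target
  rw [zero_smul, add_zero]
  exact mem_chart_target 𝔤 (1 : G)

theorem chartLine_zero (ξ : 𝔤) : chartLine G ξ 0 = 1 := by
  rw [chartLine, zero_smul, add_zero, (chartAt 𝔤 (1 : G)).left_inv (mem_chart_source 𝔤 (1 : G))]

variable [IsTopologicalAddGroup 𝔤] [ContinuousSMul ℝ 𝔤]

theorem isOpen_lineDomain (ξ : 𝔤) : IsOpen (lineDomain G ξ) :=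
  (chartAt 𝔤 (1 : G)).open_target.preimage (by fun_prop)

variable {H M : Type*} [NormedAddCommGroup H] [NormedSpace ℝ H] [TopologicalSpace M]
  [ChartedSpace H M] [MulAction G M]

/-- The infinitesimal generators of a smooth action depend linearly and continuously on the element
of the Lie algebra. -/
theorem exists_generator_clm
    (hact : IsBastianiSmooth₂ 𝔤 H H fun (g : G) (m : M) => g • m) (m : M) :
    ∃ f' : 𝔤 →L[ℝ] H, ∀ ξ : 𝔤,
      (generator (fun (g : G) (m : M) => g • m) ξ m : H) = f' ξ := by
  let φ := chartAt 𝔤 (1 : G)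
  let ψ := chartAt H m
  have hS := isOpen_chartDomain hact.continuous φ ψ ψ
  have h1 := hact.smooth φ (chart_mem_atlas _ _) ψ (chart_mem_atlas _ _) ψ (chart_mem_atlas _ _)
  have hm : ψ.symm (ψ m) = m := ψ.left_inv (mem_chart_source H m)
  have hmem : ((φ 1, ψ m) : 𝔤 × H) ∈ {p : 𝔤 × H | p.1 ∈ φ.target ∧ p.2 ∈ ψ.target ∧
      φ.symm p.1 • ψ.symm p.2 ∈ ψ.source} := by
    refine ⟨mem_chart_target 𝔤 (1 : G), mem_chart_target H m, ?_⟩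
    change φ.symm (φ 1) • ψ.symm (ψ m) ∈ ψ.source
    rw [hm, φ.left_inv (mem_chart_source 𝔤 (1 : G)), one_smul]
    exact mem_chart_source H m
  -- The derivative of the action in charts at `(1, m)` is continuous and linear on `𝔤 × H`.
  -- Generators are its values on the directions `(ξ, 0)`.
  obtain ⟨f', hf'⟩ := h1.exists_clm hS hmem
  refine ⟨f'.comp (ContinuousLinearMap.inl ℝ 𝔤 H), fun ξ => ?_⟩
  have h0 : chartLine G ξ 0 • m = m := by rw [chartLine_zero, one_smul]
  refine mfderiv_curve (f := fun t => chartLine G ξ t • m) h0 ?_ ?_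
  · have e1 : ContinuousAt (chartLine G ξ) 0 := by
      refine ContinuousAt.comp (g := φ.symm) (f := fun t : ℝ => φ 1 + t • ξ) ?_ (by fun_prop)
      exact φ.continuousAt_symm (zero_mem_lineDomain (G := G) ξ)
    exact ContinuousAt.comp (g := fun p : G × M => p.1 • p.2) (f := fun t => (chartLine G ξ t, m))
      hact.continuous.continuousAt (e1.prodMk continuousAt_const)
  · refine (hf' (ξ, 0)).congr_of_eventuallyEq (Filter.Eventually.of_forall fun t => ?_)
    change ψ (chartLine G ξ t • m) = ψ (φ.symm (φ 1 + t • ξ) • ψ.symm (ψ m + t • (0 : H)))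
    rw [smul_zero, add_zero, hm]
    rfl

variable [FiniteDimensional ℝ H] [IsManifold 𝓘(ℝ, H) ∞ M]

/-- A smooth action of a Lie group is smooth along the straight lines of the chart at `1`. -/
theorem contMDiffOn_chartLine_smul
    (hact : IsBastianiSmooth₂ 𝔤 H H fun (g : G) (m : M) => g • m) (ξ : 𝔤) :
    ContMDiffOn (𝓘(ℝ, ℝ).prod 𝓘(ℝ, H)) 𝓘(ℝ, H) ∞ (fun q : ℝ × M => chartLine G ξ q.1 • q.2)
      (lineDomain G ξ ×ˢ Set.univ) := by
  rintro ⟨t₀, m₀⟩ ⟨ht₀ : t₀ ∈ lineDomain G ξ, -⟩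
  let φ := chartAt 𝔤 (1 : G)
  let ψ := chartAt H m₀
  let χ := chartAt H (chartLine G ξ t₀ • m₀)
  have hS := isOpen_chartDomain hact.continuous φ ψ χ
  -- With base point `(φ 1, 0)` this gives the affine map `(t, p) ↦ (φ 1 + t ξ, p)` from a
  -- finite-dimensional space. Along it the action in charts is smooth in the ordinary sense.
  let A : ℝ × H →L[ℝ] 𝔤 × H :=
    ((ContinuousLinearMap.fst ℝ ℝ H).smulRight ξ).prod (ContinuousLinearMap.snd ℝ ℝ H)
  have h1 := (hact.smooth φ (chart_mem_atlas _ _) ψ (chart_mem_atlas _ _) χ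
    (chart_mem_atlas _ _)).comp_affine (φ 1, 0) A
  have hA : Continuous fun q : ℝ × H => ((φ 1, 0) : 𝔤 × H) + A q := by fun_prop
  have h2 := h1.contDiffOn (hS.preimage hA)
  let e : ℝ × M → ℝ × H := fun q => (q.1, ψ q.2)
  have he : ContMDiffOn (𝓘(ℝ, ℝ).prod 𝓘(ℝ, H)) 𝓘(ℝ, ℝ × H) ∞ e (Set.univ ×ˢ ψ.source) :=
    contMDiffOn_fst.prodMk_space ((contMDiffOn_chart (x := m₀)).comp contMDiffOn_snd
      fun q hq => hq.2)
  have hψ : IsOpen (Set.univ ×ˢ ψ.source : Set (ℝ × M)) := isOpen_univ.prod ψ.open_source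
  let V : Set (ℝ × M) := (Set.univ ×ˢ ψ.source) ∩ e ⁻¹' ((fun q : ℝ × H =>
    ((φ 1, 0) : 𝔤 × H) + A q) ⁻¹' {p : 𝔤 × H | p.1 ∈ φ.target ∧ p.2 ∈ ψ.target ∧
      φ.symm p.1 • ψ.symm p.2 ∈ χ.source})
  have hV : IsOpen V := he.continuousOn.isOpen_inter_preimage hψ (hS.preimage hA)
  have h3 := (contMDiffOn_iff_contDiffOn.2 h2).comp (he.mono (Set.inter_subset_left (t := e ⁻¹' _)))
    fun q hq => hq.2
  have hval : ∀ q ∈ V, φ.symm (((φ 1, 0) : 𝔤 × H) + A (e q)).1 •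
      ψ.symm (((φ 1, 0) : 𝔤 × H) + A (e q)).2 = chartLine G ξ q.1 • q.2 := by
    intro q hq
    change φ.symm (φ 1 + q.1 • ξ) • ψ.symm (0 + ψ q.2) = _
    rw [zero_add, ψ.left_inv hq.1.2]
    rfl
  have hsrc : ∀ q ∈ V, chartLine G ξ q.1 • q.2 ∈ χ.source := by
    intro q hq
    rw [← hval q hq]
    exact hq.2.2.2
  have h4 := (contMDiffOn_chart_symm (I := 𝓘(ℝ, H)) (n := ∞)
    (x := chartLine G ξ t₀ • m₀)).comp h3 fun q hq => by
      change χ _ ∈ χ.target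
      rw [hval q hq]
      exact χ.map_source (hsrc q hq)
  have h5 := h4.congr (f₁ := fun q : ℝ × M => chartLine G ξ q.1 • q.2) fun q hq => by
    change _ = χ.symm (χ _)
    rw [hval q hq, χ.left_inv (hsrc q hq)]
  have hmem : (t₀, m₀) ∈ V := by
    refine ⟨⟨trivial, mem_chart_source H m₀⟩, ?_, ?_, ?_⟩
    · exact ht₀
    · change (0 : H) + ψ m₀ ∈ ψ.target
      rw [zero_add]; exact mem_chart_target H m₀
    · change chartLine G ξ t₀ • ψ.symm (0 + ψ m₀) ∈ χ.source
      rw [zero_add, ψ.left_inv (mem_chart_source H m₀)]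
      exact mem_chart_source H _
  exact (h5.contMDiffAt (hV.mem_nhds hmem)).contMDiffWithinAt

end Groups
end FieldTheory
end

/-! ### Cartan's formula on manifolds for forms invariant under a smooth family -/

noncomputable section
namespace FieldTheory
section Flows
variable {H M : Type*} [NormedAddCommGroup H] [NormedSpace ℝ H] [TopologicalSpace M]
  [ChartedSpace H M]

theorem mfderiv_of_hasDerivAt {f : ℝ → H} {v : H} (h : HasDerivAt f v 0) :
    (mfderiv 𝓘(ℝ, ℝ) 𝓘(ℝ, H) f 0 (1 : ℝ) : H) = v :=
  mfderiv_curve rfl h.continuousAt h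

/-- The velocity at `t = 0` of a family of maps `ψ t`. -/
def velocity (H : Type*) [NormedAddCommGroup H] [NormedSpace ℝ H] {M : Type*} [TopologicalSpace M]
    [ChartedSpace H M] (ψ : ℝ → M → M) (m : M) : TangentSpace 𝓘(ℝ, H) m :=
  mfderiv 𝓘(ℝ, ℝ) 𝓘(ℝ, H) (fun t : ℝ => ψ t m) 0 (1 : ℝ)

/-- The representative of a family of maps in a chart. -/
def localFlow (φ : OpenPartialHomeomorph M H) (ψ : ℝ → M → M) (q : ℝ × H) : H :=
  φ (ψ q.1 (φ.symm q.2))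

/-- The parameters and coordinates at which the representative of a family of maps is defined. -/
def localFlowDomain (φ : OpenPartialHomeomorph M H) (ψ : ℝ → M → M) (I : Set ℝ) : Set (ℝ × H) :=
  {q | (q.1 ∈ I ∧ q.2 ∈ φ.target) ∧ ψ q.1 (φ.symm q.2) ∈ φ.source}

/-- The representative of the velocity in a chart. -/
def localVelocity (φ : OpenPartialHomeomorph M H) (ψ : ℝ → M → M) (q : H) : H :=
  fderiv ℝ (localFlow φ ψ) (0, q) (1, 0)

/-- A family of maps `ψ t`, smooth in `t ∈ I` and the point, with `ψ 0 = id`. -/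
structure IsSmoothFamily (H : Type*) [NormedAddCommGroup H] [NormedSpace ℝ H] {M : Type*}
    [TopologicalSpace M] [ChartedSpace H M] (ψ : ℝ → M → M) (I : Set ℝ) : Prop where
  isOpen : IsOpen I
  zero_mem : (0 : ℝ) ∈ I
  smooth : ContMDiffOn (𝓘(ℝ, ℝ).prod 𝓘(ℝ, H)) 𝓘(ℝ, H) ∞ (fun q : ℝ × M => ψ q.1 q.2)
    (I ×ˢ Set.univ)
  apply_zero : ∀ m, ψ 0 m = m

namespace IsSmoothFamily
variable {ψ : ℝ → M → M} {I : Set ℝ} (h : IsSmoothFamily H ψ I)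
include h

theorem mdifferentiableAt (m : M) :
    MDifferentiableAt 𝓘(ℝ, ℝ) 𝓘(ℝ, H) (fun t => ψ t m) 0 := by
  have h1 := (h.smooth (0, m) ⟨h.zero_mem, trivial⟩).contMDiffAt
    ((h.isOpen.prod isOpen_univ).mem_nhds ⟨h.zero_mem, trivial⟩)
  have h2 : ContMDiffAt 𝓘(ℝ, ℝ) (𝓘(ℝ, ℝ).prod 𝓘(ℝ, H)) ∞ (fun t : ℝ => (t, m)) 0 :=
    contMDiffAt_id.prodMk contMDiffAt_const
  exact (ContMDiffAt.comp (0 : ℝ) h1 h2).mdifferentiableAt (by simp)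

theorem contMDiff {t : ℝ} (ht : t ∈ I) : ContMDiff 𝓘(ℝ, H) 𝓘(ℝ, H) ∞ (ψ t) := by
  intro m
  have h1 := (h.smooth (t, m) ⟨ht, trivial⟩).contMDiffAt
    ((h.isOpen.prod isOpen_univ).mem_nhds ⟨ht, trivial⟩)
  have h2 : ContMDiffAt 𝓘(ℝ, H) (𝓘(ℝ, ℝ).prod 𝓘(ℝ, H)) ∞ (fun m' : M => (t, m')) m :=
    contMDiffAt_const.prodMk contMDiffAt_id
  exact ContMDiffAt.comp (g := fun q : ℝ × M => ψ q.1 q.2) m h1 h2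

variable {x : M}

theorem zero_mem_localFlowDomain {q : H} (hq : q ∈ (chartAt H x).target) :
    (0, q) ∈ localFlowDomain (chartAt H x) ψ I := by
  refine ⟨⟨h.zero_mem, hq⟩, ?_⟩
  change ψ 0 ((chartAt H x).symm q) ∈ _
  rw [h.apply_zero]
  exact (chartAt H x).map_target hq

theorem localFlow_zero {q : H} (hq : q ∈ (chartAt H x).target) :
    localFlow (chartAt H x) ψ (0, q) = q := by
  change chartAt H x (ψ 0 ((chartAt H x).symm q)) = q
  rw [h.apply_zero, (chartAt H x).right_inv hq]

variable [IsManifold 𝓘(ℝ, H) ∞ M] (x)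

theorem contMDiffOn_comp_symm :
    ContMDiffOn 𝓘(ℝ, ℝ × H) 𝓘(ℝ, H) ∞
      (fun q : ℝ × H => ψ q.1 ((chartAt H x).symm q.2)) (I ×ˢ (chartAt H x).target) := by
  have h1 : ContMDiffOn 𝓘(ℝ, ℝ × H) 𝓘(ℝ, H) ∞
      (fun q : ℝ × H => (chartAt H x).symm q.2) (I ×ˢ (chartAt H x).target) :=
    (contMDiffOn_chart_symm (I := 𝓘(ℝ, H)) (x := x)).comp (contDiff_snd (𝕜 := ℝ) (E := ℝ)
      (F := H)).contMDiff.contMDiffOn fun q hq => hq.2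
  have h2 := (contDiff_fst (𝕜 := ℝ) (n := ∞) (E := ℝ)
    (F := H)).contMDiff.contMDiffOn (s := I ×ˢ (chartAt H x).target)
  exact h.smooth.comp (h2.prodMk h1) fun q hq => ⟨hq.1, trivial⟩

theorem isOpen_localFlowDomain : IsOpen (localFlowDomain (chartAt H x) ψ I) :=
  (h.contMDiffOn_comp_symm x).continuousOn.isOpen_inter_preimage
    (h.isOpen.prod (chartAt H x).open_target) (chartAt H x).open_source

theorem contDiffOn_localFlow :
    ContDiffOn ℝ ∞ (localFlow (chartAt H x) ψ) (localFlowDomain (chartAt H x) ψ I) :=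
  contMDiffOn_iff_contDiffOn.1 ((contMDiffOn_chart (I := 𝓘(ℝ, H)) (x := x)).comp
    ((h.contMDiffOn_comp_symm x).mono fun _ hq => hq.1) fun _ hq => hq.2)

variable {x}

theorem contDiffAt_localFlow {q : ℝ × H} (hq : q ∈ localFlowDomain (chartAt H x) ψ I) :
    ContDiffAt ℝ ∞ (localFlow (chartAt H x) ψ) q :=
  (h.contDiffOn_localFlow x).contDiffAt ((h.isOpen_localFlowDomain x).mem_nhds hq)

theorem contDiffOn_localVelocity :
    ContDiffOn ℝ ∞ (localVelocity (chartAt H x) ψ) (chartAt H x).target := by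
  have h1 := (h.contDiffOn_localFlow x).fderiv_of_isOpen (m := ∞)
    (h.isOpen_localFlowDomain x) (by simp)
  have h2 : ContDiff ℝ ∞ (fun q : H => ((0, q) : ℝ × H)) := by fun_prop
  exact (h1.comp h2.contDiffOn fun q hq => h.zero_mem_localFlowDomain hq).clm_apply
    contDiffOn_const

theorem hasDerivAt_localFlow {q : H} (hq : q ∈ (chartAt H x).target) :
    HasDerivAt (fun t : ℝ => localFlow (chartAt H x) ψ (t, q))
      (localVelocity (chartAt H x) ψ q) 0 := by
  have h1 := ((h.contDiffAt_localFlow (h.zero_mem_localFlowDomain hq)).differentiableAt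
    (by simp)).hasFDerivAt
  exact h1.comp_hasDerivAt (0 : ℝ) ((hasDerivAt_id (0 : ℝ)).prodMk (hasDerivAt_const (0 : ℝ) q))

/-- The velocity at a point is read in the preferred chart of that point, whereas `localVelocity`
uses the fixed chart at `x`. The chart derivative mediates between the two, by the chain rule along
the curve. -/
theorem mfderiv_symm_localVelocity {q : H} (hq : q ∈ (chartAt H x).target) :
    (mfderiv 𝓘(ℝ, H) 𝓘(ℝ, H) (chartAt H x).symm q
      (localVelocity (H := H) (chartAt H x) ψ q) : H) =
      velocity H ψ ((chartAt H x).symm q) := by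
  have h1 := h.hasDerivAt_localFlow hq
  have h2 := mfderiv_comp_curve (f := fun t : ℝ => localFlow (chartAt H x) ψ (t, q))
    (F := (chartAt H x).symm) (h.localFlow_zero hq)
    (mdifferentiableAt_iff_differentiableAt.2 h1.differentiableAt)
    (mdifferentiableAt_atlas_symm (I := 𝓘(ℝ, H)) (chart_mem_atlas H x) hq)
  have h3 := mfderiv_of_hasDerivAt h1
  -- Equality holds only for small `t`, as long as the moving point stays in the chart domain.
  have h4 : (fun t : ℝ => (chartAt H x).symm (localFlow (chartAt H x) ψ (t, q))) =ᶠ[𝓝 0]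
      fun t => ψ t ((chartAt H x).symm q) := by
    have e : Continuous fun t : ℝ => (t, q) := by fun_prop
    filter_upwards [(((h.isOpen_localFlowDomain x).preimage e).mem_nhds
      (h.zero_mem_localFlowDomain hq))] with t ht
    exact (chartAt H x).left_inv ht.2
  have h5 := congrArg (β := H) (fun D : ℝ →L[ℝ] H => D 1) (h4.mfderiv_eq (I := 𝓘(ℝ, ℝ))
    (I' := 𝓘(ℝ, H)))
  exact (congrArg (β := H) (mfderiv 𝓘(ℝ, H) 𝓘(ℝ, H) (chartAt H x).symm q) h3.symm).trans
    (h2.symm.trans h5)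

theorem mfderiv_chart_velocity {m : M} (hm : m ∈ (chartAt H x).source) :
    (mfderiv 𝓘(ℝ, H) 𝓘(ℝ, H) (chartAt H x) m (velocity H ψ m) : H) =
      localVelocity (chartAt H x) ψ (chartAt H x m) := by
  have h1 := h.hasDerivAt_localFlow ((chartAt H x).map_source hm)
  have h2 := mfderiv_comp_curve (f := fun t : ℝ => ψ t m) (F := chartAt H x) (h.apply_zero m)
    (h.mdifferentiableAt m) (mdifferentiableAt_atlas (I := 𝓘(ℝ, H)) (chart_mem_atlas H x) hm)
  refine h2.symm.trans ?_
  refine mfderiv_of_hasDerivAt (f := fun t : ℝ => chartAt H x (ψ t m)) ?_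
  simpa only [localFlow, (chartAt H x).left_inv hm] using h1

variable {k : ℕ} {θ : DForm H M (k + 1)}

/-- Interior products commute with passage to a chart: the chart inverse carries the local velocity
in slot `0` to the intrinsic one, and the other slots agree by definition. -/
theorem inChart_interior (θ : DForm H M (k + 1)) {q : H} (hq : q ∈ (chartAt H x).target) :
    (θ.interior (velocity H ψ)).inChart (chartAt H x) q =
      (θ.inChart (chartAt H x) q).curryLeft (localVelocity (chartAt H x) ψ q) := by
  refine ContinuousAlternatingMap.ext fun u => ?_
  refine congrArg (θ ((chartAt H x).symm q)) (funext fun i => ?_)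
  refine Fin.cases ?_ (fun j => ?_) i
  · exact (h.mfderiv_symm_localVelocity hq).symm
  · rfl

theorem isSmooth_interior [FiniteDimensional ℝ H] (hθ : θ.IsSmooth) : (θ.interior (velocity H ψ)).IsSmooth := by
  intro x
  refine (contDiffOn_form_iff fun u => ?_ : ContDiffOn ℝ ∞ (fun q => (θ.inChart (chartAt H x)
    q).curryLeft (localVelocity (chartAt H x) ψ q)) _).congr fun q hq => h.inChart_interior θ hq
  refine contDiffOn_form_apply (g := fun q => Matrix.vecCons (localVelocity (chartAt H x) ψ q) u)
    (hθ x) (contDiffOn_pi.2 fun i => ?_)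
  refine Fin.cases ?_ (fun j => ?_) i
  · exact h.contDiffOn_localVelocity
  · exact contDiffOn_const

/-- Invariance in coordinates. Near `q`, the chart inverse after the local flow equals `ψ t` after
the chart inverse; so their derivatives agree, and invariance of `θ` can be read in the chart. -/
theorem inChart_localFlow {t : ℝ} (hθ : θ.pullback (ψ t) = θ) {q : H}
    (hq : (t, q) ∈ localFlowDomain (chartAt H x) ψ I) :
    (θ.inChart (chartAt H x) (localFlow (chartAt H x) ψ (t, q))).compContinuousLinearMap
      ((fderiv ℝ (localFlow (chartAt H x) ψ) (t, q)).comp (ContinuousLinearMap.inr ℝ ℝ H)) =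
      θ.inChart (chartAt H x) q := by
  let φ := chartAt H x
  have hφ : ∀ p ∈ φ.target, MDifferentiableAt 𝓘(ℝ, H) 𝓘(ℝ, H) φ.symm p := fun p hp =>
    mdifferentiableAt_atlas_symm (I := 𝓘(ℝ, H)) (chart_mem_atlas H x) hp
  have h1 : HasFDerivAt (fun p => localFlow φ ψ (t, p))
      ((fderiv ℝ (localFlow φ ψ) (t, q)).comp (ContinuousLinearMap.inr ℝ ℝ H)) q :=
    HasFDerivAt.comp q ((h.contDiffAt_localFlow hq).differentiableAt (by simp)).hasFDerivAt
      (hasFDerivAt_prodMk_right t q)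
  have h2 := (hφ _ (φ.map_source hq.2)).hasMFDerivAt.comp q h1.hasMFDerivAt
  have h3 := ((h.contMDiff hq.1.1 (φ.symm q)).mdifferentiableAt (by simp)).hasMFDerivAt.comp q
    (hφ q hq.1.2).hasMFDerivAt
  have h4 : (fun p => φ.symm (localFlow φ ψ (t, p))) =ᶠ[𝓝 q] fun p => ψ t (φ.symm p) := by
    have e : Continuous fun p : H => (t, p) := by fun_prop
    filter_upwards [((h.isOpen_localFlowDomain x).preimage e).mem_nhds hq] with p hp
    exact φ.left_inv hp.2
  have h5 := hasMFDerivAt_unique h2 (h3.congr_of_eventuallyEq h4)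
  refine ContinuousAlternatingMap.ext fun u => ?_
  -- The base point and the vectors must be replaced together because the type of `θ m` depends on
  -- `m`; taking the vectors in the model space `H` makes this possible.
  have h6 : ∀ (m m' : M) (w w' : Fin (k + 1) → H), m = m' → w = w' → θ m w = θ m' w' := by
    rintro m _ w _ rfl rfl; rfl
  have h7 := DFunLike.congr_fun (congrFun hθ (φ.symm q))
    (fun i => mfderiv 𝓘(ℝ, H) 𝓘(ℝ, H) φ.symm q (u i))
  refine Eq.trans ?_ h7
  refine h6 _ _ _ _ h4.self_of_nhds (funext fun i => ?_)
  exact DFunLike.congr_fun h5 (u i)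

/-- Cartan's formula for a form that is invariant under a family of maps. -/
theorem d_interior (hθ : θ.IsSmooth) (hinv : ∀ t ∈ I, θ.pullback (ψ t) = θ) :
    (-θ.d).interior (velocity H ψ) = (θ.interior (velocity H ψ)).d := by
  funext m
  let φ := chartAt H m
  have hm : m ∈ φ.source := mem_chart_source H m
  have hp : φ m ∈ φ.target := φ.map_source hm
  have ht := φ.open_target.mem_nhds hp
  have hD := h.zero_mem_localFlowDomain hp
  -- `d` at `m` is computed in the preferred chart at `m`, so the vector space formula is needed
  -- only at the single point `φ m`, with `φ` that chart.
  have h1 := extDeriv_interior_of_invariant (α := θ.inChart φ) (Ψ := localFlow φ ψ)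
    (((hθ m).contDiffAt ht).differentiableAt (by simp))
    ((h.contDiffAt_localFlow hD).of_le ENat.LEInfty.out)
    (by filter_upwards [ht] with q hq using h.localFlow_zero hq)
    (by
      have e : Continuous fun t : ℝ => (t, φ m) := by fun_prop
      filter_upwards [((h.isOpen_localFlowDomain m).preimage e).mem_nhds hD] with t ht
      exact h.inChart_localFlow (hinv t ht.1.1) ht)
  have h2 : extDeriv ((θ.interior (velocity H ψ)).inChart φ) (φ m) =
      extDeriv (fun q => (θ.inChart φ q).curryLeft (localVelocity φ ψ q)) (φ m) :=
    Filter.EventuallyEq.extDeriv_eq (by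
      filter_upwards [ht] with q hq using h.inChart_interior θ hq)
  have h3 := h2.trans h1
  refine ContinuousAlternatingMap.ext fun u => ?_
  have h4 := DFunLike.congr_fun h3 (fun i => mfderiv 𝓘(ℝ, H) 𝓘(ℝ, H) φ m (u i))
  refine Eq.trans ?_ h4.symm
  refine congrArg Neg.neg (congrArg (extDeriv (θ.inChart φ) (φ m)) (funext fun i => ?_))
  refine Fin.cases ?_ (fun j => ?_) i
  · exact h.mfderiv_chart_velocity hm
  · rfl

end IsSmoothFamily
end Flows
end FieldTheory
end

/-! ### The Cartan form, its invariance, and the Lagrangian momentum map -/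

noncomputable section
namespace FieldTheory
universe u v
variable {n N : ℕ} {X : Type u} [TopologicalSpace X] [ChartedSpace (BaseModel n) X]
  [IsManifold 𝓘(ℝ, BaseModel n) ∞ X]
  {Y : Type v} [TopologicalSpace Y] [ChartedSpace (TotalModel n N) Y]
  {π : Y → X} [IsSmoothFiberBundle n N π]

/-- The tangent map of `J¹Y → Y`, as a linear map of the model spaces. -/
def dPt (γ : JetBundle n N π) : JetModel n N →L[ℝ] TotalModel n N :=
  mfderiv 𝓘(ℝ, JetModel n N) 𝓘(ℝ, TotalModel n N) (JetBundle.pt : JetBundle n N π → Y) γ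

theorem mdifferentiableAt_pt (γ : JetBundle n N π) :
    MDifferentiableAt 𝓘(ℝ, JetModel n N) 𝓘(ℝ, TotalModel n N)
      (JetBundle.pt : JetBundle n N π → Y) γ :=
  (JetBundle.contMDiff_pt γ).mdifferentiableAt (by simp)

/-- In natural coordinates, the tangent map of `J¹Y → Y` is the projection. -/
theorem dPt_symm (a : AdaptedChart n N π) {q : JetModel n N} (hq : q ∈ a.jetHomeo.target)
    (w : JetModel n N) :
    dPt (a.jetHomeo.symm q)
      (mfderiv 𝓘(ℝ, JetModel n N) 𝓘(ℝ, JetModel n N) a.jetHomeo.symm q w) =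
      (a.dTot (a.tot.symm q.1)).inverse w.1 := by
  have hy : a.tot.symm q.1 ∈ a.tot.source := a.tot.map_target (a.mem_jetHomeo_target.1 hq)
  have h1 := (a.contMDiffOn_jetHomeo_symm.contMDiffAt
    (a.jetHomeo.open_target.mem_nhds hq)).mdifferentiableAt (by simp)
  have h2 := (mdifferentiableAt_pt (a.jetHomeo.symm q)).hasMFDerivAt.comp q h1.hasMFDerivAt
  have h3 := (a.mdiff_tot.mdifferentiableAt hy).hasMFDerivAt.comp q h2
  have h4 : HasMFDerivAt 𝓘(ℝ, JetModel n N) 𝓘(ℝ, TotalModel n N)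
      (fun p : JetModel n N => p.1) q
      (ContinuousLinearMap.fst ℝ (TotalModel n N) (BaseModel n →L[ℝ] FiberModel N)) :=
    (ContinuousLinearMap.fst ℝ (TotalModel n N) (BaseModel n →L[ℝ] FiberModel N)).hasMFDerivAt
  have h5 := hasMFDerivAt_unique h3 (h4.congr_of_eventuallyEq (by
    filter_upwards [a.jetHomeo.open_target.mem_nhds hq] with p hp
    exact a.tot.right_inv (a.mem_jetHomeo_target.1 hp)))
  have h6 := DFunLike.congr_fun h5 w
  have h7 := DFunLike.congr_fun (AdaptedChart.inverse_dTot hy) (dPt (a.jetHomeo.symm q)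
    (mfderiv 𝓘(ℝ, JetModel n N) 𝓘(ℝ, JetModel n N) a.jetHomeo.symm q w))
  exact h7.symm.trans (congrArg (a.dTot (a.tot.symm q.1)).inverse h6)

namespace Lagrangian
variable (L : Lagrangian n N π)

theorem mdifferentiableAt_legendre (γ : JetBundle n N π) :
    MDifferentiableAt 𝓘(ℝ, JetModel n N) 𝓘(ℝ, TotalModel n N × PhaseModel n N) L.legendre γ :=
  (L.contMDiff_legendre γ).mdifferentiableAt (by simp)

/-- The Legendre transform covers the identity of `Y`; this is the chain rule for that fact. -/
theorem mfderiv_pt_legendre (γ : JetBundle n N π) (w : JetModel n N) :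
    (mfderiv 𝓘(ℝ, TotalModel n N × PhaseModel n N) 𝓘(ℝ, TotalModel n N)
      (PhaseSpace.pt : PhaseSpace n N π → Y) (L.legendre γ)
      (mfderiv 𝓘(ℝ, JetModel n N) 𝓘(ℝ, TotalModel n N × PhaseModel n N) L.legendre γ w) :
        TotalModel n N) = dPt γ w := by
  have h := mfderiv_comp (I := 𝓘(ℝ, JetModel n N)) γ
    ((PhaseSpace.contMDiff_pt (L.legendre γ)).mdifferentiableAt (by simp))
    (L.mdifferentiableAt_legendre γ)
  exact (DFunLike.congr_fun h w).symm

/-- `Θ` evaluates a form on projections to `TY`, and `𝔽𝓛` does not change these projections. So the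
Cartan form involves `𝔽𝓛` but not its derivative, and it vanishes as soon as one argument is
vertical over `Y`. -/
theorem cartanForm_apply (γ : JetBundle n N π) (u : Fin (n + 1) → JetModel n N) :
    L.cartanForm γ u = (L.legendre γ).form.1 (fun i => dPt γ (u i)) :=
  congrArg (L.legendre γ).form.1 (funext fun i => L.mfderiv_pt_legendre γ (u i))

theorem inChart_cartanForm (a : AdaptedChart n N π) {q : JetModel n N}
    (hq : q ∈ a.jetHomeo.target) (u : Fin (n + 1) → JetModel n N) :
    L.cartanForm.inChart a.jetHomeo q u = (L.coordForm a q).1 (fun i => (u i).1) := by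
  have hy : (L.legendre (a.jetHomeo.symm q)).pt ∈ a.tot.source :=
    a.tot.map_target (a.mem_jetHomeo_target.1 hq)
  refine (L.cartanForm_apply (a.jetHomeo.symm q) (fun i => mfderiv 𝓘(ℝ, JetModel n N)
    𝓘(ℝ, JetModel n N) a.jetHomeo.symm q (u i))).trans ?_
  rw [coordForm, AdaptedChart.phaseCoord, dif_pos hy]
  exact congrArg (L.legendre (a.jetHomeo.symm q)).form.1 (funext fun i => dPt_symm a hq (u i))

theorem isSmooth_cartanForm : L.cartanForm.IsSmooth := by
  intro γ
  obtain ⟨a, ha, -⟩ := γ.exists_chartAt_eq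
  rw [ha]
  refine contDiffOn_form_iff fun u => ?_
  have h1 : ContDiffOn ℝ ∞ ((PhaseModel n N).subtypeL ∘ L.coordForm a) a.jetHomeo.target :=
    ContinuousLinearMap.contDiff _ |>.comp_contDiffOn (L.contDiffOn_coordForm a)
  exact (contDiffOn_form_apply h1 (contDiffOn_const (c := fun i => (u i).1))).congr
    fun q hq => L.inChart_cartanForm a hq u

end Lagrangian

section Equivariance
variable {G : Type*} [Group G] [MulAction G X] [MulAction G Y] [hG : IsAutAction n N G π]

/-- Differentiates the relation `pt ∘ η_{J¹Y} = η_Y ∘ pt`. -/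
theorem dPt_jetLift (g : G) (γ : JetBundle n N π) (w : JetModel n N) :
    dPt (jetLift n N π g γ)
      (mfderiv 𝓘(ℝ, JetModel n N) 𝓘(ℝ, JetModel n N) (jetLift n N π g) γ w) =
      dSmul (TotalModel n N) g γ.pt (dPt γ w) := by
  have h1 := mfderiv_comp (I := 𝓘(ℝ, JetModel n N)) γ
    (mdifferentiableAt_pt (jetLift n N π g γ))
    ((contMDiff_jetLift g γ).mdifferentiableAt (by simp))
  have h2 := mfderiv_comp (I := 𝓘(ℝ, JetModel n N)) γ
    ((hG.contMDiff_tot g γ.pt).mdifferentiableAt (by simp)) (mdifferentiableAt_pt γ)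
  exact (DFunLike.congr_fun h1 w).symm.trans (DFunLike.congr_fun h2 w)

/-- By equivariance the form at the moved jet is `(η_Y⁻¹)^*` of the form at `γ`, while the projected
arguments are moved by `T η_Y`. The two effects cancel. -/
theorem Lagrangian.pullback_cartanForm (L : Lagrangian n N π) (hL : L.IsEquivariant G) (g : G) :
    L.cartanForm.pullback (jetLift n N π g) = L.cartanForm := by
  funext γ
  refine ContinuousAlternatingMap.ext fun u => ?_
  let u' : Fin (n + 1) → JetModel n N := fun i =>
    mfderiv 𝓘(ℝ, JetModel n N) 𝓘(ℝ, JetModel n N) (jetLift n N π g) γ (u i)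
  refine (L.cartanForm_apply (jetLift n N π g γ) u').trans
    (Eq.trans ?_ (L.cartanForm_apply γ u).symm)
  have h1 : ∀ (z z' : PhaseSpace n N π) (w : Fin (n + 1) → TotalModel n N), z = z' →
      z.form.1 w = z'.form.1 w := by
    rintro z _ w rfl; rfl
  refine (h1 _ _ _ (L.phaseLift_legendre hL g γ).symm).trans ?_
  refine congrArg (L.legendre γ).form.1 (funext fun i => ?_)
  have h2 := dSmul_inv_dSmul (H := TotalModel n N) hG.contMDiff_tot g γ.pt (dPt γ (u i))
  exact (congrArg (dSmul (TotalModel n N) g⁻¹ (g • γ.pt)) (dPt_jetLift g γ (u i))).trans h2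

variable {𝔤 : Type*} [AddCommGroup 𝔤] [Module ℝ 𝔤] [TopologicalSpace 𝔤]
  [IsTopologicalAddGroup 𝔤] [ContinuousSMul ℝ 𝔤] [TopologicalSpace G] [ChartedSpace 𝔤 G]
  [IsManifold 𝓘(ℝ, TotalModel n N) ∞ Y] [hS : IsSmoothAction n N 𝔤 G X Y]

theorem isSmoothFamily_jetLift (ξ : 𝔤) :
    IsSmoothFamily (JetModel n N) (fun t => jetLift n N π (chartLine G ξ t)) (lineDomain G ξ) where
  isOpen := isOpen_lineDomain ξ
  zero_mem := zero_mem_lineDomain ξ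
  smooth := contMDiffOn_jetLift (isOpen_lineDomain ξ) (contMDiffOn_chartLine_smul hS.tot ξ)
  apply_zero γ := (congrArg (fun g : G => jetLift n N π g γ) (chartLine_zero ξ)).trans
    (jetLift_one γ)

/-- The generator on `J¹Y` projects to the generator on `Y`, the only part of it that the Cartan
form detects. -/
theorem dPt_jetGenerator (ξ : 𝔤) (γ : JetBundle n N π) :
    dPt γ (jetGenerator n N G π ξ γ) =
      generator (H := TotalModel n N) (fun (g : G) (y : Y) => g • y) ξ γ.pt :=
  have h := isSmoothFamily_jetLift (n := n) (N := N) (π := π) (G := G) ξ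
  (mfderiv_comp_curve (f := fun t => jetLift n N π (chartLine G ξ t) γ) (h.apply_zero γ)
    (h.mdifferentiableAt γ) (mdifferentiableAt_pt γ)).symm

namespace Lagrangian
variable (L : Lagrangian n N π)

/-- Equivariance makes the curve `η_Z(t)(𝔽𝓛 γ)` the image under `𝔽𝓛` of a differentiable curve in
`J¹Y`. Its velocity is then given by the chain rule, so differentiability of the action on `Z` is
not a separate matter. -/
theorem mfderiv_legendre_jetGenerator (hL : L.IsEquivariant G) (ξ : 𝔤) (γ : JetBundle n N π) :
    (mfderiv 𝓘(ℝ, JetModel n N) 𝓘(ℝ, TotalModel n N × PhaseModel n N) L.legendre γ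
      (jetGenerator n N G π ξ γ) : TotalModel n N × PhaseModel n N) =
      phaseGenerator n N G π ξ (L.legendre γ) := by
  have h := isSmoothFamily_jetLift (n := n) (N := N) (π := π) (G := G) ξ
  have h1 := mfderiv_comp_curve (f := fun t => jetLift n N π (chartLine G ξ t) γ) (h.apply_zero γ)
    (h.mdifferentiableAt γ) (L.mdifferentiableAt_legendre γ)
  have h2 : (fun t => L.legendre (jetLift n N π (chartLine G ξ t) γ)) =
      fun t => phaseLift n N π (chartLine G ξ t) (L.legendre γ) :=
    funext fun t => (L.phaseLift_legendre hL _ γ).symm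
  have h3 := congrArg (β := TotalModel n N × PhaseModel n N) (fun f : ℝ → PhaseSpace n N π =>
    mfderiv 𝓘(ℝ, ℝ) 𝓘(ℝ, TotalModel n N × PhaseModel n N) f 0 (1 : ℝ)) h2
  exact h1.symm.trans h3

/-- Since `ξ_{J¹Y}` and `ξ_Z` are related by `𝔽𝓛`, the interior product with them commutes with the
pullback of `Θ`. -/
theorem lagrangianMomentumMap_eq_interior (hL : L.IsEquivariant G) (ξ : 𝔤) :
    L.lagrangianMomentumMap G ξ = L.cartanForm.interior (jetGenerator n N G π ξ) := by
  funext γ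
  refine ContinuousAlternatingMap.ext fun u => ?_
  refine congrArg (canonicalForm n N π (L.legendre γ)) (funext fun i => ?_)
  refine Fin.cases ?_ (fun j => ?_) i
  · exact (L.mfderiv_legendre_jetGenerator hL ξ γ).symm
  · rfl

/-- At a fixed jet `ξ` enters only through its generator on `Y`, inserted in the first slot of a
fixed form. That generator is a continuous linear function of `ξ`, and the insertion and pullback by
`dPt γ` are continuous and linear. -/
theorem exists_lagrangianMomentumMap_clm (hL : L.IsEquivariant G) (γ : JetBundle n N π) :
    ∃ T : 𝔤 →L[ℝ] JetModel n N [⋀^Fin n]→L[ℝ] ℝ, ∀ ξ,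
      (L.lagrangianMomentumMap G ξ γ : JetModel n N [⋀^Fin n]→L[ℝ] ℝ) = T ξ := by
  obtain ⟨f', hf'⟩ := exists_generator_clm (IsSmoothAction.tot (n := n) (N := N) (𝔤 := 𝔤) (G := G) (X := X)
    (Y := Y)) γ.pt
  let z : TotalModel n N [⋀^Fin (n + 1)]→L[ℝ] ℝ := (L.legendre γ).form.1
  refine ⟨(ContinuousAlternatingMap.compContinuousLinearMapCLM (𝕜 := ℝ) (F := ℝ)
    (ι := Fin n) (dPt γ)).comp (z.curryLeft.comp f'), fun ξ => ?_⟩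
  rw [L.lagrangianMomentumMap_eq_interior hL]
  refine ContinuousAlternatingMap.ext fun u => ?_
  refine (L.cartanForm_apply γ (Matrix.vecCons (jetGenerator n N G π ξ γ) u)).trans ?_
  refine congrArg z (funext fun i => ?_)
  refine Fin.cases ?_ (fun j => ?_) i
  · exact (dPt_jetGenerator ξ γ).trans (hf' ξ)
  · rfl

/-- After rewriting `J^𝓛(ξ)` as `ξ_{J¹Y} ⌟ Θ_𝓛`, the momentum equation is Cartan's formula for the
invariant form `Θ_𝓛`; the sign in `Ω_𝓛 = -dΘ_𝓛` is the sign in that formula. -/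
theorem isCovariantMomentumMap (hL : L.IsEquivariant G) :
    IsCovariantMomentumMap (𝔤 := 𝔤) n N G π L.multisymplecticForm
      (L.lagrangianMomentumMap G) where
  linear γ := by
    obtain ⟨T, hT⟩ := L.exists_lagrangianMomentumMap_clm (𝔤 := 𝔤) hL γ
    rw [show (fun ξ : 𝔤 => (L.lagrangianMomentumMap G ξ γ : JetModel n N [⋀^Fin n]→L[ℝ] ℝ)) = T
      from funext hT]
    exact T.toLinearMap.isLinear
  continuous γ := by
    obtain ⟨T, hT⟩ := L.exists_lagrangianMomentumMap_clm (𝔤 := 𝔤) hL γ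
    exact T.continuous.congr fun ξ => (hT ξ).symm
  smooth ξ := by
    rw [L.lagrangianMomentumMap_eq_interior hL]
    exact (isSmoothFamily_jetLift ξ).isSmooth_interior L.isSmooth_cartanForm
  interior_eq ξ := by
    rw [L.lagrangianMomentumMap_eq_interior hL]
    exact (isSmoothFamily_jetLift ξ).d_interior L.isSmooth_cartanForm
      fun t _ => L.pullback_cartanForm hL _

end Lagrangian
end Equivariance
end FieldTheory
end

theorem proposition4p6 {n N : ℕ}
    {X : Type*} [TopologicalSpace X] [ChartedSpace (BaseModel n) X]
    [IsManifold 𝓘(ℝ, BaseModel n) ∞ X]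
    {Y : Type*} [TopologicalSpace Y] [ChartedSpace (TotalModel n N) Y]
    [IsManifold 𝓘(ℝ, TotalModel n N) ∞ Y]
    (π : Y → X) [IsSmoothFiberBundle n N π]
    {𝔤 : Type*} [AddCommGroup 𝔤] [Module ℝ 𝔤] [TopologicalSpace 𝔤] [IsTopologicalAddGroup 𝔤]
    [ContinuousSMul ℝ 𝔤] [LocallyConvexSpace ℝ 𝔤] [T2Space 𝔤]
    {G : Type*} [Group G] [TopologicalSpace G] [ChartedSpace 𝔤 G] [IsLieGroup 𝔤 G]
    [MulAction G X] [MulAction G Y] [IsAutAction n N G π] [IsSmoothAction n N 𝔤 G X Y]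
    (L : Lagrangian n N π) (hL : L.IsEquivariant G) :
    (∀ (g : G) (γ : JetBundle n N π),
      phaseLift n N π g (L.legendre γ) = L.legendre (jetLift n N π g γ)) ∧
    (L.cartanForm.IsSmooth ∧
      ∀ g : G, L.cartanForm.pullback (jetLift n N π g) = L.cartanForm) ∧
    (IsCovariantMomentumMap (𝔤 := 𝔤) n N G π L.multisymplecticForm (L.lagrangianMomentumMap G) ∧
      ∀ ξ : 𝔤, L.lagrangianMomentumMap G ξ =
        L.cartanForm.interior (jetGenerator n N G π ξ)) :=
  ⟨L.phaseLift_legendre hL, ⟨L.isSmooth_cartanForm, L.pullback_cartanForm hL⟩,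
    L.isCovariantMomentumMap hL, L.lagrangianMomentumMap_eq_interior hL⟩
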